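/- Let $\nu>0$ and, for each $n\ge 1$, let $W=W_n\in\mathbb{C}^{n\times n}$ be a random matrix with i.i.d. entries of law $\mathcal{N}_{\mathbb C}(0,\nu)$ (circularly symmetric complex Gaussian: independent real and imaginary parts of law $\mathcal N(0,\nu/2)$). Let $J$ be the $n\times n$ all-ones matrix, $\operatorname{per}(A)=\sum_{\sigma\in S_n}\prod_i A_{i\sigma(i)}$, and $G_W(z)=\frac1{n!}\operatorname{per}(J+zW)$. On $\mathbb{C}^{n\times n}$ with its standard Hermitian inner product let $P_0,P_r,P_c,P_m$ be the orthogonal projections onto $\operatorname{span}\{J\}$, $\{x\mathbf 1^T:\mathbf 1^Tx=0\}$, $\{\mathbf 1y^T:\mathbf 1^Ty=0\}$ and $\{M:M\mathbf 1=0,\ \mathbf 1^TM=0\}$; put $P_\parallel=P_0+P_r+P_c$, $B=-\frac1nP_\parallel+\frac1{n(n-1)}P_m$, $w=\operatorname{vec}(W)$, and $$D_1(W)=\frac1n\sum_{i,j}W_{ij},\qquad D_2(W)=w^TBw,\qquad X^{(2)}_W(z)=\exp\Bigl(-zD_1(W)-\frac{z^2}{2}D_2(W)\Bigr)G_W(z).$$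 Whenever $u\mapsto\operatorname{per}(J+uW)$ has no zero on the segment $[0,z]$, $\log\operatorname{per}(J+zW)$ denotes the value at $z$ of the branch continued along this segment from the real value $\log(n!)$ at $u=0$, that is, $\log (n!)+\int_0^1 \frac{z\,G_W'(tz)}{G_W(tz)}\,dt$ (off this event the value of the integral is immaterial). (a) Let $z=z_n\in\mathbb{C}$ satisfy $\nu^3|z|^6/n^2\to0$ as $n\to\infty$. Then $X^{(2)}_W(z)\to1$ in probability; with probability tending to $1$, $\operatorname{per}(J+uW)\neq0$ for all $|u|\le|z|$ (so that the logarithm is well defined); and $$\log\operatorname{per}(J+zW)=\log(n!)+zD_1(W)+\frac{z^2}{2}D_2(W)+O_{\mathbb P}\!\left(\frac{\nu^{3/2}|z|^3}{n}\right),$$ with absolute implicit constants: there is a function $K:(0,\infty)\to\mathbb{R}$, independent of $\nu$ and of the sequence $(z_n)$, such that for every $\varepsilon>0$ and all sufficiently large $n$ (depending on $\varepsilon$, $\nu$ and $(z_n)$), the probability that the remainder exceeds $K(\varepsilon)\,\nu^{3/2}|z|^3/n$ in absolute value is at most $\varepsilon$. (b) If $z_n=o(n^{1/3})$ and $z_n\ne0$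 for all large $n$, then $$\frac{\log\operatorname{per}(J+z_nW)-\log(n!)}{z_n}\xrightarrow{d}\mathcal{N}_{\mathbb C}(0,\nu).$$ -/

import Mathlib

open MeasureTheory ProbabilityTheory Filter Topology
open scoped NNReal ENNReal

noncomputable section

namespace RandomPermanent

/-- The circularly symmetric complex Gaussian law `N_ℂ(0, ν)`: the real and imaginary parts are
independent real Gaussians of mean `0` and variance `ν / 2`, so that `𝔼 |w|² = ν`. -/
def complexGaussian (ν : ℝ≥0) : Measure ℂ :=
  ((gaussianReal 0 (ν / 2)).prod (gaussianReal 0 (ν / 2))).map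
    (fun p : ℝ × ℝ => (⟨p.1, p.2⟩ : ℂ))

instance instIsProbabilityMeasureComplexGaussian (ν : ℝ≥0) :
    IsProbabilityMeasure (complexGaussian ν) :=
  Measure.isProbabilityMeasure_map
    (Complex.measurableEquivRealProd.symm.measurable.aemeasurable)

/-- The random matrix `W` has i.i.d. entries of law `N_ℂ(0, ν)`. -/
structure IsGaussianMatrix {Ω : Type*} [MeasurableSpace Ω] (P : Measure Ω) (ν : ℝ≥0) {n : ℕ}
    (W : Ω → Matrix (Fin n) (Fin n) ℂ) : Prop where
  indep : iIndepFun (fun (e : Fin n × Fin n) (ω : Ω) => W ω e.1 e.2) P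
  law : ∀ i j, HasLaw (fun ω => W ω i j) (complexGaussian ν) P

/-- The all-ones matrix `J`. -/
def J (n : ℕ) : Matrix (Fin n) (Fin n) ℂ := Matrix.of fun _ _ => 1

/-- `G_W(z) = per (J + z W) / n!`. -/
def G {n : ℕ} (W : Matrix (Fin n) (Fin n) ℂ) (z : ℂ) : ℂ :=
  (1 / (n.factorial : ℂ)) * (J n + z • W).permanent

/-- `ℂ^{n × n}` with its standard Hermitian inner product. -/
abbrev MatSpace (n : ℕ) : Type := EuclideanSpace ℂ (Fin n × Fin n)

/-- The vectorisation of a matrix. -/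
def vec {n : ℕ} (W : Matrix (Fin n) (Fin n) ℂ) : MatSpace n :=
  WithLp.toLp 2 fun e => W e.1 e.2

/-- `span {J}`. -/
def H0 (n : ℕ) : Submodule ℂ (MatSpace n) :=
  Submodule.span ℂ {vec (J n)}

/-- `span {x 1ᵀ : 1ᵀ x = 0}`. -/
def Hr (n : ℕ) : Submodule ℂ (MatSpace n) :=
  Submodule.span ℂ {v | ∃ x : Fin n → ℂ, ∑ i, x i = 0 ∧ v = vec (Matrix.of fun i _ => x i)}

/-- `span {1 yᵀ : 1ᵀ y = 0}`. -/
def Hc (n : ℕ) : Submodule ℂ (MatSpace n) :=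
  Submodule.span ℂ {v | ∃ y : Fin n → ℂ, ∑ j, y j = 0 ∧ v = vec (Matrix.of fun _ j => y j)}

/-- `span {M : M 1 = 0, 1ᵀ M = 0}`. -/
def Hm (n : ℕ) : Submodule ℂ (MatSpace n) :=
  Submodule.span ℂ {v | ∃ M : Matrix (Fin n) (Fin n) ℂ,
    (∀ i, ∑ j, M i j = 0) ∧ (∀ j, ∑ i, M i j = 0) ∧ v = vec M}

/-- `P_∥ = P_0 + P_r + P_c`, a sum of orthogonal projections. -/
def Ppar (n : ℕ) : MatSpace n →L[ℂ] MatSpace n :=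
  (H0 n).starProjection + (Hr n).starProjection + (Hc n).starProjection

/-- `B = -(1/n) P_∥ + (1/(n(n-1))) P_m`. -/
def B (n : ℕ) : MatSpace n →L[ℂ] MatSpace n :=
  (-(1 / (n : ℂ))) • Ppar n + (1 / ((n : ℂ) * ((n : ℂ) - 1))) • (Hm n).starProjection

/-- `D₁(W) = aᵀ w` with `a = (1/n) 1` and `w = vec W`. -/
def D1 {n : ℕ} (W : Matrix (Fin n) (Fin n) ℂ) : ℂ :=
  ∑ e, (1 / (n : ℂ)) * vec W e

/-- `D₂(W) = wᵀ B w` with `w = vec W` (a bilinear form: no complex conjugation). -/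
def D2 {n : ℕ} (W : Matrix (Fin n) (Fin n) ℂ) : ℂ :=
  ∑ e, vec W e * B n (vec W) e

/-- The second-order reweighted permanent `X_W^{(2)}(z)`. -/
def X2 {n : ℕ} (W : Matrix (Fin n) (Fin n) ℂ) (z : ℂ) : ℂ :=
  Complex.exp (-(z * D1 W) - z ^ 2 / 2 * D2 W) * G W z

/-- The branch of `log per (J + z W)` obtained by continuation along the segment from `0` to `z`,
starting from the real value `log n!` at `0`:
`log n! + ∫₀¹ z G_W'(t z) / G_W(t z) dt`. It is meaningful when `per (J + t z W) ≠ 0` for all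
`t ∈ [0, 1]`. -/
def logPer {n : ℕ} (W : Matrix (Fin n) (Fin n) ℂ) (z : ℂ) : ℂ :=
  (Real.log n.factorial : ℂ) +
    ∫ t in (0 : ℝ)..1, z * deriv (G W) ((t : ℂ) * z) / G W ((t : ℂ) * z)

theorem differentiable_G {n : ℕ} (W : Matrix (Fin n) (Fin n) ℂ) : Differentiable ℂ (G W) := by
  unfold G Matrix.permanent
  simp only [Matrix.add_apply, Matrix.smul_apply, smul_eq_mul]
  fun_prop

theorem G_zero {n : ℕ} (W : Matrix (Fin n) (Fin n) ℂ) : G W 0 = 1 := by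
  have h : (n.factorial : ℂ) ≠ 0 := by exact_mod_cast n.factorial_ne_zero
  simp [G, J, Matrix.permanent, Fintype.card_perm, h]

/-- `logPer` is a logarithm of the permanent wherever the continuation is possible. -/
theorem exp_logPer {n : ℕ} (W : Matrix (Fin n) (Fin n) ℂ) (z : ℂ)
    (h : ∀ t ∈ Set.Icc (0 : ℝ) 1, (J n + ((t : ℂ) * z) • W).permanent ≠ 0) :
    Complex.exp (logPer W z) = (J n + z • W).permanent := by
  have hn : (n.factorial : ℂ) ≠ 0 := by exact_mod_cast n.factorial_ne_zero
  have hG : ∀ t ∈ Set.Icc (0 : ℝ) 1, G W ((t : ℂ) * z) ≠ 0 := fun t ht =>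
    mul_ne_zero (one_div_ne_zero hn) (h t ht)
  have hcd : Continuous (deriv (G W)) :=
    ((differentiable_G W).contDiff (n := 1)).continuous_deriv le_rfl
  have hcG : Continuous (G W) := (differentiable_G W).continuous
  set g : ℝ → ℂ := fun t => z * deriv (G W) ((t : ℂ) * z) / G W ((t : ℂ) * z) with hg
  have hgc : ContinuousOn g (Set.Icc 0 1) := by
    refine ContinuousOn.div ?_ ?_ hG
    · exact (by fun_prop : Continuous fun t : ℝ => z * deriv (G W) ((t : ℂ) * z)).continuousOn
    · exact (by fun_prop : Continuous fun t : ℝ => G W ((t : ℂ) * z)).continuousOn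
  set g' : ℝ → ℂ := Set.IccExtend (zero_le_one' ℝ) ((Set.Icc (0 : ℝ) 1).domRestrict g)
  have hg'c : Continuous g' := hgc.domRestrict.Icc_extend'
  have hgg' : ∀ t ∈ Set.Icc (0 : ℝ) 1, g' t = g t := fun t ht => by
    simp only [g', Set.IccExtend_of_mem _ _ ht]
    rfl
  have hint : ∫ t in (0 : ℝ)..1, g t = ∫ t in (0 : ℝ)..1, g' t := by
    refine intervalIntegral.integral_congr fun t ht => (hgg' t ?_).symm
    simpa using ht
  let F : ℝ → ℂ := fun s => Complex.exp (-∫ t in (0 : ℝ)..s, g' t) * G W ((s : ℂ) * z)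
  have hFd : ∀ s : ℝ, HasDerivAt F
      (Complex.exp (-∫ t in (0 : ℝ)..s, g' t) * (-g' s) * G W ((s : ℂ) * z)
        + Complex.exp (-∫ t in (0 : ℝ)..s, g' t) * (deriv (G W) ((s : ℂ) * z) * z)) s := by
    intro s
    have h1 : HasDerivAt (fun s : ℝ => ∫ t in (0 : ℝ)..s, g' t) (g' s) s :=
      intervalIntegral.integral_hasDerivAt_right (hg'c.intervalIntegrable _ _)
        (hg'c.stronglyMeasurableAtFilter _ _) hg'c.continuousAt
    have h2 : HasDerivAt (fun s : ℝ => (s : ℂ) * z) z s := by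
      simpa using (Complex.ofRealCLM.hasDerivAt (x := s)).mul_const z
    have h3 : HasDerivAt (fun s : ℝ => G W ((s : ℂ) * z)) (deriv (G W) ((s : ℂ) * z) * z) s :=
      ((differentiable_G W) _).hasDerivAt.comp s h2
    exact (h1.neg.cexp).mul h3
  have hconst := constant_of_has_deriv_right_zero (f := F) (a := 0) (b := 1)
    (fun s _ => (hFd s).continuousAt.continuousWithinAt) (fun s hs => by
      have hs' : s ∈ Set.Icc (0 : ℝ) 1 := ⟨hs.1, hs.2.le⟩
      have := (hFd s).hasDerivWithinAt (s := Set.Ici s)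
      rw [hgg' s hs'] at this
      convert this using 1
      have := hG s hs'
      simp only [hg]
      rw [mul_assoc, neg_mul, div_mul_cancel₀ _ this]
      ring) 1 (by simp)
  simp only [F, Complex.ofReal_one, one_mul, Complex.ofReal_zero, zero_mul, G_zero, mul_one,
    intervalIntegral.integral_same, neg_zero, Complex.exp_zero] at hconst
  have key : Complex.exp (∫ t in (0 : ℝ)..1, g t) = G W z := by
    rw [hint]
    rw [Complex.exp_neg, inv_mul_eq_one₀ (Complex.exp_ne_zero _)] at hconst
    exact hconst
  have hlog : Complex.exp (Real.log n.factorial : ℂ) = n.factorial := by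
    rw [← Complex.ofReal_exp, Real.exp_log (by exact_mod_cast n.factorial_pos)]
    simp
  rw [logPer, Complex.exp_add, key, hlog, G, ← mul_assoc, mul_one_div_cancel hn, one_mul]

end RandomPermanent

end

open RandomPermanent

/-! After standardising, let ν = 1. Write W i j = x i + y j + M i j with x the row means, y the
centred column means and M doubly centred. Since 1 + u W i j = (1 + u x i)(1 + u y j)(1 + u Z i j),
with Z i j = (M i j - u x i y j) / ((1 + u x i)(1 + u y j)), and every permutation meets each row
and column once, G_W(u) is ∏ (1 + u x i) · ∏ (1 + u y j) · G_Z(u) (`G_mat_eq`). The factor exp(-u D₁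
- u² D₂ / 2) removes the first two orders of the logarithms of the two products. For |u| of order
n^(1/3) the higher orders are bounded, because power sums of x and y are small by cancellation
(`IsTypical.norm_prod_le`). Throughout, N = n^(1/6), so this radius is N ^ 2.

The core is that G_Z(u) has bounded first moment there (`lintegral_norm_G_le`). The means are held
fixed while M, which is independent of them, is integrated. The k-th coefficient of G_Z is a
polynomial of degree at most k in the Gaussians. By Wick's formula its second moment is at most a
product of second moments of elementary symmetric polynomials, one for rows and one for columns
(`lintegral_embSum₂_le`). The deterministic term -u x i y j is absorbed as the value of one more
Gaussian coordinate, at the price of a reproducing kernel bound. The symmetric polynomials are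
coefficients of ∏ (1 + t v i) with v centred. The centring lets the weight exp(-t v i) be inserted
for free, after which the coordinates decouple. The k-th coefficient is then O(n^(-1/3)) ^ k in
mean, and a geometric series closes the estimate.

Markov's inequality and Cauchy's formula turn this into a bound for the supremum of |X2 - 1| over a
disc of radius c n^(1/3), with high probability. By the choice of D₁ and D₂, X2 - 1 vanishes to
third order at 0 (`X2_sub_one_isBigO`), so Schwarz's lemma improves the bound to C |u|³ / n. This
gives (a), as the remainder of the logarithm is log X2. For (b), D₁ is exactly Gaussian, while z D₂
/ 2 and the remainder divided by z tend to 0 in probability. -/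

namespace RandomPermanent

/-! ### Standard complex Gaussian vectors and unitary invariance. -/

/-- The law of a family of independent standard complex Gaussians. -/
noncomputable abbrev gaussPi (E : Type*) [Fintype E] : Measure (E → ℂ) :=
  Measure.pi fun _ => complexGaussian 1

/-- Variance one suffices for all the estimates; general ν is reached by scaling at the end. The
density serves for explicit moments and for translations. -/
theorem complexGaussian_one_eq_withDensity :
    complexGaussian 1 =
      volume.withDensity fun z : ℂ => ENNReal.ofReal (Real.pi⁻¹ * Real.exp (-‖z‖ ^ 2)) := by
  have hm : Measurable fun p : ℝ × ℝ => (⟨p.1, p.2⟩ : ℂ) :=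
    Complex.measurableEquivRealProd.symm.measurable
  have hd : Measurable fun z : ℂ => ENNReal.ofReal (Real.pi⁻¹ * Real.exp (-‖z‖ ^ 2)) := by
    fun_prop
  have h2 : (1 / 2 : ℝ≥0) ≠ 0 := by norm_num
  ext s hs
  rw [complexGaussian, Measure.map_apply hm hs, gaussianReal_of_var_ne_zero _ h2,
    prod_withDensity (by fun_prop) (by fun_prop), ← Measure.volume_eq_prod,
    withDensity_apply _ (hm hs), withDensity_apply _ hs,
    ← (Complex.volume_preserving_equiv_real_prod.symm).setLIntegral_comp_preimage hs hd]
  refine setLIntegral_congr_fun (hm hs) fun p _ => ?_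
  simp only [gaussianPDF]
  rw [← ENNReal.ofReal_mul (gaussianPDFReal_nonneg _ _ _)]
  congr 1
  simp only [gaussianPDFReal, Complex.measurableEquivRealProd_symm_apply]
  rw [← Complex.normSq_eq_norm_sq, Complex.normSq_mk]
  have h1 : (((1 / 2 : ℝ≥0)) : ℝ) = 1 / 2 := by simp
  rw [h1, show (2 * Real.pi * (1 / 2 : ℝ)) = Real.pi by ring,
    mul_mul_mul_comm, ← Real.exp_add, ← mul_inv, Real.mul_self_sqrt Real.pi_pos.le]
  congr 2
  ring

theorem lintegral_complexGaussian_one {f : ℂ → ℝ≥0∞} (hf : Measurable f) :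
    ∫⁻ z, f z ∂complexGaussian 1 =
      ∫⁻ z : ℂ, ENNReal.ofReal (Real.pi⁻¹ * Real.exp (-‖z‖ ^ 2)) * f z := by
  rw [complexGaussian_one_eq_withDensity, lintegral_withDensity_eq_lintegral_mul _ (by fun_prop) hf]
  rfl

theorem charFunDual_complexGaussian (ν : ℝ≥0) (L : StrongDual ℝ ℂ) :
    charFunDual (complexGaussian ν) L
      = Complex.exp (-(ν * ((L 1) ^ 2 + (L Complex.I) ^ 2) / 4 : ℝ)) := by
  have key : complexGaussian ν = ((gaussianReal 0 (ν / 2)).prod (gaussianReal 0 (ν / 2))).map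
      (Complex.equivRealProdCLM.symm : ℝ × ℝ →L[ℝ] ℂ) := rfl
  rw [key, charFunDual_map, charFunDual_prod, charFunDual_eq_charFun_map_one,
    charFunDual_eq_charFun_map_one]
  have aux : ∀ M : StrongDual ℝ ℝ, charFun ((gaussianReal 0 (ν / 2)).map M) 1 =
      Complex.exp (-(ν * (M 1) ^ 2 / 4 : ℝ)) := by
    intro M
    have : (M : ℝ → ℝ) = fun x => (M 1) * x := by
      ext x
      have := M.map_smul x 1
      simp only [smul_eq_mul, mul_one] at this
      rw [this, mul_comm]
    rw [this, gaussianReal_map_const_mul, charFun_gaussianReal]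
    congr 1
    push_cast
    simp
    ring
  rw [aux, aux, ← Complex.exp_add]
  congr 1
  have e1 : (Complex.equivRealProdCLM.symm (1, 0)) = 1 := by
    simp [Complex.equivRealProdCLM_symm_apply]
  have e2 : (Complex.equivRealProdCLM.symm (0, 1)) = Complex.I := by
    simp [Complex.equivRealProdCLM_symm_apply]
  simp [e1, e2]
  ring

theorem clm_apply_eq_re (L : StrongDual ℝ ℂ) (z : ℂ) :
    L z = (((L 1 : ℂ) - L Complex.I * Complex.I) * z).re := by
  conv_lhs => rw [← Complex.re_add_im z]
  have h1 : ((z.re : ℂ)) = z.re • (1 : ℂ) := by simp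
  have h2 : ((z.im : ℂ)) * Complex.I = z.im • Complex.I := by simp
  rw [map_add, h1, h2, map_smul, map_smul]
  simp
  ring

/-- A real-linear functional on `ℂ ^ E` is the real part of a complex-linear one. -/
theorem exists_dual_eq_re {E : Type*} [Fintype E] (L : StrongDual ℝ (E → ℂ)) :
    ∃ a : E → ℂ, ∀ v, L v = (∑ e, a e * v e).re := by
  classical
  refine ⟨fun e => ((L.comp (.single ℝ (fun _ => ℂ) e) 1 : ℂ)
    - (L.comp (.single ℝ (fun _ => ℂ) e) Complex.I : ℂ) * Complex.I), fun v => ?_⟩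
  rw [← L.sum_comp_single, Complex.re_sum]
  exact Finset.sum_congr rfl fun e _ => clm_apply_eq_re _ _

/-- The value depends on `a` only through its Hermitian norm, which is what makes the law invariant
under coisometries. -/
theorem charFunDual_gaussPi {E : Type*} [Fintype E] (L : StrongDual ℝ (E → ℂ)) (a : E → ℂ)
    (ha : ∀ v, L v = (∑ e, a e * v e).re) :
    charFunDual (gaussPi E) L = Complex.exp (-((∑ e, ‖a e‖ ^ 2) / 4 : ℝ)) := by
  classical
  rw [charFunDual_pi, Finset.sum_div, Complex.ofReal_sum, ← Finset.sum_neg_distrib,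
    Complex.exp_sum]
  refine Finset.prod_congr rfl fun e _ => ?_
  rw [charFunDual_complexGaussian]
  have h : ∀ c : ℂ, (L.comp (.single ℝ (fun _ => ℂ) e)) c = (a e * c).re := by
    intro c
    simp [ha, Pi.single_apply]
  rw [h, h]
  congr 4
  rw [← Complex.normSq_eq_norm_sq, Complex.normSq_apply]
  simp
  ring

open scoped Matrix in
theorem dotProduct_star_eq_sum_norm_sq {E : Type*} [Fintype E] (b : E → ℂ) :
    b ⬝ᵥ star b = ((∑ e, ‖b e‖ ^ 2 : ℝ) : ℂ) := by
  simp [dotProduct, Complex.mul_conj, Complex.normSq_eq_norm_sq]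

open scoped Matrix in
/-- A coisometry preserves the standard complex Gaussian law. -/
theorem gaussPi_map_mulVec {E F : Type*} [Fintype E] [Fintype F] [DecidableEq F]
    (A : Matrix F E ℂ) (hA : A * Aᴴ = 1) :
    (gaussPi E).map (fun v => A *ᵥ v) = gaussPi F := by
  let T : (E → ℂ) →L[ℝ] (F → ℂ) := (A.mulVecLin.toContinuousLinearMap).restrictScalars ℝ
  have hT : (fun v => A *ᵥ v) = T := rfl
  rw [hT]
  have : IsProbabilityMeasure ((gaussPi E).map T) :=
    Measure.isProbabilityMeasure_map T.continuous.measurable.aemeasurable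
  refine Measure.ext_of_charFunDual ?_
  ext L
  obtain ⟨a, ha⟩ := exists_dual_eq_re L
  rw [charFunDual_map, charFunDual_gaussPi L a ha, charFunDual_gaussPi _ (a ᵥ* A)]
  · congr 3
    have h2 : (a ᵥ* A) ⬝ᵥ star (a ᵥ* A) = a ⬝ᵥ star a := by
      rw [Matrix.star_vecMul, ← Matrix.dotProduct_mulVec, Matrix.mulVec_mulVec, hA,
        Matrix.one_mulVec]
    rw [dotProduct_star_eq_sum_norm_sq, dotProduct_star_eq_sum_norm_sq] at h2
    rw [Complex.ofReal_injective h2]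
  · intro v
    have : L (T v) = (a ⬝ᵥ (A *ᵥ v)).re := ha _
    rw [ContinuousLinearMap.comp_apply, this, Matrix.dotProduct_mulVec]
    rfl

end RandomPermanent

/-! ### Rotation invariance, subharmonicity and coefficient extraction. -/

namespace RandomPermanent

section Rotation

variable {V : Type*} [AddCommGroup V] [Module ℂ V] [MeasurableSpace V]

/-- Invariance of a measure under multiplication by unimodular scalars. -/
def RotationInvariant (μ : Measure V) : Prop :=
  ∀ c : ℂ, ‖c‖ = 1 → MeasurePreserving (fun v : V => c • v) μ μ

/-- This reduces statements on `V` to one complex variable: inside the integral the function s ↦ h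
(s • v) may be averaged over the unit circle. -/
theorem RotationInvariant.lintegral_eq_average [MeasurableSMul₂ ℂ V] {μ : Measure V} [SFinite μ]
    (hμ : RotationInvariant μ) {Φ : V → ℝ≥0∞} (hΦ : Measurable Φ) :
    ∫⁻ v, Φ v ∂μ = ∫⁻ v, ((ENNReal.ofReal (2 * Real.pi))⁻¹ *
      ∫⁻ θ in Set.Ioc 0 (2 * Real.pi), Φ (circleMap 0 1 θ • v)) ∂μ := by
  have hm : Measurable fun p : V × ℝ => Φ (circleMap 0 1 p.2 • p.1) :=
    hΦ.comp (((continuous_circleMap 0 1).measurable.comp measurable_snd).smul measurable_fst)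
  rw [lintegral_const_mul _ (hm.lintegral_prod_right'),
    lintegral_lintegral_swap hm.aemeasurable]
  have h : ∀ θ, ∫⁻ v, Φ (circleMap 0 1 θ • v) ∂μ = ∫⁻ v, Φ v ∂μ := fun θ =>
    (hμ _ (by simp)).lintegral_comp hΦ
  simp only [h, lintegral_const, Measure.restrict_apply MeasurableSet.univ, Set.univ_inter,
    Real.volume_Ioc, sub_zero]
  rw [mul_comm, mul_assoc, ENNReal.mul_inv_cancel, mul_one]
  · simp [Real.pi_pos]
  · exact ENNReal.ofReal_ne_top

theorem ofReal_circleAverage {g : ℂ → ℝ} (hg : Continuous g) (h0 : ∀ z, 0 ≤ g z) :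
    ENNReal.ofReal (Real.circleAverage g 0 1) = (ENNReal.ofReal (2 * Real.pi))⁻¹ *
      ∫⁻ θ in Set.Ioc 0 (2 * Real.pi), ENNReal.ofReal (g (circleMap 0 1 θ)) := by
  rw [Real.circleAverage_def, smul_eq_mul, ENNReal.ofReal_mul (by positivity),
    ENNReal.ofReal_inv_of_pos (by positivity),
    intervalIntegral.integral_of_le (by positivity), ofReal_integral_eq_lintegral_ofReal]
  · exact (hg.comp (continuous_circleMap 0 1)).integrableOn_Ioc
  · exact ae_of_all _ fun _ => h0 _

/-- The square of `h` is itself holomorphic, so the mean value property for h² and the triangle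
inequality are enough. -/
theorem norm_sq_le_circleAverage {h : ℂ → ℂ} (hh : Differentiable ℂ h) :
    ‖h 0‖ ^ 2 ≤ Real.circleAverage (fun z => ‖h z‖ ^ 2) 0 1 := by
  have h2 : Real.circleAverage (fun z => h z ^ 2) 0 1 = h 0 ^ 2 :=
    ((hh.pow 2).diffContOnCl).circleAverage
  rw [← norm_pow, ← h2, Real.circleAverage_def, Real.circleAverage_def, norm_smul, smul_eq_mul,
    Real.norm_of_nonneg (by positivity)]
  gcongr
  refine (intervalIntegral.norm_integral_le_integral_norm (by positivity)).trans_eq ?_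
  simp

theorem enorm_sq_eq_ofReal (z : ℂ) : ‖z‖ₑ ^ 2 = ENNReal.ofReal (‖z‖ ^ 2) := by
  rw [← ofReal_norm, ENNReal.ofReal_pow (norm_nonneg _)]

variable [MeasurableSMul₂ ℂ V] {μ : Measure V} [IsProbabilityMeasure μ]

/-- Subharmonicity of `‖h‖²` for a rotation invariant law. -/
theorem RotationInvariant.enorm_sq_le_lintegral (hμ : RotationInvariant μ) {h : V → ℂ}
    (hm : Measurable h) (hd : ∀ v, Differentiable ℂ fun s : ℂ => h (s • v)) :
    ‖h 0‖ₑ ^ 2 ≤ ∫⁻ v, ‖h v‖ₑ ^ 2 ∂μ := by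
  rw [hμ.lintegral_eq_average (by fun_prop)]
  calc ‖h 0‖ₑ ^ 2 = ∫⁻ _, ‖h 0‖ₑ ^ 2 ∂μ := by simp
    _ ≤ _ := lintegral_mono fun v => by
      have := ENNReal.ofReal_le_ofReal (norm_sq_le_circleAverage (hd v))
      rw [ofReal_circleAverage (g := fun z => ‖h (z • v)‖ ^ 2) ((hd v).continuous.norm.pow 2) fun _ => by positivity] at this
      simpa only [enorm_sq_eq_ofReal, zero_smul] using this

/-- Parseval on the unit circle: the mean of |p|² is the sum of all squared coefficients, hence
dominates each one. -/
theorem RotationInvariant.lintegral_coeff_le (hμ : RotationInvariant μ) {h : V → ℂ}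
    (hm : Measurable h) (p : V → Polynomial ℂ) (hp : ∀ v s, (p v).eval s = h (s • v)) (k : ℕ) :
    ∫⁻ v, ‖(p v).coeff k‖ₑ ^ 2 ∂μ ≤ ∫⁻ v, ‖h v‖ₑ ^ 2 ∂μ := by
  rw [hμ.lintegral_eq_average (Φ := fun v => ‖h v‖ₑ ^ 2) (by fun_prop)]
  refine lintegral_mono fun v => ?_
  have h1 : ‖(p v).coeff k‖ ^ 2 ≤ Real.circleAverage (fun z => ‖(p v).eval z‖ ^ 2) 0 1 := by
    rw [← Polynomial.sum_sq_norm_coeff_eq_circleAverage]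
    by_cases hk : k ∈ (p v).support
    · exact Finset.single_le_sum (f := fun i => ‖(p v).coeff i‖ ^ 2) (fun _ _ => by positivity) hk
    · rw [Polynomial.notMem_support_iff.mp hk]
      simpa using Finset.sum_nonneg fun i _ => by positivity
  have := ENNReal.ofReal_le_ofReal h1
  rw [ofReal_circleAverage (g := fun z => ‖(p v).eval z‖ ^ 2) ((p v).continuous.norm.pow 2) fun _ => by positivity] at this
  simpa only [enorm_sq_eq_ofReal, hp] using this

end Rotation

open scoped Matrix in
theorem rotationInvariant_gaussPi (E : Type*) [Fintype E] : RotationInvariant (gaussPi E) := by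
  classical
  intro c hc
  refine ⟨measurable_const_smul c, ?_⟩
  have := gaussPi_map_mulVec (c • (1 : Matrix E E ℂ)) (by
    rw [Matrix.conjTranspose_smul, Matrix.conjTranspose_one, smul_mul_smul_comm, mul_one,
      Complex.star_def, Complex.mul_conj, Complex.normSq_eq_norm_sq, hc]
    simp)
  simpa [Matrix.smul_mulVec] using this

theorem measurePreserving_gaussPi_unit :
    MeasurePreserving (MeasurableEquiv.funUnique Unit ℂ) (gaussPi Unit) (complexGaussian 1) :=
  measurePreserving_funUnique (complexGaussian 1) Unit

theorem rotationInvariant_complexGaussian : RotationInvariant (complexGaussian 1) := by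
  intro c hc
  have h1 := measurePreserving_gaussPi_unit
  have h2 := (h1.comp (rotationInvariant_gaussPi Unit c hc)).comp (h1.symm _)
  exact h2

open scoped Matrix in
/-- Resampling the component of a Gaussian vector in the range of an orthogonal projection. -/
theorem measurePreserving_sub_add_mulVec {E : Type*} [Fintype E] [DecidableEq E]
    {P : Matrix E E ℂ} (hP : P * P = P) (hPh : Pᴴ = P) :
    MeasurePreserving (fun p : (E → ℂ) × (E → ℂ) => (p.1 - P *ᵥ p.1) + P *ᵥ p.2)
      ((gaussPi E).prod (gaussPi E)) (gaussPi E) := by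
  -- The block row (1 - P, P) is a coisometry, since (1 - P)(1 - P)ᴴ + P Pᴴ = (1 - P) + P.
  let A : Matrix E (E ⊕ E) ℂ := Matrix.fromCols (1 - P) P
  have hA : A * Aᴴ = 1 := by
    simp only [A, Matrix.conjTranspose_fromCols_eq_fromRows_conjTranspose,
      Matrix.fromCols_mul_fromRows, Matrix.conjTranspose_sub, Matrix.conjTranspose_one, hPh, hP]
    rw [mul_sub, mul_one, sub_mul, one_mul, hP]
    simp
  have h1 : MeasurePreserving (fun v => A *ᵥ v) (gaussPi (E ⊕ E)) (gaussPi E) :=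
    ⟨by fun_prop, gaussPi_map_mulVec A hA⟩
  have h2 := h1.comp (measurePreserving_sumPiEquivProdPi_symm
    (fun _ : E ⊕ E => complexGaussian 1))
  convert h2 using 1
  ext p : 1
  simp only [A, Function.comp_apply, Matrix.fromCols_mulVec]
  rw [Matrix.sub_mulVec, Matrix.one_mulVec]
  rfl

open scoped Matrix in
/-- Averaging out a component only decreases the second moment of a holomorphic function. -/
theorem lintegral_comp_sub_mulVec_le {E : Type*} [Fintype E] [DecidableEq E]
    {P : Matrix E E ℂ} (hP : P * P = P) (hPh : Pᴴ = P) {h : (E → ℂ) → ℂ} (hm : Measurable h)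
    (hd : ∀ v w, Differentiable ℂ fun s : ℂ => h (v + s • w)) :
    ∫⁻ v, ‖h (v - P *ᵥ v)‖ₑ ^ 2 ∂gaussPi E ≤ ∫⁻ v, ‖h v‖ₑ ^ 2 ∂gaussPi E := by
  have hmp := measurePreserving_sub_add_mulVec hP hPh
  have hf : Measurable fun v => ‖h v‖ₑ ^ 2 := by fun_prop
  conv_rhs => rw [← hmp.lintegral_comp hf]
  rw [lintegral_prod _ (by fun_prop)]
  refine lintegral_mono fun v => ?_
  -- With the component v - P v frozen, h (v - P v) is the value at w = 0 of a holomorphic function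
  -- of the resampled component.
  have := (rotationInvariant_gaussPi E).enorm_sq_le_lintegral
    (h := fun w => h ((v - P *ᵥ v) + P *ᵥ w)) (by fun_prop) (fun w => by
      simpa only [Matrix.mulVec_smul] using hd (v - P *ᵥ v) (P *ᵥ w))
  simpa using this

end RandomPermanent

/-! ### Gaussian integrals in one complex variable. -/

namespace RandomPermanent

/-- Expanding |z + c|² in the density leaves the factor |exp(-conj c · z)|². This weight is the
squared modulus of a holomorphic function, so subharmonicity still applies after the shift. -/
theorem lintegral_complexGaussian_shift (c : ℂ) {f : ℂ → ℝ≥0∞} (hf : Measurable f) :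
    ∫⁻ z, f z ∂complexGaussian 1 = ENNReal.ofReal (Real.exp (-‖c‖ ^ 2)) *
      ∫⁻ z, ‖Complex.exp (-(starRingEnd ℂ c * z))‖ₑ ^ 2 * f (z + c) ∂complexGaussian 1 := by
  rw [lintegral_complexGaussian_one hf, lintegral_complexGaussian_one (by fun_prop),
    ← lintegral_const_mul _ (by fun_prop), ← lintegral_add_right_eq_self _ c]
  refine lintegral_congr fun z => ?_
  rw [enorm_sq_eq_ofReal, ← mul_assoc, ← mul_assoc, ← ENNReal.ofReal_mul (by positivity),
    ← ENNReal.ofReal_mul (by positivity)]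
  congr 2
  rw [Complex.norm_exp, ← Real.exp_nat_mul, mul_left_comm, mul_assoc, mul_assoc, ← Real.exp_add,
    ← Real.exp_add]
  congr 2
  have h : ‖z + c‖ ^ 2 = ‖z‖ ^ 2 + ‖c‖ ^ 2 + 2 * (starRingEnd ℂ c * z).re := by
    simp only [← Complex.normSq_eq_norm_sq, Complex.normSq_apply]
    simp
    ring
  rw [h]
  simp
  ring

/-- The reproducing kernel bound in one variable. -/
theorem enorm_sq_le_lintegral_complexGaussian {q : ℂ → ℂ} (hq : Differentiable ℂ q) (c : ℂ) :
    ‖q c‖ₑ ^ 2 ≤ ENNReal.ofReal (Real.exp (‖c‖ ^ 2)) * ∫⁻ z, ‖q z‖ₑ ^ 2 ∂complexGaussian 1 := by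
  have hqm : Measurable q := hq.continuous.measurable
  rw [lintegral_complexGaussian_shift c (by fun_prop), ← mul_assoc,
    ← ENNReal.ofReal_mul (by positivity), ← Real.exp_add]
  have h := rotationInvariant_complexGaussian.enorm_sq_le_lintegral
    (h := fun z => Complex.exp (-(starRingEnd ℂ c * z)) * q (z + c)) (by fun_prop)
    (fun v => by
      have : Differentiable ℂ fun s : ℂ => q (s • v + c) := hq.comp (by fun_prop)
      simp only [smul_eq_mul] at *
      fun_prop)
  simpa [mul_pow] using h

theorem integrable_norm_pow_complexGaussian (m : ℕ) :
    Integrable (fun z : ℂ => ‖z‖ ^ (2 * m)) (complexGaussian 1) ∧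
      ∫ z : ℂ, ‖z‖ ^ (2 * m) ∂complexGaussian 1 = m.factorial := by
  have h := Complex.integral_rpow_mul_exp_neg_rpow (p := 2) (q := 2 * m) (by norm_num)
    (by have : (0 : ℝ) ≤ m := by positivity
        linarith)
  have e : ∀ x : ℂ, ‖x‖ ^ (2 * m : ℝ) * Real.exp (-‖x‖ ^ (2 : ℝ)) =
      Real.pi * ((Real.pi⁻¹ * Real.exp (-‖x‖ ^ 2)) * ‖x‖ ^ (2 * m)) := by
    intro x
    have h1 : ‖x‖ ^ (2 * m : ℝ) = ‖x‖ ^ (2 * m) := by exact_mod_cast Real.rpow_natCast ‖x‖ (2 * m)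
    have h2 : ‖x‖ ^ (2 : ℝ) = ‖x‖ ^ 2 := by exact_mod_cast Real.rpow_natCast ‖x‖ 2
    rw [h1, h2]
    field_simp
  have g : Real.Gamma ((2 * m + 2) / 2) = m.factorial := by
    rw [← Real.Gamma_nat_eq_factorial]
    congr 1
    ring
  simp only [e, g] at h
  rw [integral_const_mul, mul_div_cancel_left₀ _ (two_ne_zero' ℝ)] at h
  have h' := mul_left_cancel₀ Real.pi_ne_zero h
  -- Integrability follows from the value: a non-integrable function has Bochner integral 0, not m!.
  have hi : Integrable fun x : ℂ => (Real.pi⁻¹ * Real.exp (-‖x‖ ^ 2)) * ‖x‖ ^ (2 * m) := by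
    by_contra hn
    rw [integral_undef hn] at h'
    exact (Nat.cast_ne_zero.mpr m.factorial_ne_zero) h'.symm
  have hd : ∀ x : ℂ, (ENNReal.ofReal (Real.pi⁻¹ * Real.exp (-‖x‖ ^ 2))).toReal =
      Real.pi⁻¹ * Real.exp (-‖x‖ ^ 2) := fun x => ENNReal.toReal_ofReal (by positivity)
  rw [complexGaussian_one_eq_withDensity]
  constructor
  · rw [integrable_withDensity_iff (by fun_prop) (by simp)]
    simpa only [hd, mul_comm] using hi
  · rw [integral_withDensity_eq_integral_toReal_smul (by fun_prop) (by simp)]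
    simpa only [hd, smul_eq_mul] using h'

theorem integral_pow_mul_conj_pow_complexGaussian (m m' : ℕ) :
    ∫ z : ℂ, z ^ m * starRingEnd ℂ (z ^ m') ∂complexGaussian 1 =
      if m = m' then (m.factorial : ℂ) else 0 := by
  split_ifs with h
  · subst h
    have e : ∀ z : ℂ, z ^ m * starRingEnd ℂ (z ^ m) = ((‖z‖ ^ (2 * m) : ℝ) : ℂ) := by
      intro z
      rw [Complex.mul_conj, Complex.normSq_eq_norm_sq, norm_pow, ← pow_mul, mul_comm m]
    simp only [e]
    rw [integral_complex_ofReal, (integrable_norm_pow_complexGaussian m).2]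
    simp
  · set I := ∫ z : ℂ, z ^ m * starRingEnd ℂ (z ^ m') ∂complexGaussian 1 with hI
    have hd : ((m : ℝ) - m') ≠ 0 := sub_ne_zero.mpr (by exact_mod_cast h)
    -- The angle π / (m - m') is chosen so that rotation by `c` multiplies the integrand by exp(iπ)
    -- = -1.
    let c : ℂ := Complex.exp ((Real.pi / ((m : ℝ) - m') : ℝ) * Complex.I)
    have hc : ‖c‖ = 1 := Complex.norm_exp_ofReal_mul_I _
    have hcc : c ^ m * starRingEnd ℂ (c ^ m') = -1 := by
      have : starRingEnd ℂ c = Complex.exp (-((Real.pi / ((m : ℝ) - m') : ℝ) * Complex.I)) := by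
        simp only [c]
        rw [← Complex.exp_conj]
        simp
      rw [map_pow, this, ← Complex.exp_nat_mul, ← Complex.exp_nat_mul, ← Complex.exp_add,
        ← Complex.exp_pi_mul_I]
      congr 1
      have : ((m : ℂ) - m') ≠ 0 := by exact_mod_cast hd
      push_cast
      field_simp
      ring
    have hmp := rotationInvariant_complexGaussian c hc
    have hc0 : c ≠ 0 := Complex.exp_ne_zero _
    have h1 : I = ∫ z : ℂ, (c • z) ^ m * starRingEnd ℂ ((c • z) ^ m') ∂complexGaussian 1 :=
      (hmp.integral_comp (MeasurableEquiv.smul₀ c hc0).measurableEmbedding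
        (fun z => z ^ m * starRingEnd ℂ (z ^ m'))).symm
    have h2 : ∀ z : ℂ, (c • z) ^ m * starRingEnd ℂ ((c • z) ^ m') =
        (-1) * (z ^ m * starRingEnd ℂ (z ^ m')) := by
      intro z
      rw [← hcc]
      simp only [smul_eq_mul, mul_pow, map_mul]
      ring
    simp only [h2] at h1
    rw [integral_const_mul, ← hI] at h1
    linear_combination h1 / 2

theorem integrable_pow_mul_conj_pow_complexGaussian (m m' : ℕ) :
    Integrable (fun z : ℂ => z ^ m * starRingEnd ℂ (z ^ m')) (complexGaussian 1) := by
  have h1 := (integrable_norm_pow_complexGaussian m).1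
  have h2 := (integrable_norm_pow_complexGaussian m').1
  have hm : Measurable (starRingEnd ℂ) := Complex.continuous_conj.measurable
  refine (h1.add h2).mono' (by fun_prop) (ae_of_all _ fun z => ?_)
  rw [norm_mul, RCLike.norm_conj, norm_pow, norm_pow]
  simp only [Pi.add_apply, pow_mul']
  nlinarith [sq_nonneg (‖z‖ ^ m - ‖z‖ ^ m'), sq_nonneg (‖z‖ ^ m), sq_nonneg (‖z‖ ^ m')]

/-- The second moment of an affine function against an exponential weight. -/
theorem lintegral_affine_mul_exp_complexGaussian (a b c : ℂ) :
    ∫⁻ z, ‖(a + b * z) * Complex.exp (-(c * z))‖ₑ ^ 2 ∂complexGaussian 1 =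
      ENNReal.ofReal (Real.exp (‖c‖ ^ 2) *
        (‖a - b * starRingEnd ℂ c‖ ^ 2 + ‖b‖ ^ 2)) := by
  have key : ∀ a b : ℂ, ∫⁻ z, ‖a + b * z‖ₑ ^ 2 ∂complexGaussian 1 =
      ENNReal.ofReal (‖a‖ ^ 2 + ‖b‖ ^ 2) := by
    intro a b
    simp only [enorm_sq_eq_ofReal]
    have e : ∀ z : ℂ, ‖a + b * z‖ ^ 2 =
        (‖a‖ ^ 2 + ‖b‖ ^ 2 * ‖z‖ ^ (2 * 1)) +
          2 * (starRingEnd ℂ a * b * (z ^ 1 * starRingEnd ℂ (z ^ 0))).re := by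
      intro z
      rw [mul_one, ← mul_pow, ← norm_mul]
      simp only [← Complex.normSq_eq_norm_sq, Complex.normSq_add]
      simp
      ring
    have i1 : Integrable (fun z : ℂ => ‖a‖ ^ 2 + ‖b‖ ^ 2 * ‖z‖ ^ (2 * 1)) (complexGaussian 1) :=
      (integrable_const _).add ((integrable_norm_pow_complexGaussian 1).1.const_mul _)
    have i2 := (integrable_pow_mul_conj_pow_complexGaussian 1 0).const_mul (starRingEnd ℂ a * b)
    have i3 : Integrable (fun z : ℂ => 2 * (starRingEnd ℂ a * b *
        (z ^ 1 * starRingEnd ℂ (z ^ 0))).re) (complexGaussian 1) := i2.re.const_mul 2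
    have i4 : Integrable (fun z : ℂ => ‖a + b * z‖ ^ 2) (complexGaussian 1) := by
      simp only [e]
      exact i1.add i3
    rw [← ofReal_integral_eq_lintegral_ofReal i4 (ae_of_all _ fun z => by positivity)]
    congr 1
    simp only [e]
    rw [integral_add i1 i3, integral_add (integrable_const _)
      ((integrable_norm_pow_complexGaussian 1).1.const_mul _), integral_const_mul,
      (integrable_norm_pow_complexGaussian 1).2, integral_const_mul]
    have : ∫ z : ℂ, (starRingEnd ℂ a * b * (z ^ 1 * starRingEnd ℂ (z ^ 0))).re
        ∂complexGaussian 1 = 0 := by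
      have h := integral_re i2
      simp only [RCLike.re_to_complex] at h
      rw [h, integral_const_mul, integral_pow_mul_conj_pow_complexGaussian]
      simp
    rw [this]
    simp
  -- Shifting by conj c produces exactly the weight exp(-c z); the affine function is recentred
  -- beforehand so that it becomes a + b z after the shift.
  have h := lintegral_complexGaussian_shift (starRingEnd ℂ c)
    (f := fun z => ‖(a - b * starRingEnd ℂ c) + b * z‖ₑ ^ 2) (by fun_prop)
  rw [key] at h
  have h2 : ∀ z : ℂ, ‖Complex.exp (-(starRingEnd ℂ (starRingEnd ℂ c) * z))‖ₑ ^ 2 *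
      ‖(a - b * starRingEnd ℂ c) + b * (z + starRingEnd ℂ c)‖ₑ ^ 2 =
      ‖(a + b * z) * Complex.exp (-(c * z))‖ₑ ^ 2 := by
    intro z
    rw [enorm_mul, mul_pow, mul_comm, Complex.conj_conj]
    congr 3
    ring
  simp only [h2, RCLike.norm_conj] at h
  rw [ENNReal.ofReal_mul (by positivity), h, ← mul_assoc, ← ENNReal.ofReal_mul (by positivity),
    ← Real.exp_add]
  simp

/-- Needed to integrate out the extra coordinate that carries the deterministic rank-one term. -/
theorem lintegral_exp_half_norm_sq_complexGaussian :
    ∫⁻ z, ENNReal.ofReal (Real.exp (‖z‖ ^ 2 / 2)) ∂complexGaussian 1 = 2 := by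
  rw [lintegral_complexGaussian_one (by fun_prop)]
  have h := Complex.integral_exp_neg_mul_rpow (p := 2) (b := 1 / 2) (by norm_num) (by norm_num)
  have e : ∀ x : ℂ, Real.exp (-(1 / 2) * ‖x‖ ^ (2 : ℝ)) =
      Real.pi * ((Real.pi⁻¹ * Real.exp (-‖x‖ ^ 2)) * Real.exp (‖x‖ ^ 2 / 2)) := by
    intro x
    have h2 : ‖x‖ ^ (2 : ℝ) = ‖x‖ ^ 2 := by exact_mod_cast Real.rpow_natCast ‖x‖ 2
    rw [h2, mul_assoc, ← Real.exp_add, mul_inv_cancel_left₀ Real.pi_ne_zero]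
    congr 1
    ring
  simp only [e] at h
  have g : (1 / 2 : ℝ) ^ (-2 / 2 : ℝ) * Real.Gamma (2 / 2 + 1) = 2 := by
    rw [show (-2 / 2 : ℝ) = -1 by norm_num, Real.rpow_neg_one, show (2 / 2 + 1 : ℝ) = 2 by norm_num,
      Real.Gamma_two]
    norm_num
  rw [integral_const_mul, mul_assoc, g] at h
  have h' := mul_left_cancel₀ Real.pi_ne_zero h
  have hi : Integrable fun x : ℂ =>
      (Real.pi⁻¹ * Real.exp (-‖x‖ ^ 2)) * Real.exp (‖x‖ ^ 2 / 2) := by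
    by_contra hn
    rw [integral_undef hn] at h'
    exact two_ne_zero h'.symm
  have hz : ∀ z : ℂ, ENNReal.ofReal (Real.pi⁻¹ * Real.exp (-‖z‖ ^ 2)) *
      ENNReal.ofReal (Real.exp (‖z‖ ^ 2 / 2)) =
      ENNReal.ofReal ((Real.pi⁻¹ * Real.exp (-‖z‖ ^ 2)) * Real.exp (‖z‖ ^ 2 / 2)) := fun z =>
    (ENNReal.ofReal_mul (by positivity)).symm
  simp only [hz]
  rw [← ofReal_integral_eq_lintegral_ofReal hi (ae_of_all _ fun z => by positivity), h']
  simp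

end RandomPermanent

/-! ### Wick's formula for homogeneous polynomials. -/

namespace RandomPermanent

section Wick

variable {E : Type*} {k : ℕ}

theorem exists_perm_of_card_fiber_eq [DecidableEq E] (f g : Fin k → E)
    (h : ∀ e, Fintype.card {l // f l = e} = Fintype.card {l // g l = e}) :
    ∃ π : Equiv.Perm (Fin k), f ∘ π = g := by
  refine ⟨Equiv.ofFiberEquiv (f := g) (g := f) fun e => Fintype.equivOfCardEq (h e).symm, ?_⟩
  ext l
  exact Equiv.ofFiberEquiv_map _ l

variable [Fintype E]

/-- If f and g have equal fibre sizes, the permutations form a coset of the stabiliser of f, which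
has ∏ (fibre size)! elements; otherwise there are none. The right side is the product of the
one-variable moments. -/
theorem card_perm_comp_eq [DecidableEq E] (f g : Fin k → E) :
    (Fintype.card {π : Equiv.Perm (Fin k) // f ∘ π = g} : ℂ) =
      ∏ e, if Fintype.card {l // f l = e} = Fintype.card {l // g l = e}
        then ((Fintype.card {l // f l = e}).factorial : ℂ) else 0 := by
  by_cases h : ∀ e, Fintype.card {l // f l = e} = Fintype.card {l // g l = e}
  · obtain ⟨π₀, h₀⟩ := exists_perm_of_card_fiber_eq f g h
    rw [Finset.prod_congr rfl fun e _ => if_pos (h e), ← Nat.cast_prod,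
      ← DomMulAct.stabilizer_card f]
    congr 1
    refine Fintype.card_congr (Equiv.subtypeEquiv (Equiv.mulRight π₀⁻¹) fun π => ?_)
    rw [Equiv.coe_mulRight, Equiv.Perm.coe_mul, ← Function.comp_assoc, ← h₀]
    constructor
    · intro h
      rw [h, Function.comp_assoc, ← Equiv.Perm.coe_mul, mul_inv_cancel]
      rfl
    · intro h
      conv_rhs => rw [← h]
      rw [Function.comp_assoc, Function.comp_assoc, ← Equiv.Perm.coe_mul, inv_mul_cancel]
      rfl
  · push Not at h
    obtain ⟨e, he⟩ := h
    rw [Finset.prod_eq_zero (Finset.mem_univ e) (if_neg he), Nat.cast_eq_zero,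
      Fintype.card_eq_zero_iff]
    refine ⟨fun ⟨π, hπ⟩ => he ?_⟩
    subst hπ
    exact Fintype.card_congr (Equiv.subtypeEquiv π.symm fun l => by simp)

theorem prod_comp_eq_prod_pow [DecidableEq E] (f : Fin k → E) (v : E → ℂ) :
    ∏ l, v (f l) = ∏ e, v e ^ Fintype.card {l // f l = e} := by
  rw [Finset.prod_comp v f]
  refine Finset.prod_subset_one_on_sdiff (Finset.subset_univ _) (fun e he => ?_) fun e _ => ?_
  · have : IsEmpty {l // f l = e} := ⟨fun ⟨l, hl⟩ => by simp [← hl] at he⟩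
    simp
  · rw [Fintype.card_subtype]

theorem integral_prod_mul_conj_prod [DecidableEq E] (f g : Fin k → E) :
    Integrable (fun v : E → ℂ => (∏ l, v (f l)) * starRingEnd ℂ (∏ l, v (g l))) (gaussPi E) ∧
    ∫ v : E → ℂ, (∏ l, v (f l)) * starRingEnd ℂ (∏ l, v (g l)) ∂gaussPi E =
      Fintype.card {π : Equiv.Perm (Fin k) // f ∘ π = g} := by
  have e : ∀ v : E → ℂ, (∏ l, v (f l)) * starRingEnd ℂ (∏ l, v (g l)) =
      ∏ e, (v e ^ Fintype.card {l // f l = e} *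
        starRingEnd ℂ (v e ^ Fintype.card {l // g l = e})) := by
    intro v
    rw [prod_comp_eq_prod_pow, prod_comp_eq_prod_pow, map_prod, Finset.prod_mul_distrib]
  simp only [e]
  refine ⟨Integrable.fintype_prod (f := fun e (z : ℂ) => z ^ Fintype.card {l // f l = e} *
        starRingEnd ℂ (z ^ Fintype.card {l // g l = e})) fun e =>
    integrable_pow_mul_conj_pow_complexGaussian _ _, ?_⟩
  rw [integral_fintype_prod_eq_prod (f := fun e (z : ℂ) => z ^ Fintype.card {l // f l = e} *
        starRingEnd ℂ (z ^ Fintype.card {l // g l = e})), card_perm_comp_eq]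
  simp only [integral_pow_mul_conj_pow_complexGaussian]

/-- The second moment of a homogeneous polynomial in independent complex Gaussians. -/
theorem lintegral_homogeneous_gaussPi (c : (Fin k → E) → ℂ)
    (hc : ∀ (f : Fin k → E) (π : Equiv.Perm (Fin k)), c (f ∘ π) = c f) :
    ∫⁻ v, ‖∑ f, c f * ∏ l, v (f l)‖ₑ ^ 2 ∂gaussPi E =
      ENNReal.ofReal (k.factorial * ∑ f, ‖c f‖ ^ 2) := by
  classical
  have e : ∀ v : E → ℂ, ((‖∑ f, c f * ∏ l, v (f l)‖ ^ 2 : ℝ) : ℂ) =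
      ∑ f, ∑ g, c f * starRingEnd ℂ (c g) *
        ((∏ l, v (f l)) * starRingEnd ℂ (∏ l, v (g l))) := by
    intro v
    rw [← Complex.normSq_eq_norm_sq, ← Complex.mul_conj, map_sum, Finset.sum_mul_sum]
    refine Finset.sum_congr rfl fun f _ => Finset.sum_congr rfl fun g _ => ?_
    rw [map_mul]
    ring
  have hi : ∀ f g : Fin k → E, Integrable (fun v : E → ℂ => c f * starRingEnd ℂ (c g) *
        ((∏ l, v (f l)) * starRingEnd ℂ (∏ l, v (g l)))) (gaussPi E) := fun f g =>
    (integral_prod_mul_conj_prod f g).1.const_mul _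
  have hC : Integrable (fun v : E → ℂ => ((‖∑ f, c f * ∏ l, v (f l)‖ ^ 2 : ℝ) : ℂ))
      (gaussPi E) := by
    simp only [e]
    exact integrable_finsetSum _ fun f _ => integrable_finsetSum _ fun g _ => hi f g
  have hR : Integrable (fun v : E → ℂ => ‖∑ f, c f * ∏ l, v (f l)‖ ^ 2) (gaussPi E) := by
    refine hC.re.congr (ae_of_all _ fun v => ?_)
    exact Complex.ofReal_re _
  simp only [enorm_sq_eq_ofReal]
  rw [← ofReal_integral_eq_lintegral_ofReal hR (ae_of_all _ fun v => by positivity)]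
  congr 1
  rw [← Complex.ofReal_inj, ← integral_complex_ofReal]
  simp only [e]
  rw [integral_finsetSum _ fun f _ => integrable_finsetSum _ fun g _ => hi f g]
  push_cast
  rw [Finset.mul_sum]
  refine Finset.sum_congr rfl fun f _ => ?_
  rw [integral_finsetSum _ fun g _ => hi f g]
  simp only [integral_const_mul, (integral_prod_mul_conj_prod f _).2]
  have h1 : ∀ g : Fin k → E, (Fintype.card {π : Equiv.Perm (Fin k) // f ∘ π = g} : ℂ) =
      ∑ π : Equiv.Perm (Fin k), if f ∘ π = g then 1 else 0 := by
    intro g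
    rw [Fintype.card_subtype, Finset.sum_boole]
  simp only [h1, Finset.mul_sum, mul_ite, mul_one, mul_zero]
  -- For fixed f each permutation π selects g = f ∘ π, and by the symmetry of `c` all k! of them
  -- contribute ‖c f‖².
  rw [Finset.sum_comm]
  simp only [Finset.sum_ite_eq, Finset.mem_univ, if_true, hc]
  rw [Finset.sum_const, Finset.card_univ, Fintype.card_perm, Fintype.card_fin, nsmul_eq_mul,
    Complex.mul_conj, Complex.normSq_eq_norm_sq]
  push_cast
  ring

end Wick

end RandomPermanent

/-! ### Sums over injections and the expansion of the permanent. -/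

namespace RandomPermanent

section Embeddings

variable {n k : ℕ}

/-- The sum of `∏ v (i l)` over all injections `i : Fin k → Fin n`. -/
noncomputable def embSum (k : ℕ) {n : ℕ} (v : Fin n → ℂ) : ℂ :=
  ∑ i : Fin k ↪ Fin n, ∏ l, v (i l)

/-- The sum of `∏ Z (i l) (j l)` over all pairs of injections `Fin k → Fin n`. -/
noncomputable def embSum₂ (k : ℕ) {n : ℕ} (Z : Fin n → Fin n → ℂ) : ℂ :=
  ∑ i : Fin k ↪ Fin n, ∑ j : Fin k ↪ Fin n, ∏ l, Z (i l) (j l)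

theorem card_embedding_map_univ_eq {I : Finset (Fin n)} (hI : I.card = k) :
    Fintype.card {e : Fin k ↪ Fin n // Finset.univ.map e = I} = k.factorial := by
  have h1 : Fintype.card (Fin k ≃ I) = k.factorial := by
    have e₀ : Fin k ≃ I := Fintype.equivOfCardEq (by simp [hI])
    rw [Fintype.card_equiv e₀, Fintype.card_fin]
  rw [← h1]
  refine Fintype.card_congr
    { toFun := fun e => Equiv.ofBijective
        (fun l => (⟨e.1 l, 
          (Finset.ext_iff.mp e.2 _).mp (Finset.mem_map_of_mem _ (Finset.mem_univ l))⟩ : I)) ?_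
      invFun := fun f => ⟨f.toEmbedding.trans (Function.Embedding.subtype _), ?_⟩
      left_inv := fun e => by ext; rfl
      right_inv := fun f => by ext; rfl }
  · rw [Fintype.bijective_iff_injective_and_card]
    refine ⟨fun a b hab => e.1.injective (congrArg Subtype.val hab), by simp [hI]⟩
  · ext x
    simp only [Finset.mem_map, Finset.mem_univ, true_and, Function.Embedding.trans_apply,
      Equiv.coe_toEmbedding, Function.Embedding.subtype_apply]
    exact ⟨fun ⟨l, hl⟩ => hl ▸ (f l).2, fun hx => ⟨f.symm ⟨x, hx⟩, by simp⟩⟩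

theorem embSum_eq_factorial_mul (k : ℕ) (v : Fin n → ℂ) :
    embSum k v = k.factorial * ∑ I ∈ Finset.powersetCard k Finset.univ, ∏ i ∈ I, v i := by
  classical
  rw [embSum, ← Finset.sum_fiberwise_of_maps_to
    (s := Finset.univ) (t := Finset.powersetCard k Finset.univ)
    (g := fun e : Fin k ↪ Fin n => Finset.univ.map e) (fun e _ => by
      simp [Finset.mem_powersetCard]), Finset.mul_sum]
  refine Finset.sum_congr rfl fun I hI => ?_
  have hI' := (Finset.mem_powersetCard.mp hI).2
  rw [← card_embedding_map_univ_eq hI', Fintype.card_subtype, ← nsmul_eq_mul, ← Finset.sum_const]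
  refine Finset.sum_congr rfl fun e he => ?_
  rw [← (Finset.mem_filter.mp he).2, Finset.prod_map]

theorem prod_one_add_mul_eq (t : ℂ) (v : Fin n → ℂ) :
    ∏ i, (1 + t * v i) =
      ∑ k ∈ Finset.range (n + 1), t ^ k * (embSum k v / k.factorial) := by
  rw [Finset.prod_one_add, Finset.sum_powerset, Finset.card_univ, Fintype.card_fin]
  refine Finset.sum_congr rfl fun k _ => ?_
  rw [embSum_eq_factorial_mul, mul_div_cancel_left₀ _ (by exact_mod_cast k.factorial_ne_zero),
    Finset.mul_sum]
  refine Finset.sum_congr rfl fun I hI => ?_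
  rw [Finset.prod_mul_distrib, Finset.prod_const, (Finset.mem_powersetCard.mp hI).2]

/-- The symmetric group acts transitively on injections, so all fibres of σ ↦ σ ∘ j have the same
size, which counting n! permutations shows to be (n - k)!. -/
theorem sum_perm_trans (hk : k ≤ n) (j : Fin k ↪ Fin n) (F : (Fin k ↪ Fin n) → ℂ) :
    ∑ σ : Equiv.Perm (Fin n), F (j.trans σ.toEmbedding) = (n - k).factorial * ∑ i, F i := by
  classical
  have hconst : ∀ i i' : Fin k ↪ Fin n,
      Fintype.card {σ : Equiv.Perm (Fin n) // j.trans σ.toEmbedding = i} =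
      Fintype.card {σ : Equiv.Perm (Fin n) // j.trans σ.toEmbedding = i'} := by
    intro i i'
    have := Equiv.Perm.isMultiplyPretransitive (Fin n) k
    obtain ⟨τ, hτ⟩ := MulAction.exists_smul_eq (Equiv.Perm (Fin n)) i i'
    refine Fintype.card_congr (Equiv.subtypeEquiv (Equiv.mulLeft τ) fun σ => ?_)
    have h1 : j.trans (Equiv.mulLeft τ σ).toEmbedding = τ • j.trans σ.toEmbedding := by
      ext; rfl
    rw [h1, ← hτ, smul_left_cancel_iff]
  have hcount : ∀ i : Fin k ↪ Fin n,
      Fintype.card {σ : Equiv.Perm (Fin n) // j.trans σ.toEmbedding = i} = (n - k).factorial := by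
    intro i
    have h1 : ∑ i' : Fin k ↪ Fin n,
        Fintype.card {σ : Equiv.Perm (Fin n) // j.trans σ.toEmbedding = i'} = n.factorial := by
      rw [← Fintype.card_sigma, Fintype.card_congr (Equiv.sigmaFiberEquiv _), Fintype.card_perm,
        Fintype.card_fin]
    rw [Finset.sum_congr rfl fun i' _ => hconst i' i, Finset.sum_const, Finset.card_univ,
      Fintype.card_embedding_eq, Fintype.card_fin, Fintype.card_fin, smul_eq_mul,
      ← Nat.factorial_mul_descFactorial hk, mul_comm] at h1
    exact Nat.eq_of_mul_eq_mul_right (Nat.descFactorial_pos.mpr hk) h1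
  rw [← Finset.sum_fiberwise_of_maps_to (t := Finset.univ)
    (g := fun σ : Equiv.Perm (Fin n) => j.trans σ.toEmbedding) (fun _ _ => Finset.mem_univ _),
    Finset.mul_sum]
  refine Finset.sum_congr rfl fun i _ => ?_
  rw [← hcount i, Fintype.card_subtype, ← nsmul_eq_mul, ← Finset.sum_const]
  exact Finset.sum_congr rfl fun σ hσ => by rw [(Finset.mem_filter.mp hσ).2]

/-- The expansion of the normalised permanent in powers of `z`. -/
theorem G_eq_sum (Z : Matrix (Fin n) (Fin n) ℂ) (z : ℂ) :
    G Z z = ∑ k ∈ Finset.range (n + 1),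
      z ^ k * (((n - k).factorial / (n.factorial * k.factorial) : ℂ) * embSum₂ k fun i j => Z i j) := by
  have h1 : ∀ σ : Equiv.Perm (Fin n), ∏ i, (J n + z • Z) (σ i) i =
      ∏ i, (1 + z * Z (σ i) i) := fun σ => by simp [J]
  rw [G, Matrix.permanent]
  simp only [h1]
  have h2 : ∀ σ : Equiv.Perm (Fin n), ∏ i, (1 + z * Z (σ i) i) =
      ∑ k ∈ Finset.range (n + 1), z ^ k * (embSum k (fun i => Z (σ i) i) / k.factorial) :=
    fun σ => prod_one_add_mul_eq z fun i => Z (σ i) i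
  simp only [h2]
  rw [Finset.sum_comm, Finset.mul_sum]
  refine Finset.sum_congr rfl fun k hk => ?_
  have hk' : k ≤ n := by simpa [Nat.lt_succ_iff] using hk
  rw [← Finset.mul_sum, ← Finset.sum_div]
  have h3 : ∑ σ : Equiv.Perm (Fin n), embSum k (fun i => Z (σ i) i) =
      (n - k).factorial * embSum₂ k fun i j => Z i j := by
    simp only [embSum]
    rw [Finset.sum_comm, embSum₂]
    conv_rhs => rw [Finset.sum_comm]
    rw [Finset.mul_sum]
    refine Finset.sum_congr rfl fun j _ => ?_
    exact sum_perm_trans hk' j fun i => ∏ l, Z (i l) (j l)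
  rw [h3]
  have : (n.factorial : ℂ) ≠ 0 := by exact_mod_cast n.factorial_ne_zero
  have : (k.factorial : ℂ) ≠ 0 := by exact_mod_cast k.factorial_ne_zero
  field_simp

end Embeddings

end RandomPermanent

/-! ### Second moments of sums over pairs of injections. -/

namespace RandomPermanent

section SecondMoment

variable {n k : ℕ} {A E : Type*} [Fintype E]

/-- The coefficient tensor of `v ↦ embSum k (S v)`. -/
noncomputable def embCoeff (S : Fin n → A → ℂ) (a : Fin k → A) : ℂ :=
  ∑ i : Fin k ↪ Fin n, ∏ l, S (i l) (a l)

theorem embCoeff_comp_perm (S : Fin n → A → ℂ) (a : Fin k → A) (π : Equiv.Perm (Fin k)) :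
    embCoeff S (a ∘ π) = embCoeff S a := by
  refine Fintype.sum_equiv (Equiv.embeddingCongr π (Equiv.refl _)) _ _ fun i => ?_
  refine Fintype.prod_equiv π _ _ fun l => ?_
  simp [Equiv.embeddingCongr]

/-- Once f is fixed, the sums over row and column injections separate, so the coefficient tensor is
a product of a row tensor and a column tensor. -/
theorem embSum₂_sum_mul (S S' : Fin n → A → ℂ) (ρ κ : E → A) (v : E → ℂ) :
    embSum₂ k (fun i j => ∑ e, S i (ρ e) * S' j (κ e) * v e) =
      ∑ f : Fin k → E, (embCoeff S (ρ ∘ f) * embCoeff S' (κ ∘ f)) * ∏ l, v (f l) := by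
  classical
  simp only [embSum₂, Finset.prod_univ_sum, Fintype.piFinset_univ, Finset.prod_mul_distrib]
  rw [Finset.sum_congr rfl fun i _ => Finset.sum_comm, Finset.sum_comm]
  refine Finset.sum_congr rfl fun f _ => ?_
  rw [embCoeff, embCoeff, Finset.sum_mul_sum, Finset.sum_mul]
  refine Finset.sum_congr rfl fun i _ => ?_
  rw [Finset.sum_mul]
  rfl

variable [Fintype A]

theorem embSum_sum_mul (S : Fin n → A → ℂ) (v : A → ℂ) :
    embSum k (fun i => ∑ a, S i a * v a) = ∑ a : Fin k → A, embCoeff S a * ∏ l, v (a l) := by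
  classical
  simp only [embSum, embCoeff, Finset.prod_univ_sum, Fintype.piFinset_univ, Finset.sum_mul,
    Finset.prod_mul_distrib]
  exact Finset.sum_comm

theorem lintegral_embSum (S : Fin n → A → ℂ) :
    ∫⁻ v, ‖embSum k (fun i => ∑ a, S i a * v a)‖ₑ ^ 2 ∂gaussPi A =
      ENNReal.ofReal (k.factorial * ∑ a : Fin k → A, ‖embCoeff S a‖ ^ 2) := by
  simp only [embSum_sum_mul]
  exact lintegral_homogeneous_gaussPi _ (embCoeff_comp_perm S)

/-- By Wick's formula each side is (k!)² times a sum of squared coefficients. As f ↦ (ρ ∘ f, κ ∘ f)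
is injective, the left sum is part of the double sum obtained by expanding the right side. -/
theorem lintegral_embSum₂_le (S S' : Fin n → A → ℂ) (ρ κ : E → A)
    (h : Function.Injective fun e => (ρ e, κ e)) :
    k.factorial * ∫⁻ v, ‖embSum₂ k (fun i j => ∑ e, S i (ρ e) * S' j (κ e) * v e)‖ₑ ^ 2
        ∂gaussPi E ≤
      (∫⁻ v, ‖embSum k (fun i => ∑ a, S i a * v a)‖ₑ ^ 2 ∂gaussPi A) *
        ∫⁻ v, ‖embSum k (fun i => ∑ a, S' i a * v a)‖ₑ ^ 2 ∂gaussPi A := by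
  classical
  simp only [lintegral_embSum, embSum₂_sum_mul]
  rw [lintegral_homogeneous_gaussPi _ fun f π => by
    rw [← Function.comp_assoc, ← Function.comp_assoc, embCoeff_comp_perm, embCoeff_comp_perm],
    ← ENNReal.ofReal_natCast, ← ENNReal.ofReal_mul (by positivity),
    ← ENNReal.ofReal_mul (by positivity)]
  refine ENNReal.ofReal_le_ofReal ?_
  rw [mul_mul_mul_comm, mul_assoc (k.factorial : ℝ), ← mul_assoc (k.factorial : ℝ)]
  rw [← mul_assoc]
  refine mul_le_mul_of_nonneg_left ?_ (by positivity)
  rw [Finset.sum_mul_sum, ← Finset.sum_product']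
  simp only [norm_mul, mul_pow]
  refine (Finset.sum_map Finset.univ
    ⟨fun f : Fin k → E => ((ρ ∘ f, κ ∘ f) : (Fin k → A) × (Fin k → A)), fun f g hfg => ?_⟩
    (fun p => ‖embCoeff S p.1‖ ^ 2 * ‖embCoeff S' p.2‖ ^ 2)).symm.trans_le ?_
  · ext l
    simp only [Prod.mk.injEq, funext_iff, Function.comp_apply] at hfg
    exact h (Prod.ext (hfg.1 l) (hfg.2 l))
  · exact Finset.sum_le_sum_of_subset_of_nonneg (fun _ _ => by simp) fun _ _ _ => by positivity

theorem measurable_embSum₂ {X : Type*} [MeasurableSpace X] {Z : X → Fin n → Fin n → ℂ}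
    (hZ : ∀ i j, Measurable fun x => Z x i j) : Measurable fun x => embSum₂ k (Z x) := by
  unfold embSum₂
  fun_prop

/-- The rank-one deterministic term is viewed as an additional Gaussian coordinate evaluated at θ.
The reproducing kernel bound compares this evaluation with the full second moment and costs
exp(‖θ‖²). -/
theorem lintegral_embSum₂_add_le (S S' : Fin n → Option (Fin n) → ℂ) (θ : ℂ) :
    k.factorial * ∫⁻ v, ‖embSum₂ k (fun i j =>
        ∑ e : Fin n × Fin n, S i (some e.1) * S' j (some e.2) * v e +
          S i none * S' j none * θ)‖ₑ ^ 2 ∂gaussPi (Fin n × Fin n) ≤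
      ENNReal.ofReal (Real.exp (‖θ‖ ^ 2)) *
      ((∫⁻ v, ‖embSum k (fun i => ∑ a, S i a * v a)‖ₑ ^ 2 ∂gaussPi (Option (Fin n))) *
        ∫⁻ v, ‖embSum k (fun i => ∑ a, S' i a * v a)‖ₑ ^ 2 ∂gaussPi (Option (Fin n))) := by
  let ρ : Option (Fin n × Fin n) → Option (Fin n) := Option.map Prod.fst
  let κ : Option (Fin n × Fin n) → Option (Fin n) := Option.map Prod.snd
  have hinj : Function.Injective fun e => (ρ e, κ e) := by
    rintro (_ | ⟨a, b⟩) (_ | ⟨a', b'⟩) h <;> simp [ρ, κ] at h ⊢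
    exact h
  refine le_trans ?_ (mul_le_mul_right (lintegral_embSum₂_le (k := k) S S' ρ κ hinj) _)
  rw [mul_left_comm]
  refine mul_le_mul_right ?_ _
  have hmp : MeasurePreserving
      (MeasurableEquiv.piOptionEquivProd (fun _ : Option (Fin n × Fin n) => ℂ)).symm
      ((gaussPi (Fin n × Fin n)).prod (complexGaussian 1)) (gaussPi (Option (Fin n × Fin n))) :=
    ⟨MeasurableEquiv.measurable _, Measure.pi_map_piOptionEquivProd fun _ => complexGaussian 1⟩
  have hm : Measurable fun v : Option (Fin n × Fin n) → ℂ =>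
      ‖embSum₂ k (fun i j => ∑ e, S i (ρ e) * S' j (κ e) * v e)‖ₑ ^ 2 :=
    ((measurable_embSum₂ fun i j => by fun_prop).enorm).pow_const 2
  rw [← hmp.lintegral_comp hm, lintegral_prod _ (by exact (hm.comp hmp.measurable).aemeasurable),
    ← lintegral_const_mul]
  · refine lintegral_mono fun v => ?_
    have hq : Differentiable ℂ fun ζ : ℂ => embSum₂ k (fun i j =>
        ∑ e : Fin n × Fin n, S i (some e.1) * S' j (some e.2) * v e +
          S i none * S' j none * ζ) := by
      unfold embSum₂
      fun_prop
    have := enorm_sq_le_lintegral_complexGaussian hq θ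
    refine this.trans_eq ?_
    congr 2
    ext ζ
    congr 3
    ext i j
    rw [Fintype.sum_option, add_comm]
    rfl
  · exact (hm.comp hmp.measurable).lintegral_prod_right'

end SecondMoment

end RandomPermanent

/-! ### Elementary symmetric polynomials of centred Gaussian vectors. -/

namespace RandomPermanent

section ElementarySymmetric

variable {n : ℕ}

/-- The matrix of the map `v ↦ λ (v - mean v + s ζ)`, where `ζ = v none`. -/
noncomputable def centredRow (lam s : Fin n → ℂ) (i : Fin n) : Option (Fin n) → ℂ
  | none => lam i * s i
  | some j => lam i * ((if i = j then 1 else 0) - (n : ℂ)⁻¹)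

theorem sum_centredRow_mul (lam s : Fin n → ℂ) (i : Fin n) (v : Option (Fin n) → ℂ) :
    ∑ a, centredRow lam s i a * v a =
      lam i * (v (some i) - (n : ℂ)⁻¹ * ∑ j, v (some j) + s i * v none) := by
  rw [Fintype.sum_option]
  simp only [centredRow, mul_assoc, ← Finset.mul_sum, sub_mul, Finset.sum_sub_distrib, ite_mul,
    one_mul, zero_mul, Finset.sum_ite_eq, Finset.mem_univ, if_true]
  ring

theorem embSum_eq_zero_of_lt {k : ℕ} (h : n < k) (v : Fin n → ℂ) : embSum k v = 0 := by
  have : IsEmpty (Fin k ↪ Fin n) := Function.Embedding.isEmpty_of_card_lt (by simpa using h)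
  simp [embSum]

theorem measurable_embSum {X : Type*} [MeasurableSpace X] {k : ℕ} {Z : X → Fin n → ℂ}
    (hZ : ∀ i, Measurable fun x => Z x i) : Measurable fun x => embSum k (Z x) := by
  unfold embSum
  fun_prop

/-- Replacing v by s • v turns the generating product into a polynomial in s, whose k-th coefficient
is bounded by Parseval. The parameter `t` is free and is optimised later. -/
theorem lintegral_embSum_le {A : Type*} [Fintype A] (k : ℕ) (S : Fin n → A → ℂ) (t : ℂ) :
    ‖t ^ k‖ₑ ^ 2 * ∫⁻ v, ‖embSum k (fun i => ∑ a, S i a * v a)‖ₑ ^ 2 ∂gaussPi A ≤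
      (k.factorial : ℝ≥0∞) ^ 2 *
        ∫⁻ v, ‖∏ i, (1 + t * ∑ a, S i a * v a)‖ₑ ^ 2 ∂gaussPi A := by
  have hk : (k.factorial : ℂ) ≠ 0 := by exact_mod_cast k.factorial_ne_zero
  let p : (A → ℂ) → Polynomial ℂ := fun v => ∑ k ∈ Finset.range (n + 1),
    Polynomial.C (t ^ k * (embSum k (fun i => ∑ a, S i a * v a) / k.factorial)) * Polynomial.X ^ k
  have hp : ∀ v s, (p v).eval s = ∏ i, (1 + t * ∑ a, S i a * (s • v) a) := by
    intro v s
    have : ∀ i, t * ∑ a, S i a * (s • v) a = (s * t) * ∑ a, S i a * v a := by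
      intro i
      simp only [Pi.smul_apply, smul_eq_mul, Finset.mul_sum]
      exact Finset.sum_congr rfl fun a _ => by ring
    simp only [this, prod_one_add_mul_eq, p, Polynomial.eval_finsetSum, Polynomial.eval_mul,
      Polynomial.eval_C, Polynomial.eval_pow, Polynomial.eval_X]
    exact Finset.sum_congr rfl fun k _ => by ring
  have hc : ∀ v, (p v).coeff k =
      t ^ k * (embSum k (fun i => ∑ a, S i a * v a) / k.factorial) := by
    intro v
    simp only [p, Polynomial.finsetSum_coeff, Polynomial.coeff_C_mul, Polynomial.coeff_X_pow,
      mul_ite, mul_one, mul_zero, Finset.sum_ite_eq, Finset.mem_range]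
    split_ifs with h
    · rfl
    · rw [embSum_eq_zero_of_lt (by omega)]
      simp
  have h := (rotationInvariant_gaussPi A).lintegral_coeff_le
    (h := fun v => ∏ i, (1 + t * ∑ a, S i a * v a)) (by fun_prop) p hp k
  refine le_trans (le_of_eq ?_) (mul_le_mul_right h _)
  have hm : Measurable fun v : A → ℂ => embSum k (fun i => ∑ a, S i a * v a) :=
    measurable_embSum fun i => by fun_prop
  simp only [hc]
  rw [← lintegral_const_mul _ (by fun_prop), ← lintegral_const_mul _ (by fun_prop)]
  refine lintegral_congr fun v => ?_
  rw [← mul_pow, ← mul_pow, ← enorm_mul]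
  have hf : (k.factorial : ℝ≥0∞) = ‖(k.factorial : ℂ)‖ₑ := by
    rw [← ofReal_norm, Complex.norm_natCast, ENNReal.ofReal_natCast]
  rw [hf, ← enorm_mul]
  congr 2
  field_simp

theorem lintegral_prod_gaussPi {E : Type*} [Fintype E] {f : E → ℂ → ℝ≥0∞}
    (hf : ∀ i, Measurable (f i)) :
    ∫⁻ v, ∏ i, f i (v i) ∂gaussPi E = ∏ i, ∫⁻ z, f i z ∂complexGaussian 1 := by
  have h := iIndepFun_pi (μ := fun _ : E => complexGaussian 1) (X := f)
    fun i => (hf i).aemeasurable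
  rw [lintegral_prod_eq_prod_lintegral_of_indepFun Finset.univ _ h
    fun i => (hf i).comp (measurable_pi_apply i)]
  exact Finset.prod_congr rfl fun i _ =>
    (measurePreserving_eval (fun _ : E => complexGaussian 1) i).lintegral_comp (hf i)

/-- Completing the square, ‖b‖² - 2 t Re b = ‖b - t‖² - t², and this -t² cancels the prefactor: that
is the gain from the exponential weight. The cross term between δ and b t is split by the
arithmetic-geometric mean inequality. -/
theorem exp_mul_norm_sq_add_le (t : ℝ) (δ b : ℂ) :
    Real.exp (t ^ 2) * (‖1 + δ - b * t‖ ^ 2 + ‖b‖ ^ 2) ≤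
      Real.exp (2 * δ.re + 2 * ‖δ‖ ^ 2 + ‖b - t‖ ^ 2 + 2 * t ^ 2 * ‖b‖ ^ 2) := by
  have h : ‖1 + δ - b * t‖ ^ 2 + ‖b‖ ^ 2 ≤
      (2 * δ.re + 2 * ‖δ‖ ^ 2 + ‖b - t‖ ^ 2 + 2 * t ^ 2 * ‖b‖ ^ 2 - t ^ 2) + 1 := by
    simp only [← Complex.normSq_eq_norm_sq, Complex.normSq_apply]
    simp
    nlinarith [sq_nonneg (δ.re + t * b.re), sq_nonneg (δ.im + t * b.im)]
  calc _ ≤ Real.exp (t ^ 2) * Real.exp (2 * δ.re + 2 * ‖δ‖ ^ 2 + ‖b - t‖ ^ 2 +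
        2 * t ^ 2 * ‖b‖ ^ 2 - t ^ 2) := by
        gcongr
        exact h.trans (Real.add_one_le_exp _)
    _ = _ := by
        rw [← Real.exp_add]
        congr 1
        ring

-- The centred coordinates sum to zero, so the factor ∏ exp(-t v i) equals 1 on them and may be
-- inserted. Undoing the centring only increases the second moment of the resulting holomorphic
-- function, and then the coordinates are independent.
open scoped Matrix in
theorem lintegral_prod_centred_le (lam s : Fin n → ℂ) (t : ℝ) (ζ : ℂ) :
    ∫⁻ v, ‖∏ i, (1 + t * (lam i * (v i - (n : ℂ)⁻¹ * ∑ j, v j + s i * ζ)))‖ₑ ^ 2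
        ∂gaussPi (Fin n) ≤
      ENNReal.ofReal (Real.exp (∑ i, (2 * (t * lam i * s i * ζ).re +
        2 * ‖t * lam i * s i * ζ‖ ^ 2 + ‖t * lam i - t‖ ^ 2 + 2 * t ^ 2 * ‖t * lam i‖ ^ 2))) := by
  rcases Nat.eq_zero_or_pos n with rfl | hn
  · simp
  have hn0 : (n : ℂ) ≠ 0 := by exact_mod_cast hn.ne'
  let P : Matrix (Fin n) (Fin n) ℂ := Matrix.of fun _ _ => (n : ℂ)⁻¹
  have hP : P * P = P := by
    ext i j
    simp [P, Matrix.mul_apply, hn0]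
  have hPh : Pᴴ = P := by
    ext i j
    simp [P]
  have hPv : ∀ v i, (P *ᵥ v) i = (n : ℂ)⁻¹ * ∑ j, v j := by
    intro v i
    simp [P, Matrix.mulVec, dotProduct, Finset.mul_sum]
  let h : (Fin n → ℂ) → ℂ := fun v => ∏ i, ((1 + t * lam i * s i * ζ + t * lam i * v i) *
    Complex.exp (-(t * v i)))
  have e1 : ∀ v, ∏ i, (1 + t * (lam i * (v i - (n : ℂ)⁻¹ * ∑ j, v j + s i * ζ))) =
      h (v - P *ᵥ v) := by
    intro v
    simp only [h, Finset.prod_mul_distrib, ← Complex.exp_sum, Finset.sum_neg_distrib,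
      ← Finset.mul_sum, Pi.sub_apply, hPv, Finset.sum_sub_distrib]
    rw [Finset.sum_const, Finset.card_univ, Fintype.card_fin, nsmul_eq_mul,
      inv_mul_cancel_left₀ hn0, sub_self, mul_zero, neg_zero, Complex.exp_zero, mul_one]
    exact Finset.prod_congr rfl fun i _ => by ring
  simp only [e1]
  refine (lintegral_comp_sub_mulVec_le hP hPh (h := h) (by fun_prop) fun v w => ?_).trans ?_
  · simp only [h, Pi.add_apply, Pi.smul_apply]
    fun_prop
  · have e2 : ∀ v, ‖h v‖ₑ ^ 2 = ∏ i, ‖(1 + t * lam i * s i * ζ + t * lam i * v i) *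
        Complex.exp (-(t * v i))‖ₑ ^ 2 := by
      intro v
      simp only [h, Finset.prod_pow]
      congr 1
      simp only [enorm_eq_nnnorm]
      rw [nnnorm_prod]
      push_cast
      rfl
    simp only [e2]
    rw [lintegral_prod_gaussPi
      (f := fun i z => ‖(1 + t * lam i * s i * ζ + t * lam i * z) * Complex.exp (-(t * z))‖ₑ ^ 2)]
    · simp only [lintegral_affine_mul_exp_complexGaussian]
      rw [← ENNReal.ofReal_prod_of_nonneg fun i _ => by positivity, Real.exp_sum]
      refine ENNReal.ofReal_le_ofReal (Finset.prod_le_prod (fun i _ => by positivity) fun i _ => ?_)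
      have := exp_mul_norm_sq_add_le t (t * lam i * s i * ζ) (t * lam i)
      simpa using this
    · intro i
      fun_prop

/-- The coordinate ζ = v none enters the exponent by at most 2 a ‖ζ‖ + ‖ζ‖² / 4, where 1/4 is twice
the bound 1/8. Since 2 a ‖ζ‖ ≤ 4 a² + ‖ζ‖² / 4, what remains is exp(‖ζ‖² / 2), which is integrable.
-/
theorem lintegral_prod_centredRow_le (lam s : Fin n → ℂ) (t a b : ℝ)
    (h1 : ‖∑ i, t * lam i * s i‖ ≤ a) (h2 : ∑ i, ‖t * lam i * s i‖ ^ 2 ≤ 1 / 8)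
    (h3 : ∑ i, (‖t * lam i - t‖ ^ 2 + 2 * t ^ 2 * ‖t * lam i‖ ^ 2) ≤ b) :
    ∫⁻ v, ‖∏ i, (1 + t * ∑ c, centredRow lam s i c * v c)‖ₑ ^ 2 ∂gaussPi (Option (Fin n)) ≤
      ENNReal.ofReal (2 * Real.exp (4 * a ^ 2 + b)) := by
  simp only [sum_centredRow_mul]
  have hmp : MeasurePreserving
      (MeasurableEquiv.piOptionEquivProd (fun _ : Option (Fin n) => ℂ)).symm
      ((gaussPi (Fin n)).prod (complexGaussian 1)) (gaussPi (Option (Fin n))) :=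
    ⟨MeasurableEquiv.measurable _, Measure.pi_map_piOptionEquivProd fun _ => complexGaussian 1⟩
  have hm : Measurable fun v : Option (Fin n) → ℂ => ‖∏ i, (1 + t * (lam i *
      (v (some i) - (n : ℂ)⁻¹ * ∑ j, v (some j) + s i * v none)))‖ₑ ^ 2 := by fun_prop
  rw [← hmp.lintegral_comp hm,
    lintegral_prod_symm _ (by exact (hm.comp hmp.measurable).aemeasurable)]
  calc _ ≤ ∫⁻ ζ, ENNReal.ofReal (Real.exp (4 * a ^ 2 + b)) *
        ENNReal.ofReal (Real.exp (‖ζ‖ ^ 2 / 2)) ∂complexGaussian 1 := by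
        refine lintegral_mono fun ζ => (lintegral_prod_centred_le lam s t ζ).trans ?_
        rw [← ENNReal.ofReal_mul (by positivity), ← Real.exp_add]
        refine ENNReal.ofReal_le_ofReal (Real.exp_le_exp.mpr ?_)
        simp only [add_assoc]
        rw [Finset.sum_add_distrib, Finset.sum_add_distrib]
        have e1 : ∑ i, 2 * (t * lam i * s i * ζ).re ≤ 2 * (a * ‖ζ‖) := by
          rw [← Finset.mul_sum, ← Complex.re_sum, ← Finset.sum_mul]
          have := Complex.re_le_norm ((∑ i, t * lam i * s i) * ζ)
          rw [norm_mul] at this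
          have := mul_le_mul_of_nonneg_right h1 (norm_nonneg ζ)
          linarith
        have e2 : ∑ i, 2 * ‖t * lam i * s i * ζ‖ ^ 2 ≤ 2 * (1 / 8 * ‖ζ‖ ^ 2) := by
          simp only [norm_mul _ ζ, mul_pow]
          rw [← Finset.mul_sum, ← Finset.sum_mul]
          gcongr
        nlinarith [sq_nonneg (2 * a - ‖ζ‖ / 2)]
    _ = _ := by
        rw [lintegral_const_mul _ (by fun_prop), lintegral_exp_half_norm_sq_complexGaussian,
          mul_comm, ENNReal.ofReal_mul (by norm_num)]
        simp

end ElementarySymmetric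

end RandomPermanent

/-! ### Typical vectors of means and the normalised rows. -/

namespace RandomPermanent

section RemainderBound

variable {n : ℕ}

/-- Deterministic bounds satisfied with high probability by the vectors of row and column means;
here `N ^ 6` is the dimension. -/
structure IsTypical (K N : ℝ) (x : Fin n → ℂ) : Prop where
  norm_le : ∀ i, ‖x i‖ * N ^ 2 ≤ 1 / 2
  -- These are the natural sizes for independent Gaussian entries of variance 1/n: ∑ ‖x i‖^(2m) has
  -- order n^(1-m), and by cancellation ‖∑ x i^m‖ has order n^((1-m)/2).
  sum_norm_sq_le : ∑ i, ‖x i‖ ^ 2 ≤ K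
  sum_norm_four_le : ∑ i, ‖x i‖ ^ 4 ≤ K / N ^ 6
  sum_norm_six_le : ∑ i, ‖x i‖ ^ 6 ≤ K / N ^ 12
  norm_sum_one_le : ‖∑ i, x i‖ ≤ K
  norm_sum_sq_le : ‖∑ i, x i ^ 2‖ ≤ K / N ^ 3
  norm_sum_cube_le : ‖∑ i, x i ^ 3‖ ≤ K / N ^ 6
  norm_sum_four_le : ‖∑ i, x i ^ 4‖ ≤ K / N ^ 9
  norm_sum_five_le : ‖∑ i, x i ^ 5‖ ≤ K / N ^ 12

/-- Factor by factor this is n (k - j) ≤ k (n - j). -/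
theorem pow_mul_factorial_le {k : ℕ} (h : k ≤ n) :
    n ^ k * k.factorial ≤ k ^ k * n.descFactorial k := by
  rw [← Nat.descFactorial_self k, Nat.descFactorial_eq_prod_range,
    Nat.descFactorial_eq_prod_range, ← Finset.card_range k, ← Finset.prod_const,
    ← Finset.prod_const, Finset.card_range, ← Finset.prod_mul_distrib,
    ← Finset.prod_mul_distrib]
  refine Finset.prod_le_prod' fun j hj => ?_
  have hj' : j < k := Finset.mem_range.mp hj
  rw [Nat.mul_sub, Nat.mul_sub, mul_comm n k]
  have : k * j ≤ n * j := Nat.mul_le_mul_right _ h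
  omega

theorem factorial_sub_div_le {k : ℕ} (h : k ≤ n) (hn : 0 < n) :
    ((n - k).factorial / n.factorial : ℝ) ≤ (Real.exp 1 / n) ^ k := by
  have h1 : (n ^ k * k.factorial : ℝ) ≤ k ^ k * n.descFactorial k := by
    exact_mod_cast pow_mul_factorial_le h
  have h2 : (k : ℝ) ^ k ≤ Real.exp 1 ^ k * k.factorial := by
    have := Real.pow_div_factorial_le_exp (k : ℝ) (by positivity) k
    rw [div_le_iff₀ (by positivity)] at this
    rwa [← Real.exp_nat_mul, mul_one]
  have h3 : ((n - k).factorial * n.descFactorial k : ℝ) = n.factorial := by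
    exact_mod_cast Nat.factorial_mul_descFactorial h
  have hk : (0 : ℝ) < k.factorial := by positivity
  have h4 : (n : ℝ) ^ k ≤ Real.exp 1 ^ k * n.descFactorial k := by
    refine le_of_mul_le_mul_right (h1.trans ?_) hk
    calc _ ≤ (Real.exp 1 ^ k * k.factorial) * n.descFactorial k := by gcongr
      _ = _ := by ring
  rw [div_pow, div_le_div_iff₀ (by positivity) (by positivity), ← h3]
  calc ((n - k).factorial : ℝ) * n ^ k ≤ (n - k).factorial * (Real.exp 1 ^ k * n.descFactorial k) := by
        gcongr
    _ = _ := by ring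

/-- The row (or column) normalisation factors. -/
noncomputable def invFactor (u : ℂ) (x : Fin n → ℂ) (i : Fin n) : ℂ := (1 + u * x i)⁻¹

namespace IsTypical

variable {K N : ℝ} {x : Fin n → ℂ} {u : ℂ}

theorem norm_mul_le (h : IsTypical K N x) (hu : ‖u‖ ≤ N ^ 2) (i : Fin n) :
    ‖u * x i‖ ≤ 1 / 2 := by
  rw [norm_mul, mul_comm]
  exact (mul_le_mul_of_nonneg_left hu (norm_nonneg _)).trans (h.norm_le i)

theorem one_add_ne_zero (h : IsTypical K N x) (hu : ‖u‖ ≤ N ^ 2) (i : Fin n) :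
    1 + u * x i ≠ 0 := by
  intro h0
  have h1 := h.norm_mul_le hu i
  rw [eq_neg_of_add_eq_zero_right h0] at h1
  norm_num at h1

theorem norm_invFactor_le (h : IsTypical K N x) (hu : ‖u‖ ≤ N ^ 2) (i : Fin n) :
    ‖invFactor u x i‖ ≤ 2 := by
  rw [invFactor, norm_inv]
  have h1 := h.norm_mul_le hu i
  have h2 := norm_sub_norm_le (1 : ℂ) (-(u * x i))
  rw [norm_neg, norm_one, sub_neg_eq_add] at h2
  rw [inv_le_comm₀ (by linarith) (by norm_num)]
  linarith

theorem invFactor_sub_one (h : IsTypical K N x) (hu : ‖u‖ ≤ N ^ 2) (i : Fin n) :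
    invFactor u x i - 1 = -(u * x i * invFactor u x i) := by
  have := h.one_add_ne_zero hu i
  rw [invFactor]
  field_simp
  ring

theorem sum_norm_cube_le (h : IsTypical K N x) (hN : 1 ≤ N) : ∑ i, ‖x i‖ ^ 3 ≤ K / N ^ 3 := by
  have hN0 : 0 < N := by linarith
  -- The cubic sum is interpolated between the quadratic and quartic ones.
  calc ∑ i, ‖x i‖ ^ 3 ≤ ∑ i, (‖x i‖ ^ 2 / N ^ 3 + ‖x i‖ ^ 4 * N ^ 3) / 2 := by
        refine Finset.sum_le_sum fun i _ => ?_
        have h1 : (‖x i‖ ^ 2 / N ^ 3 + ‖x i‖ ^ 4 * N ^ 3) / 2 - ‖x i‖ ^ 3 =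
            ‖x i‖ ^ 2 * (1 - ‖x i‖ * N ^ 3) ^ 2 / N ^ 3 / 2 := by
          field_simp
          ring
        have h2 : 0 ≤ ‖x i‖ ^ 2 * (1 - ‖x i‖ * N ^ 3) ^ 2 / N ^ 3 / 2 := by positivity
        linarith
    _ = ((∑ i, ‖x i‖ ^ 2) / N ^ 3 + (∑ i, ‖x i‖ ^ 4) * N ^ 3) / 2 := by
        rw [← Finset.sum_div, Finset.sum_add_distrib, Finset.sum_div, Finset.sum_mul]
    _ ≤ (K / N ^ 3 + K / N ^ 6 * N ^ 3) / 2 := by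
        gcongr
        · exact h.sum_norm_sq_le
        · exact h.sum_norm_four_le
    _ = K / N ^ 3 := by
        field_simp
        ring

/-- Bounding termwise would only give order n^(1/2) = N ^ 3. Expanding the inverse factor to second
order leaves two sums with cancellation, and absolute values are taken only at third order. -/
theorem norm_sum_invFactor_mul_le (h : IsTypical K N x) (hK : 0 ≤ K) (hN : 1 ≤ N)
    (hu : ‖u‖ ≤ N ^ 2) : ‖∑ i, invFactor u x i * x i‖ ≤ 4 * K * N := by
  have hN0 : 0 < N := by linarith
  have e : ∀ i, invFactor u x i * x i =
      x i - u * x i ^ 2 + u ^ 2 * (x i ^ 3 * invFactor u x i) := by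
    intro i
    have := h.one_add_ne_zero hu i
    rw [invFactor]
    field_simp
    ring
  simp only [e]
  rw [Finset.sum_add_distrib, Finset.sum_sub_distrib, ← Finset.mul_sum, ← Finset.mul_sum]
  have h1 : ‖u * ∑ i, x i ^ 2‖ ≤ K * N := by
    rw [norm_mul]
    calc _ ≤ N ^ 2 * (K / N ^ 3) := by
          gcongr
          exact h.norm_sum_sq_le
      _ = K / N := by field_simp
      _ ≤ K * N := by
          rw [div_le_iff₀ hN0]
          nlinarith [mul_nonneg hK hN0.le]
  have h2 : ‖u ^ 2 * ∑ i, x i ^ 3 * invFactor u x i‖ ≤ 2 * K * N := by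
    rw [norm_mul, norm_pow]
    calc _ ≤ (N ^ 2) ^ 2 * (K / N ^ 3 * 2) := by
          gcongr
          refine (norm_sum_le _ _).trans ?_
          refine le_trans ?_ (mul_le_mul_of_nonneg_right (h.sum_norm_cube_le hN) zero_le_two)
          rw [Finset.sum_mul]
          refine Finset.sum_le_sum fun i _ => ?_
          rw [norm_mul, norm_pow]
          gcongr
          exact h.norm_invFactor_le hu i
      _ = 2 * K * N := by field_simp
  have h3 := h.norm_sum_one_le
  have h4 : K ≤ K * N := by nlinarith
  calc _ ≤ ‖∑ i, x i‖ + ‖u * ∑ i, x i ^ 2‖ + ‖u ^ 2 * ∑ i, x i ^ 3 * invFactor u x i‖ :=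
        (norm_add_le _ _).trans (add_le_add_left (norm_sub_le _ _) _)
    _ ≤ 4 * K * N := by linarith

/-- The second moment of the elementary symmetric polynomials of a normalised row. -/
theorem lintegral_embSum_centredRow_le (h : IsTypical K N x) (hK : 0 ≤ K) (hN : 1 ≤ N)
    (hKN : 32 * K ≤ N ^ 2) (hn : N ^ 6 = n) (hu : ‖u‖ ≤ N ^ 2) {k : ℕ} (hk : 0 < k)
    {r : ℝ} (hr : 0 < r) (hrk : r ^ 4 * k = N ^ 4) :
    ∫⁻ v, ‖embSum k (fun i => ∑ c, centredRow (invFactor u x) (fun i => r * x i) i c * v c)‖ₑ ^ 2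
      ∂gaussPi (Option (Fin n)) ≤
      ENNReal.ofReal ((k.factorial : ℝ) ^ 2 *
        (2 * Real.exp (64 * K ^ 2 + 4 * K + 8) * r ^ 2 * N ^ 2) ^ k) := by
  have hN0 : 0 < N := by linarith
  have hk1 : (1 : ℝ) ≤ k := by exact_mod_cast hk
  set lam := invFactor u x with hlam
  -- Here t = k^(1/4) / N ^ 2. The error terms are of size t² N ^ 4 = √k and n t⁴ = k / N ^ 2, both
  -- at most k, so they cost only an exponential factor in k.
  set t : ℝ := (r * N)⁻¹ with ht
  have ht0 : 0 < t := by positivity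
  have htr : t * r = N⁻¹ := by
    rw [ht]
    field_simp
  have ht4 : t ^ 4 = k / N ^ 8 := by
    rw [ht, eq_div_iff (by positivity)]
    have : (k : ℝ) = N ^ 4 / r ^ 4 := by
      rw [eq_div_iff (by positivity)]
      linarith
    rw [this]
    field_simp
  have ht2 : t ^ 2 * N ^ 4 ≤ k := by
    have h1 : (t ^ 2 * N ^ 4) ^ 2 = k := by
      rw [mul_pow, ← pow_mul, ht4]
      field_simp
    nlinarith [sq_nonneg (t ^ 2 * N ^ 4 - 1), mul_nonneg (sq_nonneg t) (sq_nonneg (N ^ 2))]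
  have h1 : ‖∑ i, t * lam i * (r * x i)‖ ≤ 4 * K := by
    have e : ∑ i, (t : ℂ) * lam i * (r * x i) = ((t * r : ℝ) : ℂ) * ∑ i, lam i * x i := by
      rw [Finset.mul_sum]
      push_cast
      exact Finset.sum_congr rfl fun i _ => by ring
    rw [e, htr, norm_mul, Complex.norm_real, Real.norm_of_nonneg (by positivity)]
    calc _ ≤ N⁻¹ * (4 * K * N) := by
          gcongr
          exact h.norm_sum_invFactor_mul_le hK hN hu
      _ = 4 * K := by field_simp
  have h2 : ∑ i, ‖t * lam i * (r * x i)‖ ^ 2 ≤ 1 / 8 := by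
    calc _ ≤ ∑ i, (N⁻¹ * 2) ^ 2 * ‖x i‖ ^ 2 := by
          refine Finset.sum_le_sum fun i _ => ?_
          have e : (t : ℂ) * lam i * (r * x i) = ((t * r : ℝ) : ℂ) * lam i * x i := by
            push_cast
            ring
          rw [e, htr, norm_mul, norm_mul, Complex.norm_real, Real.norm_of_nonneg (by positivity),
            mul_pow]
          gcongr
          exact h.norm_invFactor_le hu i
      _ = (N⁻¹ * 2) ^ 2 * ∑ i, ‖x i‖ ^ 2 := by rw [Finset.mul_sum]
      _ ≤ (N⁻¹ * 2) ^ 2 * K := by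
          gcongr
          exact h.sum_norm_sq_le
      _ ≤ 1 / 8 := by
          rw [mul_pow, inv_pow, mul_assoc, inv_mul_le_iff₀ (by positivity)]
          linarith
  have h3 : ∑ i, (‖t * lam i - t‖ ^ 2 + 2 * t ^ 2 * ‖t * lam i‖ ^ 2) ≤ (4 * K + 8) * k := by
    rw [Finset.sum_add_distrib]
    have a1 : ∑ i, ‖t * lam i - t‖ ^ 2 ≤ 4 * K * (k : ℝ) := by
      calc _ ≤ ∑ i, t ^ 2 * (N ^ 2 * ‖x i‖ * 2) ^ 2 := by
            refine Finset.sum_le_sum fun i _ => ?_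
            rw [show (t : ℂ) * lam i - t = t * (lam i - 1) by ring, h.invFactor_sub_one hu,
              norm_mul, mul_pow, Complex.norm_real, Real.norm_of_nonneg ht0.le, norm_neg, norm_mul,
              norm_mul]
            gcongr
            exact h.norm_invFactor_le hu i
        _ = (t ^ 2 * N ^ 4) * (4 * ∑ i, ‖x i‖ ^ 2) := by
            rw [Finset.mul_sum, Finset.mul_sum]
            exact Finset.sum_congr rfl fun i _ => by ring
        _ ≤ k * (4 * K) := by
            gcongr
            exact h.sum_norm_sq_le
        _ = _ := by ring
    have a2 : ∑ i, 2 * t ^ 2 * ‖t * lam i‖ ^ 2 ≤ 8 * (k : ℝ) := by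
      calc _ ≤ ∑ _i : Fin n, 2 * t ^ 2 * (t * 2) ^ 2 := by
            refine Finset.sum_le_sum fun i _ => ?_
            rw [norm_mul, Complex.norm_real, Real.norm_of_nonneg ht0.le]
            gcongr
            exact h.norm_invFactor_le hu i
        _ = 8 * (N ^ 6 * t ^ 4) := by
            rw [Finset.sum_const, Finset.card_univ, Fintype.card_fin, nsmul_eq_mul, ← hn]
            ring
        _ = 8 * (k / N ^ 2) := by
            rw [ht4]
            field_simp
        _ ≤ 8 * k := by
            gcongr
            exact div_le_self (by positivity) (one_le_pow₀ hN)
    linarith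
  have hF := lintegral_prod_centredRow_le lam (fun i => r * x i) t (4 * K) ((4 * K + 8) * k)
    h1 h2 h3
  have hE := (lintegral_embSum_le k (centredRow lam fun i => r * x i) t).trans
    (mul_le_mul_right hF _)
  have hpos : 0 < t ^ (2 * k) := by positivity
  have e1 : ‖(t : ℂ) ^ k‖ₑ ^ 2 = ENNReal.ofReal (t ^ (2 * k)) := by
    rw [enorm_sq_eq_ofReal, norm_pow, Complex.norm_real, Real.norm_of_nonneg ht0.le, ← pow_mul,
      mul_comm]
  rw [e1, ← ENNReal.ofReal_natCast, ← ENNReal.ofReal_pow (by positivity),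
    ← ENNReal.ofReal_mul (by positivity)] at hE
  rw [mul_comm, ← ENNReal.le_div_iff_mul_le (Or.inl (by simp [hpos]))
    (Or.inl ENNReal.ofReal_ne_top)] at hE
  refine hE.trans ?_
  rw [← ENNReal.ofReal_div_of_pos hpos]
  refine ENNReal.ofReal_le_ofReal ?_
  rw [mul_div_assoc]
  refine mul_le_mul_of_nonneg_left ?_ (by positivity)
  have e2 : (2 * Real.exp (64 * K ^ 2 + 4 * K + 8) * r ^ 2 * N ^ 2) ^ k =
      (2 * Real.exp (64 * K ^ 2 + 4 * K + 8)) ^ k / t ^ (2 * k) := by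
    rw [pow_mul, ← div_pow]
    congr 1
    rw [ht]
    field_simp
  rw [e2]
  gcongr
  -- The term 64 K² is 4 a² with a = 4 K. As k ≥ 1, it and the prefactor 2 are absorbed into the
  -- k-th power.
  rw [mul_pow (2 : ℝ) (Real.exp _), ← Real.exp_nat_mul]
  gcongr
  · exact le_self_pow₀ (by norm_num) hk.ne'
  · nlinarith [sq_nonneg K]

end IsTypical

end RemainderBound
end RandomPermanent

/-! ### First moment of the normalised permanent for fixed means. -/

namespace RandomPermanent

section ScaledMatrix

variable {n : ℕ}

noncomputable def rowMean (W : Fin n × Fin n → ℂ) (i : Fin n) : ℂ := (n : ℂ)⁻¹ * ∑ j, W (i, j)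

noncomputable def colMean (W : Fin n × Fin n → ℂ) (j : Fin n) : ℂ := (n : ℂ)⁻¹ * ∑ i, W (i, j)

noncomputable def grandMean (W : Fin n × Fin n → ℂ) : ℂ := (n : ℂ)⁻¹ * ∑ i, rowMean W i

/-- The doubly centred part of a matrix. -/
noncomputable def dblCentre (W : Fin n × Fin n → ℂ) (i j : Fin n) : ℂ :=
  W (i, j) - rowMean W i - colMean W j + grandMean W

/-- The matrix `Z` for which `1 + u x i + u y j + u M i j` is
`(1 + u x i) (1 + u y j) (1 + u Z i j)`. -/
noncomputable def scaledMatrix (u : ℂ) (x y : Fin n → ℂ) (M : Fin n → Fin n → ℂ) :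
    Matrix (Fin n) (Fin n) ℂ :=
  Matrix.of fun i j => invFactor u x i * invFactor u y j * (M i j - u * (x i * y j))

/-- Double centring is the tensor product of the row and column centrings, which gives the product
form required by the second moment bound. -/
theorem sum_centredRow_mul_centredRow (lam mu s s' : Fin n → ℂ) (W : Fin n × Fin n → ℂ)
    (i j : Fin n) :
    ∑ e : Fin n × Fin n, centredRow lam s i (some e.1) * centredRow mu s' j (some e.2) * W e =
      lam i * mu j * dblCentre W i j := by
  have h : ∀ e : Fin n × Fin n,
      centredRow lam s i (some e.1) * centredRow mu s' j (some e.2) * W e =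
      lam i * mu j * ((if i = e.1 then (if j = e.2 then W e else 0) else 0)
        - (n : ℂ)⁻¹ * (if i = e.1 then W e else 0) - (n : ℂ)⁻¹ * (if j = e.2 then W e else 0)
        + (n : ℂ)⁻¹ * ((n : ℂ)⁻¹ * W e)) := by
    intro e
    simp only [centredRow]
    split_ifs <;> ring
  simp only [h]
  rw [← Finset.mul_sum]
  congr 1
  rw [Finset.sum_add_distrib, Finset.sum_sub_distrib, Finset.sum_sub_distrib, ← Finset.mul_sum,
    ← Finset.mul_sum, ← Finset.mul_sum, ← Finset.mul_sum]
  simp only [Fintype.sum_prod_type, Finset.sum_ite_eq, Finset.mem_univ, if_true]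
  have h1 : ∑ a, ∑ b, (if i = a then W (a, b) else 0) = ∑ b, W (i, b) := by
    rw [Finset.sum_comm]
    simp
  have h2 : ∑ a, (if i = a then ∑ b, (if j = b then W (a, b) else 0) else 0) = W (i, j) := by simp
  have h3 : ∑ a, ∑ b, (if i = a then (if j = b then W (a, b) else 0) else 0) = W (i, j) := by
    rw [← h2]
    refine Finset.sum_congr rfl fun a _ => ?_
    split_ifs <;> simp
  rw [h1, h3]
  simp only [dblCentre, rowMean, colMean, grandMean, Finset.mul_sum]

/-- From |f| ≤ c / 2 + |f|² / (2 c), an elementary substitute for Cauchy–Schwarz. -/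
theorem lintegral_enorm_le_of_sq {X : Type*} [MeasurableSpace X] {μ : Measure X}
    [IsProbabilityMeasure μ] {f : X → ℂ} {c : ℝ} (hc : 0 < c)
    (h : ∫⁻ x, ‖f x‖ₑ ^ 2 ∂μ ≤ ENNReal.ofReal (c ^ 2)) :
    ∫⁻ x, ‖f x‖ₑ ∂μ ≤ ENNReal.ofReal c := by
  calc ∫⁻ x, ‖f x‖ₑ ∂μ ≤ ∫⁻ x, (ENNReal.ofReal (c / 2) +
        ENNReal.ofReal (1 / (2 * c)) * ‖f x‖ₑ ^ 2) ∂μ := by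
        refine lintegral_mono fun x => ?_
        rw [enorm_sq_eq_ofReal, ← ENNReal.ofReal_mul (by positivity),
          ← ENNReal.ofReal_add (by positivity) (by positivity), ← ofReal_norm]
        refine ENNReal.ofReal_le_ofReal ?_
        have h1 : c / 2 + 1 / (2 * c) * ‖f x‖ ^ 2 - ‖f x‖ = (c - ‖f x‖) ^ 2 / (2 * c) := by
          field_simp
          ring
        have h2 : 0 ≤ (c - ‖f x‖) ^ 2 / (2 * c) := by positivity
        linarith
    _ = ENNReal.ofReal (c / 2) + ENNReal.ofReal (1 / (2 * c)) * ∫⁻ x, ‖f x‖ₑ ^ 2 ∂μ := by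
        rw [lintegral_add_left measurable_const,
          lintegral_const_mul' _ _ ENNReal.ofReal_ne_top]
        simp
    _ ≤ ENNReal.ofReal (c / 2) + ENNReal.ofReal (1 / (2 * c)) * ENNReal.ofReal (c ^ 2) := by
        gcongr
    _ = ENNReal.ofReal c := by
        rw [← ENNReal.ofReal_mul (by positivity),
          ← ENNReal.ofReal_add (by positivity) (by positivity)]
        congr 1
        field_simp
        ring

/-- The exponential rate in the bounds on the chaos components. -/
noncomputable def chaosRate (K : ℝ) : ℝ := 2 * Real.exp (64 * K ^ 2 + 4 * K + 8)

theorem chaosRate_pos (K : ℝ) : 0 < chaosRate K := by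
  unfold chaosRate
  positivity

variable {K N : ℝ} {x y : Fin n → ℂ} {u : ℂ}

theorem lintegral_chaos_le (hx : IsTypical K N x) (hy : IsTypical K N y) (hK : 0 ≤ K)
    (hN : 1 ≤ N) (hKN : 32 * K ≤ N ^ 2) (hn : N ^ 6 = n) (hu : ‖u‖ ≤ N ^ 2) {k : ℕ} (hk : k ≤ n) :
    ∫⁻ W, ‖((n - k).factorial / (n.factorial * k.factorial) : ℂ) *
        embSum₂ k (fun i j => scaledMatrix u x y (dblCentre W) i j)‖ₑ ∂gaussPi (Fin n × Fin n) ≤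
      ENNReal.ofReal ((Real.exp 2 * chaosRate K / N ^ 2) ^ k) := by
  have hN0 : 0 < N := by linarith
  have hn0 : 0 < n := by
    have : 0 < N ^ 6 := by positivity
    rw [hn] at this
    exact_mod_cast this
  have hC := chaosRate_pos K
  rcases Nat.eq_zero_or_pos k with rfl | hk0
  · have : (n.factorial : ℂ) ≠ 0 := by exact_mod_cast n.factorial_ne_zero
    simp [embSum₂, this]
  have hk1 : (1 : ℝ) ≤ k := by exact_mod_cast hk0
  refine lintegral_enorm_le_of_sq (by positivity) ?_
  -- The weight `r` is moved between the vectors r x, r y and the scalar θ = -u / r², leaving (r x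
  -- i)(r y j) θ = -u x i y j. With r⁴ = N⁴ / k one has ‖θ‖² ≤ k, so evaluation at θ costs at most
  -- exp k.
  let r : ℝ := N / (k : ℝ) ^ (1 / 4 : ℝ)
  have hr : 0 < r := by positivity
  have hrk : r ^ 4 * k = N ^ 4 := by
    simp only [r, div_pow]
    rw [← Real.rpow_natCast ((k : ℝ) ^ (1 / 4 : ℝ)) 4, ← Real.rpow_mul (by positivity)]
    norm_num
    field_simp
  let θ : ℂ := -u / (r ^ 2 : ℝ)
  have hθ : ‖θ‖ ^ 2 ≤ k := by
    simp only [θ]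
    rw [norm_div, norm_neg, Complex.norm_real, Real.norm_of_nonneg (by positivity), div_pow,
      div_le_iff₀ (by positivity)]
    calc ‖u‖ ^ 2 ≤ (N ^ 2) ^ 2 := by gcongr
      _ = k * (r ^ 2) ^ 2 := by rw [← pow_mul, ← pow_mul, ← hrk]; ring
  have hZ : ∀ W : Fin n × Fin n → ℂ, (fun i j => scaledMatrix u x y (dblCentre W) i j) =
      fun i j => ∑ e : Fin n × Fin n, centredRow (invFactor u x) (fun i => r * x i) i (some e.1) *
        centredRow (invFactor u y) (fun i => r * y i) j (some e.2) * W e +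
        centredRow (invFactor u x) (fun i => r * x i) i none *
        centredRow (invFactor u y) (fun i => r * y i) j none * θ := by
    intro W
    ext i j
    rw [sum_centredRow_mul_centredRow]
    have : (r : ℂ) ≠ 0 := by exact_mod_cast hr.ne'
    simp only [scaledMatrix, centredRow, θ, Matrix.of_apply]
    push_cast
    field_simp
    ring
  have h1 := lintegral_embSum₂_add_le (k := k) (centredRow (invFactor u x) (fun i => r * x i))
    (centredRow (invFactor u y) (fun i => r * y i)) θ
  simp only [← hZ] at h1
  set I := ∫⁻ W, ‖embSum₂ k (fun i j => scaledMatrix u x y (dblCentre W) i j)‖ₑ ^ 2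
    ∂gaussPi (Fin n × Fin n) with hI
  have h2 := h1.trans (mul_le_mul' (ENNReal.ofReal_le_ofReal (Real.exp_le_exp.mpr hθ))
    (mul_le_mul' (hx.lintegral_embSum_centredRow_le hK hN hKN hn hu hk0 hr hrk)
      (hy.lintegral_embSum_centredRow_le hK hN hKN hn hu hk0 hr hrk)))
  have hkf : (0 : ℝ) < k.factorial := by positivity
  rw [← ENNReal.ofReal_mul (by positivity), ← ENNReal.ofReal_mul (by positivity),
    ← ENNReal.ofReal_natCast, mul_comm, ← ENNReal.le_div_iff_mul_le (Or.inl (by simp [Nat.factorial_ne_zero]))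
    (Or.inl ENNReal.ofReal_ne_top), ← ENNReal.ofReal_div_of_pos hkf] at h2
  simp only [enorm_mul, mul_pow]
  rw [lintegral_const_mul' _ _ (by simp), ← hI]
  refine (mul_le_mul_right h2 _).trans ?_
  rw [enorm_sq_eq_ofReal, ← ENNReal.ofReal_mul (by positivity)]
  refine ENNReal.ofReal_le_ofReal ?_
  have e1 : ‖((n - k).factorial / (n.factorial * k.factorial) : ℂ)‖ =
      ((n - k).factorial / n.factorial : ℝ) / k.factorial := by
    simp
    field_simp
  rw [e1]
  have hfac := factorial_sub_div_le hk hn0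
  rw [← hn] at hfac
  have hkk : (k.factorial : ℝ) ≤ (k : ℝ) ^ k := by exact_mod_cast Nat.factorial_le_pow k
  have hr4 : r ^ 4 = N ^ 4 / k := by
    rw [eq_div_iff (by positivity)]
    exact hrk
  calc _ ≤ ((Real.exp 1 / N ^ 6) ^ k / k.factorial) ^ 2 *
        (Real.exp k * ((k.factorial : ℝ) ^ 2 *
        (chaosRate K * r ^ 2 * N ^ 2) ^ k * ((k.factorial : ℝ) ^ 2 *
        (chaosRate K * r ^ 2 * N ^ 2) ^ k)) / k.factorial) := by
        gcongr
        all_goals exact le_of_eq rfl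
    -- The two symmetric-function bounds give k!⁴, and division by k!³ leaves one k!. It is
    -- compensated by the k^(-k) coming from r^(4k) = (N⁴ / k)^k, which is the reason for the
    -- k-dependence of `r`.
    _ = (k.factorial / (k : ℝ) ^ k) * (Real.exp 3 * chaosRate K ^ 2 / N ^ 4) ^ k := by
        have e2 : Real.exp 3 = Real.exp 1 ^ 3 := by rw [← Real.exp_nat_mul]; norm_num
        have e3 : Real.exp k = Real.exp 1 ^ k := by rw [← Real.exp_nat_mul, mul_one]
        have e4 : (chaosRate K * r ^ 2 * N ^ 2) ^ k * (chaosRate K * r ^ 2 * N ^ 2) ^ k =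
            (chaosRate K ^ 2 * N ^ 8 / k) ^ k := by
          rw [← mul_pow]
          congr 1
          calc _ = chaosRate K ^ 2 * r ^ 4 * N ^ 4 := by ring
            _ = _ := by
              rw [hr4]
              ring
        calc _ = ((Real.exp 1 / N ^ 6) ^ k / k.factorial) ^ 2 * (Real.exp k *
              ((k.factorial : ℝ) ^ 4 * ((chaosRate K * r ^ 2 * N ^ 2) ^ k *
                (chaosRate K * r ^ 2 * N ^ 2) ^ k)) / k.factorial) := by ring
          _ = _ := by
            rw [e4, e2, e3]
            simp only [div_pow, mul_pow]
            field_simp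
            ring
    _ ≤ 1 * (Real.exp 4 * chaosRate K ^ 2 / N ^ 4) ^ k := by
        gcongr
        · exact div_le_one_of_le₀ hkk (by positivity)
        · norm_num
    _ = ((Real.exp 2 * chaosRate K / N ^ 2) ^ k) ^ 2 := by
        rw [one_mul, ← pow_mul, mul_comm k 2, pow_mul]
        congr 1
        rw [div_pow, mul_pow, ← Real.exp_nat_mul]
        norm_num
        ring

theorem measurable_dblCentre (i j : Fin n) :
    Measurable fun W : Fin n × Fin n → ℂ => dblCentre W i j := by
  unfold dblCentre rowMean colMean grandMean rowMean
  fun_prop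

/-- The condition on `u` makes the k-th term at most 2^(-k), so the bound is the sum of a geometric
series, uniformly in n. -/
theorem lintegral_norm_G_le (hx : IsTypical K N x) (hy : IsTypical K N y) (hK : 0 ≤ K)
    (hN : 1 ≤ N) (hKN : 32 * K ≤ N ^ 2) (hn : N ^ 6 = n)
    (hu : ‖u‖ * (2 * Real.exp 2 * chaosRate K) ≤ N ^ 2) :
    ∫⁻ W, ‖G (scaledMatrix u x y (dblCentre W)) u‖ₑ ∂gaussPi (Fin n × Fin n) ≤ 2 := by
  have hN0 : 0 < N := by linarith
  have hC := chaosRate_pos K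
  have hC1 : 1 ≤ 2 * Real.exp 2 * chaosRate K := by
    unfold chaosRate
    have h1 := Real.one_le_exp (by norm_num : (0 : ℝ) ≤ 2)
    have h2 := Real.one_le_exp (by positivity : (0 : ℝ) ≤ 64 * K ^ 2 + 4 * K + 8)
    nlinarith
  have hu' : ‖u‖ ≤ N ^ 2 := (le_mul_of_one_le_right (norm_nonneg _) hC1).trans hu
  have hm : ∀ k, Measurable fun W : Fin n × Fin n → ℂ =>
      embSum₂ k (fun i j => scaledMatrix u x y (dblCentre W) i j) := fun k =>
    measurable_embSum₂ fun i j => by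
      have := measurable_dblCentre i j
      simp only [scaledMatrix, Matrix.of_apply]
      fun_prop
  calc _ ≤ ∫⁻ W, ∑ k ∈ Finset.range (n + 1), ‖u ^ k‖ₑ *
        ‖((n - k).factorial / (n.factorial * k.factorial) : ℂ) *
        embSum₂ k (fun i j => scaledMatrix u x y (dblCentre W) i j)‖ₑ
          ∂gaussPi (Fin n × Fin n) := by
        refine lintegral_mono fun W => ?_
        rw [G_eq_sum]
        refine (enorm_sum_le _ _).trans_eq ?_
        simp only [enorm_mul]
    _ = ∑ k ∈ Finset.range (n + 1), ‖u ^ k‖ₑ * ∫⁻ W,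
        ‖((n - k).factorial / (n.factorial * k.factorial) : ℂ) *
        embSum₂ k (fun i j => scaledMatrix u x y (dblCentre W) i j)‖ₑ
          ∂gaussPi (Fin n × Fin n) := by
        rw [lintegral_finsetSum _ fun k _ => by fun_prop]
        exact Finset.sum_congr rfl fun k _ => lintegral_const_mul' _ _ (by simp)
    _ ≤ ∑ k ∈ Finset.range (n + 1), ENNReal.ofReal ((1 / 2) ^ k) := by
        refine Finset.sum_le_sum fun k hk => ?_
        have hk' : k ≤ n := by simpa [Nat.lt_succ_iff] using hk
        refine (mul_le_mul_right (lintegral_chaos_le hx hy hK hN hKN hn hu' hk') _).trans ?_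
        rw [← ofReal_norm, ← ENNReal.ofReal_mul (by positivity), norm_pow, ← mul_pow]
        refine ENNReal.ofReal_le_ofReal (pow_le_pow_left₀ (by positivity) ?_ _)
        rw [← mul_div_assoc, div_le_iff₀ (by positivity)]
        linarith
    _ ≤ 2 := by
        rw [← ENNReal.ofReal_sum_of_nonneg fun _ _ => by positivity]
        refine (ENNReal.ofReal_le_ofReal (sum_geometric_two_le (n + 1))).trans_eq (by simp)

end ScaledMatrix

end RandomPermanent

/-! ### Decomposition into means and the factorisation of the permanent. -/

namespace RandomPermanent

section Quadratic

variable {n : ℕ}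

/-- The centred column means. -/
noncomputable def colDev (W : Fin n × Fin n → ℂ) (j : Fin n) : ℂ := colMean W j - grandMean W

/-- The matrix with the given entries. -/
def mat (W : Fin n × Fin n → ℂ) : Matrix (Fin n) (Fin n) ℂ := Matrix.of fun i j => W (i, j)

theorem starProjection_span_eq {E : Type*} [NormedAddCommGroup E] [InnerProductSpace ℂ E]
    [FiniteDimensional ℂ E] {S : Set E} {u v : E} (hv : v ∈ Submodule.span ℂ S)
    (h : ∀ w ∈ S, inner ℂ (u - v) w = 0) : (Submodule.span ℂ S).starProjection u = v := by
  refine Submodule.eq_starProjection_of_mem_of_inner_eq_zero hv fun w hw => ?_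
  induction hw using Submodule.span_induction with
  | mem w hw => exact h w hw
  | zero => simp
  | add a b _ _ ha hb => rw [inner_add_right, ha, hb, add_zero]
  | smul c a _ ha => rw [inner_smul_right, ha, mul_zero]

theorem inner_vec (A C : Matrix (Fin n) (Fin n) ℂ) :
    inner ℂ (vec A) (vec C) = ∑ i, ∑ j, C i j * starRingEnd ℂ (A i j) := by
  simp [vec, PiLp.inner_apply, Fintype.sum_prod_type]

theorem sum_row (hn : n ≠ 0) (W : Fin n × Fin n → ℂ) (i : Fin n) :
    ∑ j, W (i, j) = n * rowMean W i := by
  have : (n : ℂ) ≠ 0 := by exact_mod_cast hn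
  rw [rowMean, mul_inv_cancel_left₀ this]

theorem sum_col (hn : n ≠ 0) (W : Fin n × Fin n → ℂ) (j : Fin n) :
    ∑ i, W (i, j) = n * colMean W j := by
  have : (n : ℂ) ≠ 0 := by exact_mod_cast hn
  rw [colMean, mul_inv_cancel_left₀ this]

theorem sum_rowMean (hn : n ≠ 0) (W : Fin n × Fin n → ℂ) :
    ∑ i, rowMean W i = n * grandMean W := by
  have : (n : ℂ) ≠ 0 := by exact_mod_cast hn
  rw [grandMean, mul_inv_cancel_left₀ this]

theorem sum_colMean (hn : n ≠ 0) (W : Fin n × Fin n → ℂ) :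
    ∑ i, colMean W i = n * grandMean W := by
  rw [← sum_rowMean hn]
  simp only [rowMean, colMean, ← Finset.mul_sum]
  rw [Finset.sum_comm]

theorem sum_colDev (hn : n ≠ 0) (W : Fin n × Fin n → ℂ) : ∑ j, colDev W j = 0 := by
  simp [colDev, Finset.sum_sub_distrib, sum_colMean hn]

theorem eq_row_add_col_add_dblCentre (W : Fin n × Fin n → ℂ) (i j : Fin n) :
    W (i, j) = rowMean W i + colDev W j + dblCentre W i j := by
  simp only [colDev, dblCentre]
  ring

theorem sum_dblCentre_row (hn : n ≠ 0) (W : Fin n × Fin n → ℂ) (i : Fin n) :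
    ∑ j, dblCentre W i j = 0 := by
  have h := sum_row hn W i
  simp only [eq_row_add_col_add_dblCentre W i, Finset.sum_add_distrib, sum_colDev hn] at h
  simpa using h

theorem sum_dblCentre_col (hn : n ≠ 0) (W : Fin n × Fin n → ℂ) (j : Fin n) :
    ∑ i, dblCentre W i j = 0 := by
  have h := sum_col hn W j
  simp only [eq_row_add_col_add_dblCentre W _ j, Finset.sum_add_distrib, sum_rowMean hn] at h
  simp only [Finset.sum_const, Finset.card_univ, Fintype.card_fin, nsmul_eq_mul, colDev] at h
  linear_combination h

theorem vec_sub (A C : Matrix (Fin n) (Fin n) ℂ) : vec A - vec C = vec (A - C) := rfl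

theorem H0_starProjection (hn : n ≠ 0) (W : Fin n × Fin n → ℂ) :
    (H0 n).starProjection (vec (mat W)) = vec (Matrix.of fun _ _ => grandMean W) := by
  refine starProjection_span_eq ?_ ?_
  · rw [Submodule.mem_span_singleton]
    exact ⟨grandMean W, by ext; simp [vec, J]⟩
  · rintro w rfl
    rw [vec_sub, inner_vec]
    have : ∑ i, ∑ j, (W (i, j) - grandMean W) = 0 := by
      simp [Finset.sum_sub_distrib, sum_row hn, ← Finset.mul_sum, sum_rowMean hn]
    simp only [J, Matrix.of_apply, one_mul, ← map_sum, mat, Matrix.sub_apply, this, map_zero]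

theorem Hr_starProjection (hn : n ≠ 0) (W : Fin n × Fin n → ℂ) :
    (Hr n).starProjection (vec (mat W)) =
      vec (Matrix.of fun i _ => rowMean W i - grandMean W) := by
  refine starProjection_span_eq ?_ ?_
  · refine Submodule.subset_span ⟨fun i => rowMean W i - grandMean W, ?_, rfl⟩
    simp [Finset.sum_sub_distrib, sum_rowMean hn]
  · rintro w ⟨x, hx, rfl⟩
    rw [vec_sub, inner_vec]
    have : ∀ i, ∑ j, (W (i, j) - (rowMean W i - grandMean W)) = n * grandMean W := by
      intro i
      simp [Finset.sum_sub_distrib, sum_row hn]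
    simp only [Matrix.of_apply, mat, Matrix.sub_apply, ← Finset.mul_sum, ← map_sum, this]
    rw [← Finset.sum_mul, hx, zero_mul]

theorem Hc_starProjection (hn : n ≠ 0) (W : Fin n × Fin n → ℂ) :
    (Hc n).starProjection (vec (mat W)) = vec (Matrix.of fun _ j => colDev W j) := by
  refine starProjection_span_eq ?_ ?_
  · exact Submodule.subset_span ⟨colDev W, sum_colDev hn W, rfl⟩
  · rintro w ⟨x, hx, rfl⟩
    rw [vec_sub, inner_vec, Finset.sum_comm]
    have : ∀ j, ∑ i, (W (i, j) - colDev W j) = n * grandMean W := by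
      intro j
      simp [Finset.sum_sub_distrib, sum_col hn, colDev]
    simp only [Matrix.of_apply, mat, Matrix.sub_apply, ← Finset.mul_sum, ← map_sum, this]
    rw [← Finset.sum_mul, hx, zero_mul]

theorem Hm_starProjection (hn : n ≠ 0) (W : Fin n × Fin n → ℂ) :
    (Hm n).starProjection (vec (mat W)) = vec (Matrix.of fun i j => dblCentre W i j) := by
  refine starProjection_span_eq ?_ ?_
  · exact Submodule.subset_span ⟨_, sum_dblCentre_row hn W, sum_dblCentre_col hn W, rfl⟩
  · rintro w ⟨M, hr, hc, rfl⟩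
    rw [vec_sub, inner_vec]
    have h : ∀ i j, W (i, j) - dblCentre W i j = rowMean W i + colDev W j := by
      intro i j
      rw [eq_row_add_col_add_dblCentre W i j]
      ring
    simp only [Matrix.of_apply, mat, Matrix.sub_apply, h, map_add, mul_add, Finset.sum_add_distrib,
      ← Finset.sum_mul, hr, zero_mul, zero_add]
    rw [Finset.sum_comm]
    simp only [← Finset.sum_mul, hc, zero_mul, Finset.sum_const_zero]

theorem sum_mul_rowMean (hn : n ≠ 0) (W : Fin n × Fin n → ℂ) :
    ∑ i, ∑ j, W (i, j) * rowMean W i = n * ∑ i, rowMean W i ^ 2 := by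
  simp only [← Finset.sum_mul, sum_row hn, Finset.mul_sum]
  exact Finset.sum_congr rfl fun i _ => by ring

theorem sum_mul_colDev (hn : n ≠ 0) (W : Fin n × Fin n → ℂ) :
    ∑ i, ∑ j, W (i, j) * colDev W j = n * ∑ j, colDev W j ^ 2 := by
  rw [Finset.sum_comm]
  simp only [← Finset.sum_mul, sum_col hn]
  have h : ∀ j, n * colMean W j * colDev W j =
      n * colDev W j ^ 2 + n * grandMean W * colDev W j := by
    intro j
    rw [colDev]
    ring
  simp only [h]
  rw [Finset.sum_add_distrib, ← Finset.mul_sum, ← Finset.mul_sum, sum_colDev hn]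
  ring

theorem sum_mul_dblCentre (hn : n ≠ 0) (W : Fin n × Fin n → ℂ) :
    ∑ i, ∑ j, W (i, j) * dblCentre W i j = ∑ i, ∑ j, dblCentre W i j ^ 2 := by
  have h : ∀ i j, W (i, j) * dblCentre W i j =
      rowMean W i * dblCentre W i j + colDev W j * dblCentre W i j + dblCentre W i j ^ 2 := by
    intro i j
    rw [eq_row_add_col_add_dblCentre W i j]
    ring
  simp only [h, Finset.sum_add_distrib, ← Finset.mul_sum, sum_dblCentre_row hn]
  rw [Finset.sum_comm (f := fun i j => colDev W j * dblCentre W i j)]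
  simp [← Finset.mul_sum, sum_dblCentre_col hn]

theorem sum_sq (hn : n ≠ 0) (W : Fin n × Fin n → ℂ) :
    ∑ i, ∑ j, W (i, j) ^ 2 = n * ∑ i, rowMean W i ^ 2 + n * ∑ j, colDev W j ^ 2 +
      ∑ i, ∑ j, dblCentre W i j ^ 2 := by
  rw [← sum_mul_rowMean hn, ← sum_mul_colDev hn, ← sum_mul_dblCentre hn]
  simp only [← Finset.sum_add_distrib, ← mul_add, ← eq_row_add_col_add_dblCentre, sq]

theorem D1_mat (W : Fin n × Fin n → ℂ) : D1 (mat W) = ∑ i, rowMean W i := by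
  simp [D1, vec, mat, rowMean, Fintype.sum_prod_type, Finset.mul_sum]

/-- The grand mean is kept inside the row means, so `H0` and `Hr` together project onto the row-mean
matrix, and the three parts are orthogonal also for the bilinear form. -/
theorem D2_mat (hn : n ≠ 0) (W : Fin n × Fin n → ℂ) :
    D2 (mat W) = -∑ i, rowMean W i ^ 2 - ∑ j, colDev W j ^ 2 +
      1 / ((n : ℂ) * ((n : ℂ) - 1)) * ∑ i, ∑ j, dblCentre W i j ^ 2 := by
  have h0 : (n : ℂ) ≠ 0 := by exact_mod_cast hn
  have h : ∀ i j, vec (mat W) (i, j) * B n (vec (mat W)) (i, j) =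
      -(1 / (n : ℂ)) * (W (i, j) * rowMean W i) + -(1 / (n : ℂ)) * (W (i, j) * colDev W j) +
        1 / ((n : ℂ) * ((n : ℂ) - 1)) * (W (i, j) * dblCentre W i j) := by
    intro i j
    simp only [B, Ppar, add_apply, smul_apply,
      H0_starProjection hn, Hr_starProjection hn, Hc_starProjection hn, Hm_starProjection hn]
    simp [vec, mat]
    ring
  rw [D2, Fintype.sum_prod_type]
  simp only [h, Finset.sum_add_distrib, ← Finset.mul_sum, sum_mul_rowMean hn, sum_mul_colDev hn,
    sum_mul_dblCentre hn]
  field_simp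
  ring

end Quadratic

section Factorisation

variable {n : ℕ}

/-- In the product along a permutation each row factor and each column factor occurs exactly once,
so both products come out of the permanent. -/
theorem G_mat_eq (W : Fin n × Fin n → ℂ) (u : ℂ) (hx : ∀ i, 1 + u * rowMean W i ≠ 0)
    (hy : ∀ j, 1 + u * colDev W j ≠ 0) :
    G (mat W) u = (∏ i, (1 + u * rowMean W i)) * (∏ j, (1 + u * colDev W j)) *
      G (scaledMatrix u (rowMean W) (colDev W) (dblCentre W)) u := by
  rw [G, G, Matrix.permanent, Matrix.permanent, mul_left_comm]
  congr 1
  rw [Finset.mul_sum]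
  refine Finset.sum_congr rfl fun σ _ => ?_
  rw [← Equiv.prod_comp σ fun i => 1 + u * rowMean W i, ← Finset.prod_mul_distrib,
    ← Finset.prod_mul_distrib]
  refine Finset.prod_congr rfl fun i _ => ?_
  have h1 := hx (σ i)
  have h2 := hy i
  simp only [J, mat, scaledMatrix, invFactor, Matrix.add_apply, Matrix.smul_apply, Matrix.of_apply,
    smul_eq_mul]
  rw [eq_row_add_col_add_dblCentre W (σ i) i]
  field_simp
  ring

theorem prod_one_add_eq_exp_sum_log {w : Fin n → ℂ} (hw : ∀ i, 1 + w i ≠ 0) :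
    ∏ i, (1 + w i) = Complex.exp (∑ i, Complex.log (1 + w i)) := by
  rw [Complex.exp_sum]
  exact Finset.prod_congr rfl fun i _ => (Complex.exp_log (hw i)).symm

/-- The regularised product of the row factors is bounded. -/
theorem IsTypical.norm_prod_le {K N : ℝ} {x : Fin n → ℂ} {u : ℂ} (h : IsTypical K N x)
    (hK : 0 ≤ K) (hN : 1 ≤ N) (hu : ‖u‖ ≤ N ^ 2) :
    ‖(∏ i, (1 + u * x i)) * Complex.exp (-(u * ∑ i, x i) + u ^ 2 / 2 * ∑ i, x i ^ 2)‖ ≤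
      Real.exp (2 * K) := by
  have hN0 : 0 < N := by linarith
  rw [prod_one_add_eq_exp_sum_log (h.one_add_ne_zero hu), ← Complex.exp_add, Complex.norm_exp]
  refine Real.exp_le_exp.mpr ((Complex.re_le_norm _).trans ?_)
  -- The exponential cancels orders one and two. At ‖u‖ = N ^ 2 the absolute sum of order m has size
  -- N^(6-m), bounded only from m = 6 on; orders three to five therefore use the cancelling power
  -- sums.
  have e : ∑ i, Complex.log (1 + u * x i) + (-(u * ∑ i, x i) + u ^ 2 / 2 * ∑ i, x i ^ 2) =
      ∑ i, (Complex.log (1 + u * x i) - Complex.logTaylor (5 + 1) (u * x i)) +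
      (u ^ 3 / 3 * ∑ i, x i ^ 3 - u ^ 4 / 4 * ∑ i, x i ^ 4 + u ^ 5 / 5 * ∑ i, x i ^ 5) := by
    have h1 : ∀ w : ℂ, Complex.logTaylor (5 + 1) w =
        w - w ^ 2 / 2 + w ^ 3 / 3 - w ^ 4 / 4 + w ^ 5 / 5 := by
      intro w
      simp [Complex.logTaylor_succ, Complex.logTaylor_zero]
      ring
    simp only [h1, Finset.mul_sum, ← Finset.sum_add_distrib, ← Finset.sum_sub_distrib,
      ← Finset.sum_neg_distrib]
    exact Finset.sum_congr rfl fun i _ => by ring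
  have hrem : ‖∑ i, (Complex.log (1 + u * x i) - Complex.logTaylor (5 + 1) (u * x i))‖ ≤ K := by
    calc _ ≤ ∑ i, (N ^ 2) ^ 6 * ‖x i‖ ^ 6 := by
          refine (norm_sum_le _ _).trans (Finset.sum_le_sum fun i _ => ?_)
          have h2 := h.norm_mul_le hu i
          refine (Complex.norm_log_sub_logTaylor_le 5 (by linarith)).trans ?_
          have h3 : (1 - ‖u * x i‖)⁻¹ ≤ 2 := by
            rw [inv_le_comm₀ (by linarith) (by norm_num)]
            linarith
          calc ‖u * x i‖ ^ (5 + 1) * (1 - ‖u * x i‖)⁻¹ / ((5 : ℕ) + 1)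
              ≤ ‖u * x i‖ ^ (5 + 1) * 2 / ((5 : ℕ) + 1) := by gcongr
            _ ≤ ‖u * x i‖ ^ 6 := by
              have h4 := pow_nonneg (norm_nonneg (u * x i)) 6
              rw [div_le_iff₀ (by positivity)]
              push_cast
              linarith
            _ ≤ (N ^ 2) ^ 6 * ‖x i‖ ^ 6 := by
              rw [norm_mul, mul_pow]
              gcongr
      _ = (N ^ 2) ^ 6 * ∑ i, ‖x i‖ ^ 6 := by rw [Finset.mul_sum]
      _ ≤ (N ^ 2) ^ 6 * (K / N ^ 12) := by
          gcongr
          exact h.sum_norm_six_le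
      _ = K := by field_simp
  have h3 : ‖u ^ 3 / 3 * ∑ i, x i ^ 3‖ ≤ K / 3 := by
    rw [norm_mul, norm_div, norm_pow]
    calc _ ≤ (N ^ 2) ^ 3 / 3 * (K / N ^ 6) := by
          norm_num
          gcongr
          exact h.norm_sum_cube_le
      _ = K / 3 := by field_simp
  have h4 : ‖u ^ 4 / 4 * ∑ i, x i ^ 4‖ ≤ K / 4 := by
    rw [norm_mul, norm_div, norm_pow]
    calc _ ≤ (N ^ 2) ^ 4 / 4 * (K / N ^ 9 * N) := by
          norm_num
          gcongr
          exact h.norm_sum_four_le.trans (le_mul_of_one_le_right (by positivity) hN)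
      _ = K / 4 := by field_simp
  have h5 : ‖u ^ 5 / 5 * ∑ i, x i ^ 5‖ ≤ K / 5 := by
    rw [norm_mul, norm_div, norm_pow]
    calc _ ≤ (N ^ 2) ^ 5 / 5 * (K / N ^ 12 * N ^ 2) := by
          norm_num
          gcongr
          exact h.norm_sum_five_le.trans (le_mul_of_one_le_right (by positivity) (one_le_pow₀ hN))
      _ = K / 5 := by field_simp
  rw [e]
  refine (norm_add_le _ _).trans ?_
  have h6 := norm_add_le (u ^ 3 / 3 * ∑ i, x i ^ 3 - u ^ 4 / 4 * ∑ i, x i ^ 4)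
    (u ^ 5 / 5 * ∑ i, x i ^ 5)
  have h7 := norm_sub_le (u ^ 3 / 3 * ∑ i, x i ^ 3) (u ^ 4 / 4 * ∑ i, x i ^ 4)
  linarith

end Factorisation

end RandomPermanent

/-! ### Third-order contact of the reweighted permanent with 1, and Schwarz's lemma. -/

namespace RandomPermanent

section SecondOrder

variable {n : ℕ}

/-- Pairs of distinct indices are all pairs minus the diagonal; applied to rows and to columns, this
yields the four terms of the degree-two coefficient. -/
theorem sum_embedding_two (F : Fin n → Fin n → ℂ) :
    ∑ i : Fin 2 ↪ Fin n, F (i 0) (i 1) = ∑ a, ∑ b, F a b - ∑ a, F a a := by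
  have h1 : ∑ i : Fin 2 ↪ Fin n, F (i 0) (i 1) =
      ∑ p : {p : Fin n × Fin n | p.1 ≠ p.2}, F p.1.1 p.1.2 :=
    Fintype.sum_equiv Function.Embedding.twoEmbeddingEquiv _ _ fun i => rfl
  have h2 : ∑ p : {p : Fin n × Fin n | p.1 ≠ p.2}, F p.1.1 p.1.2 =
      ∑ p : Fin n × Fin n, if p.1 ≠ p.2 then F p.1 p.2 else 0 := by
    rw [← Finset.sum_filter]
    exact (Finset.sum_subtype (Finset.univ.filter fun p : Fin n × Fin n => p.1 ≠ p.2) (by simp)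
      fun p => F p.1 p.2).symm
  have h3 : ∀ a b, (if a ≠ b then F a b else 0) = F a b - if a = b then F a b else 0 := by
    intro a b
    split_ifs <;> simp_all
  rw [h1, h2, Fintype.sum_prod_type]
  simp [h3, Finset.sum_sub_distrib]

theorem embSum₂_zero (Z : Fin n → Fin n → ℂ) : embSum₂ 0 Z = 1 := by
  simp [embSum₂]

theorem embSum₂_one (Z : Fin n → Fin n → ℂ) : embSum₂ 1 Z = ∑ i, ∑ j, Z i j := by
  rw [embSum₂]
  simp only [Fin.prod_univ_one]
  rw [Fintype.sum_equiv Function.Embedding.oneEmbeddingEquiv _ (fun i => ∑ j, Z i j)]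
  intro i
  exact Fintype.sum_equiv Function.Embedding.oneEmbeddingEquiv _ _ fun j => rfl

theorem embSum₂_two (Z : Fin n → Fin n → ℂ) :
    embSum₂ 2 Z = (∑ i, ∑ j, Z i j) ^ 2 - ∑ i, (∑ j, Z i j) ^ 2 - ∑ j, (∑ i, Z i j) ^ 2 +
      ∑ i, ∑ j, Z i j ^ 2 := by
  rw [embSum₂]
  simp only [Fin.prod_univ_two]
  have h : ∀ i : Fin 2 ↪ Fin n, ∑ j : Fin 2 ↪ Fin n, Z (i 0) (j 0) * Z (i 1) (j 1) =
      ∑ a, ∑ b, Z (i 0) a * Z (i 1) b - ∑ a, Z (i 0) a * Z (i 1) a := fun i =>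
    sum_embedding_two fun a b => Z (i 0) a * Z (i 1) b
  simp only [h]
  rw [sum_embedding_two fun i i' => ∑ a, ∑ b, Z i a * Z i' b - ∑ a, Z i a * Z i' a]
  simp only [Finset.sum_sub_distrib, ← Finset.sum_mul_sum, sq]
  have h2 : ∑ x, ∑ y, ∑ a, Z x a * Z y a = ∑ j, (∑ i, Z i j) * ∑ i, Z i j := by
    simp only [Finset.sum_mul_sum]
    rw [Finset.sum_congr rfl fun x _ => Finset.sum_comm, Finset.sum_comm]
  rw [h2]
  ring

/-- The second Taylor coefficient of `G`. -/
theorem two_mul_coeff_two_eq (hn : 2 ≤ n) (W : Fin n × Fin n → ℂ) :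
    ((n - 2).factorial / (n.factorial * (2).factorial) : ℂ) * embSum₂ 2 (fun i j => mat W i j) =
      (D1 (mat W) ^ 2 + D2 (mat W)) / 2 := by
  have hn0 : n ≠ 0 := by omega
  have h0 : (n : ℂ) ≠ 0 := by exact_mod_cast hn0
  have h1 : (n : ℂ) - 1 ≠ 0 := by
    rw [sub_ne_zero]
    exact_mod_cast (by omega : n ≠ 1)
  have hf : (n.factorial : ℂ) = n * (n - 1) * (n - 2).factorial := by
    obtain ⟨m, rfl⟩ : ∃ m, n = m + 2 := ⟨n - 2, by omega⟩
    rw [Nat.factorial_succ, Nat.factorial_succ]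
    push_cast
    ring
  have hf0 : ((n - 2).factorial : ℂ) ≠ 0 := by exact_mod_cast Nat.factorial_ne_zero _
  have hc : ∑ j, colMean W j ^ 2 = ∑ j, colDev W j ^ 2 + n * grandMean W ^ 2 := by
    have : ∀ j, colMean W j ^ 2 =
        colDev W j ^ 2 + 2 * grandMean W * colDev W j + grandMean W ^ 2 := fun j => by
      rw [colDev]
      ring
    simp only [this, Finset.sum_add_distrib, ← Finset.mul_sum, sum_colDev hn0]
    simp
  rw [embSum₂_two, D2_mat hn0, D1_mat]
  simp only [mat, Matrix.of_apply, sum_row hn0, sum_col hn0, sum_sq hn0, mul_pow,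
    ← Finset.mul_sum, hc, sum_rowMean hn0, hf]
  simp only [Nat.factorial]
  field_simp
  push_cast
  ring

theorem coeff_one_eq (hn : 0 < n) (W : Fin n × Fin n → ℂ) :
    ((n - 1).factorial / (n.factorial * (1).factorial) : ℂ) * embSum₂ 1 (fun i j => mat W i j) =
      D1 (mat W) := by
  have h0 : (n : ℂ) ≠ 0 := by exact_mod_cast hn.ne'
  have hf : (n.factorial : ℂ) = n * (n - 1).factorial := by
    exact_mod_cast (Nat.mul_factorial_pred hn.ne').symm
  have hf0 : ((n - 1).factorial : ℂ) ≠ 0 := by exact_mod_cast Nat.factorial_ne_zero _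
  rw [embSum₂_one, D1_mat, hf]
  simp only [mat, Matrix.of_apply, sum_row hn.ne', ← Finset.mul_sum]
  simp
  field_simp

open Asymptotics in
theorem G_isBigO (hn : 2 ≤ n) (W : Fin n × Fin n → ℂ) :
    (fun u => G (mat W) u - (1 + u * D1 (mat W) +
      u ^ 2 * ((D1 (mat W) ^ 2 + D2 (mat W)) / 2))) =O[𝓝 0] fun u : ℂ => u ^ 3 := by
  have hsplit : ∀ u : ℂ, G (mat W) u - (1 + u * D1 (mat W) +
      u ^ 2 * ((D1 (mat W) ^ 2 + D2 (mat W)) / 2)) =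
      u ^ 3 * ∑ k ∈ Finset.range (n - 2), u ^ k *
        (((n - (3 + k)).factorial / (n.factorial * (3 + k).factorial) : ℂ) *
          embSum₂ (3 + k) fun i j => mat W i j) := by
    intro u
    have hf0 : (n.factorial : ℂ) ≠ 0 := by exact_mod_cast Nat.factorial_ne_zero _
    rw [G_eq_sum, show n + 1 = 3 + (n - 2) by omega, Finset.sum_range_add, Finset.sum_range_succ,
      Finset.sum_range_succ, Finset.sum_range_one, two_mul_coeff_two_eq hn,
      coeff_one_eq (by omega), embSum₂_zero]
    simp only [pow_add u 3, mul_assoc, ← Finset.mul_sum]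
    simp [hf0]
  simp only [hsplit]
  refine ((isBigO_refl (fun u : ℂ => u ^ 3) (𝓝 0)).mul (g₂ := fun _ => (1 : ℂ)) ?_).congr_right
    fun u => by simp
  refine Tendsto.isBigO_one ℂ (Continuous.tendsto ?_ 0)
  fun_prop

open Asymptotics in
theorem X2_sub_one_isBigO (hn : 2 ≤ n) (W : Fin n × Fin n → ℂ) :
    (fun u => X2 (mat W) u - 1) =O[𝓝 0] fun u : ℂ => u ^ 3 := by
  set a := D1 (mat W) with ha
  set b := D2 (mat W) with hb
  have hG := G_isBigO hn W
  have hc : ∀ f : ℂ → ℂ, Continuous f → f =O[𝓝 0] fun _ : ℂ => (1 : ℂ) :=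
    fun f hf => (hf.tendsto 0).isBigO_one ℂ
  have hp : ∀ f : ℂ → ℂ, Continuous f → (fun u => u ^ 3 * f u) =O[𝓝 0] fun u : ℂ => u ^ 3 :=
    fun f hf => ((isBigO_refl (fun u : ℂ => u ^ 3) (𝓝 0)).mul (hc f hf)).congr_right
      fun u => by simp
  have hlin : Tendsto (fun u : ℂ => -(u * a) - u ^ 2 / 2 * b) (𝓝 0) (𝓝 0) := by
    have : Continuous fun u : ℂ => -(u * a) - u ^ 2 / 2 * b := by fun_prop
    simpa using this.tendsto 0
  have hE := (Complex.exp_sub_sum_range_isBigO_pow 3).comp_tendsto hlin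
  have hE2 : (fun u : ℂ => Complex.exp (-(u * a) - u ^ 2 / 2 * b) -
      (1 + (-(u * a) - u ^ 2 / 2 * b) + (-(u * a) - u ^ 2 / 2 * b) ^ 2 / 2)) =O[𝓝 0]
      fun u : ℂ => u ^ 3 := by
    refine (hE.trans ?_).congr_left fun u => ?_
    · refine (hp (fun u => (-a - u / 2 * b) ^ 3) (by fun_prop)).congr_left fun u => ?_
      simp
      ring
    · simp [Finset.sum_range_succ, Nat.factorial]
  have h1 := ((hc (G (mat W)) (differentiable_G _).continuous).mul hE2).congr_right
    (g₂ := fun u => u ^ 3) fun u => by simp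
  have h2 := ((hc (fun u => 1 + (-(u * a) - u ^ 2 / 2 * b) + (-(u * a) - u ^ 2 / 2 * b) ^ 2 / 2)
    (by fun_prop)).mul hG).congr_right (g₂ := fun u => u ^ 3) fun u => by simp
  -- The explicit polynomial is u^(-3) (T P - 1), with T and P the second-order Taylor polynomials
  -- of the exponential and of `G`. Then X2 - 1 = G (exp - T) + T (G - P) + (T P - 1).
  have h3 := hp (fun u => -(a * b / 2) + u * (b ^ 2 / 8 + a ^ 2 * b / 2 + (a ^ 4 - b ^ 2) / 4) +
    u ^ 2 * (a * b ^ 2 / 8 + a * b / 2 * ((a ^ 2 + b) / 2)) + u ^ 3 * (b ^ 2 / 8 * ((a ^ 2 + b) / 2)))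
    (by fun_prop)
  refine ((h1.add h2).add h3).congr_left fun u => ?_
  rw [X2, ← ha, ← hb]
  ring

end SecondOrder

section Bounds

variable {n : ℕ}

theorem norm_sum_dblCentre_sq_le {K N : ℝ} {W : Fin n × Fin n → ℂ}
    (hx : IsTypical K N (rowMean W)) (hy : IsTypical K N (colDev W))
    (hW : ‖∑ i, ∑ j, W (i, j) ^ 2‖ ≤ K * n) (hK : 0 ≤ K) (hN : 1 ≤ N) (hn0 : n ≠ 0) :
    ‖∑ i, ∑ j, dblCentre W i j ^ 2‖ ≤ 3 * K * n := by
  have h1 : ∑ i, ∑ j, dblCentre W i j ^ 2 = ∑ i, ∑ j, W (i, j) ^ 2 - n * ∑ i, rowMean W i ^ 2 - n * ∑ j, colDev W j ^ 2 := by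
    rw [sum_sq hn0]
    ring
  have h2 : ∀ x : Fin n → ℂ, IsTypical K N x → ‖(n : ℂ) * ∑ i, x i ^ 2‖ ≤ K * n := by
    intro x h
    rw [norm_mul, Complex.norm_natCast, mul_comm]
    gcongr
    exact h.norm_sum_sq_le.trans (div_le_self hK (one_le_pow₀ hN))
  rw [h1]
  have h3 := h2 _ hx
  have h4 := h2 _ hy
  have h5 := norm_sub_le (∑ i, ∑ j, W (i, j) ^ 2 - n * ∑ i, rowMean W i ^ 2)
    (n * ∑ j, colDev W j ^ 2)
  have h6 := norm_sub_le (∑ i, ∑ j, W (i, j) ^ 2) (n * ∑ i, rowMean W i ^ 2)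
  linarith

/-- The exponent splits along the decomposition: the row and column parts regularise the two
products, costing exp(2 K) each. The doubly centred part is bounded by exp(3 K), because its sum of
squares is O(n) and ‖u‖² ≤ n. -/
theorem norm_X2_le {K N : ℝ} {W : Fin n × Fin n → ℂ} {u : ℂ}
    (hx : IsTypical K N (rowMean W)) (hy : IsTypical K N (colDev W))
    (hW : ‖∑ i, ∑ j, W (i, j) ^ 2‖ ≤ K * n) (hK : 0 ≤ K) (hN : 1 ≤ N) (hn : N ^ 6 = n)
    (hn2 : 2 ≤ n) (hu : ‖u‖ ≤ N ^ 2) :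
    ‖X2 (mat W) u‖ ≤ Real.exp (7 * K) *
      ‖G (scaledMatrix u (rowMean W) (colDev W) (dblCentre W)) u‖ := by
  have hN0 : 0 < N := by linarith
  have hn0 : n ≠ 0 := by omega
  have hnR : (2 : ℝ) ≤ n := by exact_mod_cast hn2
  set S := ∑ i, ∑ j, dblCentre W i j ^ 2 with hS
  have e : X2 (mat W) u =
      ((∏ i, (1 + u * rowMean W i)) *
        Complex.exp (-(u * ∑ i, rowMean W i) + u ^ 2 / 2 * ∑ i, rowMean W i ^ 2)) *
      ((∏ i, (1 + u * colDev W i)) *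
        Complex.exp (-(u * ∑ i, colDev W i) + u ^ 2 / 2 * ∑ i, colDev W i ^ 2)) *
      Complex.exp (-(u ^ 2 / 2 * (1 / ((n : ℂ) * ((n : ℂ) - 1)) * S))) *
      G (scaledMatrix u (rowMean W) (colDev W) (dblCentre W)) u := by
    rw [X2, G_mat_eq W u (hx.one_add_ne_zero hu) (hy.one_add_ne_zero hu), D1_mat, D2_mat hn0,
      sum_colDev hn0]
    have : ∀ p q a b c g : ℂ, p * Complex.exp a * (q * Complex.exp b) * Complex.exp c * g =
        Complex.exp (a + b + c) * (p * q * g) := by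
      intro p q a b c g
      rw [Complex.exp_add, Complex.exp_add]
      ring
    rw [this]
    congr 2
    ring
  have hSn : ‖S‖ ≤ 3 * K * n := norm_sum_dblCentre_sq_le hx hy hW hK hN hn0
  have hexp : ‖Complex.exp (-(u ^ 2 / 2 * (1 / ((n : ℂ) * ((n : ℂ) - 1)) * S)))‖ ≤
      Real.exp (3 * K) := by
    rw [Complex.norm_exp]
    refine Real.exp_le_exp.mpr ((Complex.re_le_norm _).trans ?_)
    have h1 : ‖(n : ℂ) - 1‖ = (n : ℝ) - 1 := by
      rw [← Complex.ofReal_natCast, ← Complex.ofReal_one, ← Complex.ofReal_sub, Complex.norm_real,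
        Real.norm_of_nonneg (by linarith)]
    rw [norm_neg, norm_mul, norm_mul, norm_div, norm_div, norm_mul, norm_pow, norm_one, h1,
      Complex.norm_natCast, Complex.norm_ofNat]
    have h2 : 0 < (n : ℝ) - 1 := by linarith
    calc _ ≤ (N ^ 2) ^ 2 / 2 * (1 / (n * (n - 1)) * (3 * K * n)) := by gcongr
      _ ≤ n / 2 * (1 / (n * (n - 1)) * (3 * K * n)) := by
        gcongr
        rw [← hn, ← pow_mul]
        exact pow_le_pow_right₀ hN (by norm_num)
      _ = 3 * K * (n / (2 * (n - 1))) := by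
        field_simp
      _ ≤ 3 * K * 1 := by
        gcongr
        rw [div_le_one (by positivity)]
        linarith
      _ = 3 * K := mul_one _
  rw [e, norm_mul, norm_mul, norm_mul]
  have e7 : Real.exp (7 * K) = Real.exp (2 * K) * Real.exp (2 * K) * Real.exp (3 * K) := by
    rw [← Real.exp_add, ← Real.exp_add]
    ring_nf
  rw [e7]
  gcongr
  · exact hx.norm_prod_le hK hN hu
  · exact hy.norm_prod_le hK hN hu

theorem X2_zero (W : Matrix (Fin n) (Fin n) ℂ) : X2 W 0 = 1 := by
  simp [X2, G_zero]

theorem differentiable_X2 (W : Matrix (Fin n) (Fin n) ℂ) : Differentiable ℂ (X2 W) := by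
  have := differentiable_G W
  unfold X2
  fun_prop

open Asymptotics in
/-- A bound on a disc self-improves to third order at the centre. -/
theorem norm_X2_sub_one_le_of_bound (hn : 2 ≤ n) (W : Matrix (Fin n) (Fin n) ℂ) {R K : ℝ}
    (h : ∀ u : ℂ, ‖u‖ ≤ R → ‖X2 W u - 1‖ ≤ K) {u : ℂ} (hu : ‖u‖ < R) :
    ‖X2 W u - 1‖ ≤ K * (‖u‖ / R) ^ 3 := by
  have ho : (fun w => X2 W w - X2 W 0) =o[𝓝 0] fun w : ℂ => ‖w - 0‖ ^ 2 := by
    have h1 := X2_sub_one_isBigO hn fun e : Fin n × Fin n => W e.1 e.2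
    rw [show (mat fun e : Fin n × Fin n => W e.1 e.2) = W from rfl] at h1
    simp only [X2_zero, sub_zero]
    have h2 := h1.trans_isLittleO (isLittleO_pow_pow (𝕜 := ℂ) (show 2 < 3 by norm_num))
    refine h2.norm_right.congr_right fun w => ?_
    rw [norm_pow]
  -- The order parameter is 2: contact o(‖w‖²) gives the exponent 2 + 1.
  have := Complex.dist_le_mul_div_pow_of_mapsTo_ball_of_isLittleO
    (R₁ := R) (R₂ := K) (c := 0) (n := 2) (z := u)
    (differentiable_X2 W).differentiableOn (fun w hw => ?_) ho (by simpa using hu)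
  · simpa [dist_eq_norm, X2_zero] using this
  · rw [mem_ball_zero_iff] at hw
    rw [Metric.mem_closedBall, dist_eq_norm, X2_zero]
    exact h w hw.le

end Bounds

end RandomPermanent

/-! ### Moments of the means and the probability of the typical event. -/

namespace RandomPermanent

section Moments

/-- A sum of pure powers has its coefficient tensor supported on constant index maps, so Wick's
formula gives it directly. -/
theorem lintegral_sum_mul_pow_gaussPi {E : Type*} [Fintype E] [DecidableEq E] (a : E → ℂ) {m : ℕ}
    (hm : m ≠ 0) :
    ∫⁻ v, ‖∑ i, a i * v i ^ m‖ₑ ^ 2 ∂gaussPi E =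
      ENNReal.ofReal (m.factorial * ∑ i, ‖a i‖ ^ 2) := by
  obtain ⟨k, rfl⟩ := Nat.exists_eq_succ_of_ne_zero hm
  let c : (Fin (k + 1) → E) → ℂ := fun f => if ∀ l l', f l = f l' then a (f 0) else 0
  have hinj : Function.Injective fun (i : E) (_ : Fin (k + 1)) => i :=
    fun i j h => congrFun h 0
  have hc0 : ∀ f ∉ Set.range (fun (i : E) (_ : Fin (k + 1)) => i), c f = 0 := by
    intro f hf
    refine if_neg fun h => hf ⟨f 0, ?_⟩
    ext l
    exact h 0 l
  have hc1 : ∀ i : E, c (fun _ => i) = a i := fun i => if_pos fun _ _ => rfl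
  have hc : ∀ f (π : Equiv.Perm (Fin (k + 1))), c (f ∘ π) = c f := by
    intro f π
    by_cases h : ∀ l l', f l = f l'
    · have h' : ∀ l l', (f ∘ π) l = (f ∘ π) l' := fun l l' => h _ _
      simp only [c, if_pos h, if_pos h']
      exact congrArg a (h _ _)
    · have h' : ¬ ∀ l l', (f ∘ π) l = (f ∘ π) l' := fun h1 => h fun l l' => by
        simpa using h1 (π.symm l) (π.symm l')
      simp only [c, if_neg h, if_neg h']
  have h := lintegral_homogeneous_gaussPi c hc
  have e1 : ∑ f, ‖c f‖ ^ 2 = ∑ i, ‖a i‖ ^ 2 :=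
    (Fintype.sum_of_injective _ hinj _ _ (fun f hf => by simp [hc0 f hf])
      fun i => by rw [hc1]).symm
  have e2 : ∀ v : E → ℂ, ∑ f, c f * ∏ l, v (f l) = ∑ i, a i * v i ^ (k + 1) := fun v =>
    (Fintype.sum_of_injective _ hinj _ _ (fun f hf => by simp [hc0 f hf])
      fun i => by simp [hc1]).symm
  rw [e1] at h
  simp only [e2] at h
  exact h

theorem measure_lt_le_of_lintegral_le {X : Type*} [MeasurableSpace X] {μ : Measure X} {f : X → ℝ}
    (hf : Measurable f) {c t : ℝ} (ht : 0 < t)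
    (h : ∫⁻ x, ENNReal.ofReal (f x) ∂μ ≤ ENNReal.ofReal (c * t)) :
    μ {x | t < f x} ≤ ENNReal.ofReal c := by
  have h1 := mul_meas_ge_le_lintegral (μ := μ) hf.ennreal_ofReal (ENNReal.ofReal t)
  have ht' : ENNReal.ofReal t ≠ 0 := by simpa using ht
  have h2 : μ {x | t < f x} ≤ μ {x | ENNReal.ofReal t ≤ ENNReal.ofReal (f x)} :=
    measure_mono fun x hx => ENNReal.ofReal_le_ofReal (le_of_lt hx)
  have h3 := (mul_le_mul_right h2 (ENNReal.ofReal t)).trans (h1.trans h)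
  rw [mul_comm, ← ENNReal.le_div_iff_mul_le (Or.inl ht') (Or.inl ENNReal.ofReal_ne_top),
    ← ENNReal.ofReal_div_of_pos ht, mul_div_cancel_right₀ _ ht.ne'] at h3
  exact h3

variable {n : ℕ} {X : Type*} [MeasurableSpace X] {μ : Measure X}

/-- Only upper bounds on moments are assumed, since the centred column means are not independent.
Markov's inequality gives 162 = (1! + 2! + 3!) + (1! + ⋯ + 5!). The entrywise bound uses the eighth
absolute moment, and 6144 = 4! · 2⁸. -/
theorem measure_not_isTypical_le {x : X → Fin n → ℂ} (hx : Measurable x)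
    (hmom : ∀ (a : Fin n → ℂ) (m : ℕ), m ≠ 0 → ∫⁻ ω, ‖∑ i, a i * x ω i ^ m‖ₑ ^ 2 ∂μ ≤
      ENNReal.ofReal (m.factorial * (∑ i, ‖a i‖ ^ 2) / n ^ m)) {K N : ℝ} (hK : 1 ≤ K) (hN : 0 < N)
    (hn : N ^ 6 = n) :
    μ {ω | ¬ IsTypical K N (x ω)} ≤ ENNReal.ofReal (162 / K + 6144 / N ^ 2) := by
  have hK0 : 0 < K := by linarith
  have hxi : ∀ i, Measurable fun ω => x ω i := fun i => (measurable_pi_apply i).comp hx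
  have hmoment : ∀ i m, m ≠ 0 → ∫⁻ ω, ENNReal.ofReal (‖x ω i‖ ^ (2 * m)) ∂μ ≤
      ENNReal.ofReal (m.factorial / n ^ m) := by
    intro i m hm
    have := hmom (Pi.single i 1) m hm
    have e : ∑ j, ‖(Pi.single i 1 : Fin n → ℂ) j‖ ^ 2 = 1 := by
      rw [Finset.sum_eq_single i] <;> simp +contextual
    rw [e, mul_one] at this
    convert! this using 3 with ω
    rw [enorm_sq_eq_ofReal]
    simp [Pi.single_apply, ← pow_mul, mul_comm]
  have hsum : ∀ m, m ≠ 0 → ∫⁻ ω, ENNReal.ofReal (∑ i, ‖x ω i‖ ^ (2 * m)) ∂μ ≤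
      ENNReal.ofReal (n * (m.factorial / n ^ m)) := by
    intro m hm
    calc _ = ∑ i, ∫⁻ ω, ENNReal.ofReal (‖x ω i‖ ^ (2 * m)) ∂μ := by
          rw [← lintegral_finsetSum _ fun i _ => by have := hxi i; fun_prop]
          congr 1 with ω
          exact ENNReal.ofReal_sum_of_nonneg fun i _ => by positivity
      _ ≤ ∑ _i : Fin n, ENNReal.ofReal (m.factorial / n ^ m) :=
          Finset.sum_le_sum fun i _ => hmoment i m hm
      _ = _ := by
          rw [ENNReal.ofReal_mul (by positivity)]
          simp
  have hpow : ∀ m, m ≠ 0 → ∫⁻ ω, ENNReal.ofReal (‖∑ i, x ω i ^ m‖ ^ 2) ∂μ ≤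
      ENNReal.ofReal (n * (m.factorial / n ^ m)) := by
    intro m hm
    have := hmom (fun _ => 1) m hm
    simp only [one_mul, norm_one, one_pow, Finset.sum_const, Finset.card_univ, Fintype.card_fin,
      nsmul_eq_mul, mul_one, enorm_sq_eq_ofReal] at this
    refine this.trans_eq ?_
    congr 1
    ring
  have s1 : ∀ m, m ≠ 0 → ∀ t : ℝ, 0 < t → t * n ^ m = K * n →
      μ {ω | t < ∑ i, ‖x ω i‖ ^ (2 * m)} ≤ ENNReal.ofReal (m.factorial / K) := by
    intro m hm t ht h
    refine measure_lt_le_of_lintegral_le (by fun_prop) ht ((hsum m hm).trans_eq ?_)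
    congr 1
    have hn0 : (0 : ℝ) < n := by rw [← hn]; positivity
    field_simp
    linarith
  have s2 : ∀ m, m ≠ 0 → ∀ t : ℝ, 0 < t → t ^ 2 * n ^ m = K ^ 2 * n →
      μ {ω | t < ‖∑ i, x ω i ^ m‖} ≤ ENNReal.ofReal (m.factorial / K) := by
    intro m hm t ht h
    have e : {ω | t < ‖∑ i, x ω i ^ m‖} = {ω | t ^ 2 < ‖∑ i, x ω i ^ m‖ ^ 2} := by
      ext ω
      exact (pow_lt_pow_iff_left₀ ht.le (norm_nonneg _) two_ne_zero).symm
    rw [e]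
    refine (measure_lt_le_of_lintegral_le (c := m.factorial / K ^ 2) (by fun_prop)
      (by positivity) ((hpow m hm).trans_eq ?_)).trans (ENNReal.ofReal_le_ofReal ?_)
    · congr 1
      have hn0 : (0 : ℝ) < n := by rw [← hn]; positivity
      field_simp
      linarith
    · gcongr
      exact le_self_pow₀ hK two_ne_zero
  have s3 : μ (⋃ i, {ω | 1 / 2 < ‖x ω i‖ * N ^ 2}) ≤ ENNReal.ofReal (6144 / N ^ 2) := by
    refine (measure_iUnion_fintype_le _ _).trans ?_
    calc _ ≤ ∑ _i : Fin n, ENNReal.ofReal (6144 / N ^ 8) := by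
          refine Finset.sum_le_sum fun i _ => ?_
          have e : {ω | 1 / 2 < ‖x ω i‖ * N ^ 2} =
              {ω | (1 / (2 * N ^ 2)) ^ (2 * 4) < ‖x ω i‖ ^ (2 * 4)} := by
            ext ω
            rw [Set.mem_ofPred_eq, Set.mem_ofPred_eq,
              pow_lt_pow_iff_left₀ (by positivity) (norm_nonneg _) (by norm_num),
              div_lt_iff₀ (by positivity), div_lt_iff₀ (by positivity)]
            constructor <;> intro h <;> linarith
          rw [e]
          have := hxi i
          refine measure_lt_le_of_lintegral_le (by fun_prop) (by positivity)
            ((hmoment i 4 (by norm_num)).trans_eq ?_)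
          rw [← hn]
          congr 1
          simp only [Nat.factorial]
          push_cast
          field_simp
          norm_num
      _ = _ := by
          rw [Finset.sum_const, Finset.card_univ, Fintype.card_fin, nsmul_eq_mul,
            ← ENNReal.ofReal_natCast, ← ENNReal.ofReal_mul (by positivity), ← hn]
          congr 1
          field_simp
  have hsub : {ω | ¬ IsTypical K N (x ω)} ⊆ (⋃ i, {ω | 1 / 2 < ‖x ω i‖ * N ^ 2}) ∪
      ({ω | K < ∑ i, ‖x ω i‖ ^ (2 * 1)} ∪ ({ω | K / N ^ 6 < ∑ i, ‖x ω i‖ ^ (2 * 2)} ∪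
      ({ω | K / N ^ 12 < ∑ i, ‖x ω i‖ ^ (2 * 3)} ∪ ({ω | K < ‖∑ i, x ω i ^ 1‖} ∪
      ({ω | K / N ^ 3 < ‖∑ i, x ω i ^ 2‖} ∪ ({ω | K / N ^ 6 < ‖∑ i, x ω i ^ 3‖} ∪
      ({ω | K / N ^ 9 < ‖∑ i, x ω i ^ 4‖} ∪ {ω | K / N ^ 12 < ‖∑ i, x ω i ^ 5‖}))))))) := by
    intro ω hω
    by_contra h
    simp only [Set.mem_union, Set.mem_iUnion, Set.mem_ofPred_eq, not_or, not_exists, not_lt] at h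
    obtain ⟨h0, h1, h2, h3, h4, h5, h6, h7, h8⟩ := h
    simp only [pow_one] at h4
    exact hω ⟨h0, h1, h2, h3, h4, h5, h6, h7, h8⟩
  have u : ∀ {s t : Set X} {a b : ℝ}, 0 ≤ a → 0 ≤ b → μ s ≤ ENNReal.ofReal a →
      μ t ≤ ENNReal.ofReal b → μ (s ∪ t) ≤ ENNReal.ofReal (a + b) := by
    intro s t a b ha hb hs ht
    rw [ENNReal.ofReal_add ha hb]
    exact (measure_union_le _ _).trans (add_le_add hs ht)
  refine (measure_mono hsub).trans ((u (by positivity) (by positivity) s3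
    (u (by positivity) (by positivity) (s1 1 (by norm_num) K hK0 (by ring))
    (u (by positivity) (by positivity) (s1 2 (by norm_num) _ (by positivity) (by
      rw [← hn]; field_simp))
    (u (by positivity) (by positivity) (s1 3 (by norm_num) _ (by positivity) (by
      rw [← hn]; field_simp))
    (u (by positivity) (by positivity) (s2 1 (by norm_num) K hK0 (by ring))
    (u (by positivity) (by positivity) (s2 2 (by norm_num) _ (by positivity) (by
      rw [← hn]; field_simp))
    (u (by positivity) (by positivity) (s2 3 (by norm_num) _ (by positivity) (by
      rw [← hn]; field_simp))
    (u (by positivity) (by positivity) (s2 4 (by norm_num) _ (by positivity) (by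
      rw [← hn]; field_simp))
    (s2 5 (by norm_num) _ (by positivity) (by
      rw [← hn]; field_simp)))))))))).trans_eq ?_)
  congr 1
  simp only [Nat.factorial]
  push_cast
  ring

/-- The variance-one normalised fibre sums of `p`. -/
noncomputable def fibreMatrix {E : Type*} (p : E → Fin n) : Matrix (Fin n) E ℂ :=
  Matrix.of fun i e => if p e = i then (((√n)⁻¹ : ℝ) : ℂ) else 0

theorem fibreMatrix_mul_conjTranspose {E : Type*} [Fintype E] (hn : n ≠ 0) {p : E → Fin n}
    (hp : ∀ i, (Finset.univ.filter fun e => p e = i).card = n) :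
    fibreMatrix p * (fibreMatrix p).conjTranspose = 1 := by
  have h0 : (n : ℝ) ≠ 0 := by exact_mod_cast hn
  have hc : (((√n)⁻¹ : ℝ) : ℂ) * (((√n)⁻¹ : ℝ) : ℂ) = (n : ℂ)⁻¹ := by
    rw [← Complex.ofReal_mul, ← mul_inv, Real.mul_self_sqrt (Nat.cast_nonneg n)]
    simp
  ext i j
  rw [Matrix.mul_apply, Matrix.one_apply]
  have h : ∀ e, fibreMatrix p i e * (fibreMatrix p).conjTranspose e j =
      if p e = i then (if i = j then (n : ℂ)⁻¹ else 0) else 0 := by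
    intro e
    simp only [fibreMatrix, Matrix.conjTranspose_apply, Matrix.of_apply]
    by_cases h1 : p e = i
    · by_cases h2 : i = j
      · simp only [h1, h2, if_true]
        rw [← hc]
        simp
      · simp [h1, h2]
    · simp [h1]
  simp only [h]
  rw [← Finset.sum_filter, Finset.sum_const, hp]
  have h0' : (n : ℂ) ≠ 0 := by exact_mod_cast hn
  split_ifs <;> simp [h0']

theorem card_fst_fibre (i : Fin n) :
    (Finset.univ.filter fun e : Fin n × Fin n => e.1 = i).card = n := by
  rw [Finset.card_filter, Fintype.sum_prod_type, Finset.sum_comm]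
  simp

theorem card_snd_fibre (i : Fin n) :
    (Finset.univ.filter fun e : Fin n × Fin n => e.2 = i).card = n := by
  rw [Finset.card_filter, Fintype.sum_prod_type]
  simp

theorem inv_sqrt_mul_fibreMatrix {E : Type*} [Fintype E] (p : E → Fin n) (v : E → ℂ)
    (i : Fin n) : (((√n)⁻¹ : ℝ) : ℂ) * (fibreMatrix p).mulVec v i =
      (n : ℂ)⁻¹ * ∑ e, if p e = i then v e else 0 := by
  have hc : (((√n)⁻¹ : ℝ) : ℂ) * (((√n)⁻¹ : ℝ) : ℂ) = (n : ℂ)⁻¹ := by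
    rw [← Complex.ofReal_mul, ← mul_inv, Real.mul_self_sqrt (Nat.cast_nonneg n)]
    simp
  rw [Matrix.mulVec, dotProduct, ← hc, mul_assoc]
  congr 1
  rw [Finset.mul_sum]
  refine Finset.sum_congr rfl fun e _ => ?_
  simp only [fibreMatrix, Matrix.of_apply]
  split_ifs <;> simp

theorem rowMean_eq (W : Fin n × Fin n → ℂ) (i : Fin n) :
    rowMean W i = (((√n)⁻¹ : ℝ) : ℂ) * (fibreMatrix Prod.fst).mulVec W i := by
  rw [inv_sqrt_mul_fibreMatrix, rowMean, Fintype.sum_prod_type, Finset.sum_comm]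
  simp

theorem colMean_eq (W : Fin n × Fin n → ℂ) (j : Fin n) :
    colMean W j = (((√n)⁻¹ : ℝ) : ℂ) * (fibreMatrix Prod.snd).mulVec W j := by
  rw [inv_sqrt_mul_fibreMatrix, colMean, Fintype.sum_prod_type]
  simp

theorem lintegral_scaled_moment (a : Fin n → ℂ) {m : ℕ} (hm : m ≠ 0) :
    ∫⁻ v, ‖∑ i, a i * ((((√n)⁻¹ : ℝ) : ℂ) * v i) ^ m‖ₑ ^ 2 ∂gaussPi (Fin n) =
      ENNReal.ofReal (m.factorial * (∑ i, ‖a i‖ ^ 2) / n ^ m) := by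
  have e : ∀ v : Fin n → ℂ, ∑ i, a i * ((((√n)⁻¹ : ℝ) : ℂ) * v i) ^ m =
      ∑ i, (a i * (((√n)⁻¹ : ℝ) : ℂ) ^ m) * v i ^ m := fun v =>
    Finset.sum_congr rfl fun i _ => by ring
  simp only [e]
  rw [lintegral_sum_mul_pow_gaussPi _ hm]
  congr 1
  have h : ∀ i, ‖a i * (((√n)⁻¹ : ℝ) : ℂ) ^ m‖ ^ 2 = ‖a i‖ ^ 2 * (n ^ m : ℝ)⁻¹ := by
    intro i
    rw [norm_mul, norm_pow, Complex.norm_real, Real.norm_of_nonneg (by positivity), mul_pow,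
      ← pow_mul, mul_comm m, pow_mul, inv_pow, Real.sq_sqrt (by positivity), inv_pow]
  simp only [h, ← Finset.sum_mul]
  ring

theorem lintegral_rowMean_moment (hn : n ≠ 0) (a : Fin n → ℂ) {m : ℕ} (hm : m ≠ 0) :
    ∫⁻ W, ‖∑ i, a i * rowMean W i ^ m‖ₑ ^ 2 ∂gaussPi (Fin n × Fin n) =
      ENNReal.ofReal (m.factorial * (∑ i, ‖a i‖ ^ 2) / n ^ m) := by
  rw [← lintegral_scaled_moment a hm, ← gaussPi_map_mulVec (fibreMatrix Prod.fst)
    (fibreMatrix_mul_conjTranspose hn card_fst_fibre), lintegral_map (by fun_prop) (by fun_prop)]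
  simp only [rowMean_eq]

theorem colDev_eq (hn : n ≠ 0) (W : Fin n × Fin n → ℂ) (j : Fin n) :
    colDev W j = (((√n)⁻¹ : ℝ) : ℂ) * ((fibreMatrix Prod.snd).mulVec W -
      (Matrix.of fun _ _ : Fin n => (n : ℂ)⁻¹).mulVec ((fibreMatrix Prod.snd).mulVec W)) j := by
  have h0 : (n : ℂ) ≠ 0 := by exact_mod_cast hn
  have h : grandMean W = (n : ℂ)⁻¹ * ∑ i, colMean W i := by
    rw [sum_colMean hn, inv_mul_cancel_left₀ h0]
  rw [colDev, h, colMean_eq, Pi.sub_apply, mul_sub]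
  simp only [colMean_eq]
  congr 1
  rw [Matrix.mulVec, dotProduct]
  simp only [Matrix.of_apply, ← Finset.mul_sum]
  ring

/-- Projecting out the mean does not increase the second moment of a holomorphic function, so
centred column means are dominated by independent uncentred ones. -/
theorem lintegral_colDev_moment_le (hn : n ≠ 0) (a : Fin n → ℂ) {m : ℕ} (hm : m ≠ 0) :
    ∫⁻ W, ‖∑ i, a i * colDev W i ^ m‖ₑ ^ 2 ∂gaussPi (Fin n × Fin n) ≤
      ENNReal.ofReal (m.factorial * (∑ i, ‖a i‖ ^ 2) / n ^ m) := by
  have h0 : (n : ℂ) ≠ 0 := by exact_mod_cast hn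
  rw [← lintegral_scaled_moment a hm]
  simp only [colDev_eq hn]
  rw [← lintegral_map (μ := gaussPi (Fin n × Fin n)) (f := fun v : Fin n → ℂ =>
      ‖∑ i, a i * ((((√n)⁻¹ : ℝ) : ℂ) *
        (v - (Matrix.of fun _ _ : Fin n => (n : ℂ)⁻¹).mulVec v) i) ^ m‖ₑ ^ 2)
    (g := fun W => (fibreMatrix Prod.snd).mulVec W) (by fun_prop) (by fun_prop),
    gaussPi_map_mulVec (fibreMatrix Prod.snd)
      (fibreMatrix_mul_conjTranspose hn card_snd_fibre)]
  refine lintegral_comp_sub_mulVec_le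
    (h := fun v : Fin n → ℂ => ∑ i, a i * ((((√n)⁻¹ : ℝ) : ℂ) * v i) ^ m) ?_ ?_ (by fun_prop) ?_
  · ext i j
    simp [Matrix.mul_apply, h0]
  · ext i j
    simp
  · intro v w
    simp only [Pi.add_apply, Pi.smul_apply, smul_eq_mul]
    fun_prop

theorem measurable_rowMean : Measurable fun W : Fin n × Fin n → ℂ => rowMean W := by
  unfold rowMean
  fun_prop

theorem measurable_colDev : Measurable fun W : Fin n × Fin n → ℂ => colDev W := by
  unfold colDev colMean grandMean rowMean
  fun_prop

theorem measure_sum_sq_le {K : ℝ} (hn : n ≠ 0) (hK : 1 ≤ K) :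
    gaussPi (Fin n × Fin n) {W | K * n < ‖∑ i, ∑ j, W (i, j) ^ 2‖} ≤ ENNReal.ofReal (2 / K) := by
  have hK0 : 0 < K := by linarith
  have hn0 : (0 : ℝ) < n := by exact_mod_cast Nat.pos_of_ne_zero hn
  have e : {W : Fin n × Fin n → ℂ | K * n < ‖∑ i, ∑ j, W (i, j) ^ 2‖} =
      {W | (K * n) ^ 2 < ‖∑ e, W e ^ 2‖ ^ 2} := by
    ext W
    rw [Set.mem_ofPred_eq, Set.mem_ofPred_eq, Fintype.sum_prod_type]
    exact (pow_lt_pow_iff_left₀ (by positivity) (norm_nonneg _) two_ne_zero).symm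
  rw [e]
  have h := lintegral_sum_mul_pow_gaussPi (E := Fin n × Fin n) (fun _ => 1) two_ne_zero
  simp only [one_mul, enorm_sq_eq_ofReal] at h
  refine (measure_lt_le_of_lintegral_le (c := 2 / K ^ 2) (by fun_prop) (by positivity)
    (h.trans_le (ENNReal.ofReal_le_ofReal ?_))).trans (ENNReal.ofReal_le_ofReal ?_)
  · simp [Nat.factorial]
    field_simp
    exact le_rfl
  · gcongr
    exact le_self_pow₀ hK two_ne_zero

/-- The event on which the means and the sum of squares are under control. -/
def typicalSet (K N : ℝ) (n : ℕ) : Set (Fin n × Fin n → ℂ) :=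
  {W | IsTypical K N (rowMean W) ∧ IsTypical K N (colDev W) ∧
    ‖∑ i, ∑ j, W (i, j) ^ 2‖ ≤ K * n}

/-- Rows and columns each contribute 162 / K + 6144 / N ^ 2, and the sum of squares contributes 2 /
K. -/
theorem measure_compl_typicalSet_le {K N : ℝ} (hn : N ^ 6 = n) (hK : 1 ≤ K) (hN : 0 < N) :
    gaussPi (Fin n × Fin n) (typicalSet K N n)ᶜ ≤
      ENNReal.ofReal (326 / K + 12288 / N ^ 2) := by
  have hn0 : n ≠ 0 := by
    rintro rfl
    have : 0 < N ^ 6 := by positivity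
    simp_all
  have hK0 : 0 < K := by linarith
  have h1 := measure_not_isTypical_le (K := K) (N := N) measurable_rowMean
    (fun a m hm => (lintegral_rowMean_moment hn0 a hm).le) hK hN hn
  have h2 := measure_not_isTypical_le (K := K) (N := N) measurable_colDev
    (fun a m hm => lintegral_colDev_moment_le hn0 a hm) hK hN hn
  have h3 := measure_sum_sq_le hn0 hK
  have hsub : (typicalSet K N n)ᶜ ⊆ {W | ¬ IsTypical K N (rowMean W)} ∪
      ({W | ¬ IsTypical K N (colDev W)} ∪ {W | K * n < ‖∑ i, ∑ j, W (i, j) ^ 2‖}) := by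
    intro W hW
    by_contra h
    simp only [Set.mem_union, Set.mem_ofPred_eq, not_or, not_not, not_lt] at h
    exact hW h
  refine (measure_mono hsub).trans ((measure_union_le _ _).trans
    ((add_le_add h1 ((measure_union_le _ _).trans (add_le_add h2 h3))).trans_eq ?_))
  rw [← ENNReal.ofReal_add (by positivity) (by positivity),
    ← ENNReal.ofReal_add (by positivity) (by positivity)]
  congr 1
  ring

end Moments

end RandomPermanent

/-! ### Resampling the doubly centred part. -/

namespace RandomPermanent

section Resampling

variable {n : ℕ}

/-- The projection of vectors onto those of zero sum. -/
noncomputable def centring (n : ℕ) : Matrix (Fin n) (Fin n) ℂ := 1 - Matrix.of fun _ _ => (n : ℂ)⁻¹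

theorem centring_mul_self (hn : n ≠ 0) : centring n * centring n = centring n := by
  have h0 : (n : ℂ) ≠ 0 := by exact_mod_cast hn
  have h : (Matrix.of fun _ _ : Fin n => (n : ℂ)⁻¹) * (Matrix.of fun _ _ : Fin n => (n : ℂ)⁻¹) =
      Matrix.of fun _ _ : Fin n => (n : ℂ)⁻¹ := by
    ext i j
    simp [Matrix.mul_apply, h0]
  simp only [centring]
  rw [mul_sub, sub_mul, sub_mul, h]
  simp

theorem conjTranspose_centring : (centring n).conjTranspose = centring n := by
  ext i j
  simp [centring, Matrix.one_apply, eq_comm]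

open scoped Kronecker in
/-- The projection onto doubly centred matrices. -/
noncomputable def dblCentring (n : ℕ) : Matrix (Fin n × Fin n) (Fin n × Fin n) ℂ :=
  centring n ⊗ₖ centring n

theorem dblCentring_mul_self (hn : n ≠ 0) : dblCentring n * dblCentring n = dblCentring n := by
  rw [dblCentring, ← Matrix.mul_kronecker_mul, centring_mul_self hn]

theorem conjTranspose_dblCentring : (dblCentring n).conjTranspose = dblCentring n := by
  rw [dblCentring, Matrix.conjTranspose_kronecker, conjTranspose_centring]

theorem dblCentring_mulVec (W : Fin n × Fin n → ℂ) (i j : Fin n) :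
    (dblCentring n).mulVec W (i, j) = dblCentre W i j := by
  have h := sum_centredRow_mul_centredRow (fun _ => 1) (fun _ => 1) 0 0 W i j
  rw [one_mul, one_mul] at h
  rw [← h, Matrix.mulVec, dotProduct]
  refine Finset.sum_congr rfl fun e _ => ?_
  simp [dblCentring, Matrix.kroneckerMap_apply, centring, centredRow, Matrix.one_apply]

/-- Exchanging the doubly centred part for that of another matrix leaves all means unchanged, so
events defined by means are stable under resampling. -/
theorem means_of_eq_add (hn : n ≠ 0) {T W V : Fin n × Fin n → ℂ}
    (h : ∀ i j, T (i, j) = rowMean W i + colDev W j + dblCentre V i j) :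
    rowMean T = rowMean W ∧ colDev T = colDev W ∧ dblCentre T = dblCentre V := by
  have h0 : (n : ℂ) ≠ 0 := by exact_mod_cast hn
  have h1 : rowMean T = rowMean W := by
    ext i
    rw [rowMean]
    simp only [h, Finset.sum_add_distrib, sum_colDev hn, sum_dblCentre_row hn]
    simp [h0]
  have hg : grandMean T = grandMean W := by rw [grandMean, grandMean, h1]
  have h2 : colDev T = colDev W := by
    ext j
    rw [colDev, hg, colMean]
    simp only [h, Finset.sum_add_distrib, sum_rowMean hn, sum_dblCentre_col hn]
    simp only [Finset.sum_const, Finset.card_univ, Fintype.card_fin, nsmul_eq_mul]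
    field_simp
    ring
  refine ⟨h1, h2, ?_⟩
  ext i j
  have h3 := eq_row_add_col_add_dblCentre T i j
  rw [h, h1, h2] at h3
  exact (add_left_cancel h3).symm

theorem measurableSet_isTypical (K N : ℝ) : MeasurableSet {x : Fin n → ℂ | IsTypical K N x} := by
  have e : {x : Fin n → ℂ | IsTypical K N x} = {x | (∀ i, ‖x i‖ * N ^ 2 ≤ 1 / 2) ∧
      ∑ i, ‖x i‖ ^ 2 ≤ K ∧ ∑ i, ‖x i‖ ^ 4 ≤ K / N ^ 6 ∧ ∑ i, ‖x i‖ ^ 6 ≤ K / N ^ 12 ∧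
      ‖∑ i, x i‖ ≤ K ∧ ‖∑ i, x i ^ 2‖ ≤ K / N ^ 3 ∧ ‖∑ i, x i ^ 3‖ ≤ K / N ^ 6 ∧
      ‖∑ i, x i ^ 4‖ ≤ K / N ^ 9 ∧ ‖∑ i, x i ^ 5‖ ≤ K / N ^ 12} := by
    ext x
    exact ⟨fun ⟨h0, h1, h2, h3, h4, h5, h6, h7, h8⟩ => ⟨h0, h1, h2, h3, h4, h5, h6, h7, h8⟩,
      fun ⟨h0, h1, h2, h3, h4, h5, h6, h7, h8⟩ => ⟨h0, h1, h2, h3, h4, h5, h6, h7, h8⟩⟩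
  rw [e]
  simp only [Set.ofPred_and, Set.ofPred_forall]
  refine MeasurableSet.inter (MeasurableSet.iInter fun i =>
    measurableSet_le (by fun_prop) (by fun_prop)) ?_
  iterate 7 refine MeasurableSet.inter (measurableSet_le (by fun_prop) (by fun_prop)) ?_
  exact measurableSet_le (by fun_prop) (by fun_prop)

theorem measurable_G_scaledMatrix (u : ℂ) :
    Measurable fun p : (Fin n × Fin n → ℂ) × (Fin n × Fin n → ℂ) =>
      G (scaledMatrix u (rowMean p.1) (colDev p.1) (dblCentre p.2)) u := by
  unfold G Matrix.permanent
  simp only [scaledMatrix, invFactor, J, Matrix.add_apply, Matrix.smul_apply, Matrix.of_apply,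
    smul_eq_mul, dblCentre, colDev, rowMean, colMean, grandMean]
  fun_prop

/-- The doubly centred part is replaced by an independent copy, which preserves the law. The event
depends on the means only, so for fixed typical means the inner integral is at most 2. -/
theorem setLIntegral_norm_G_le {K N : ℝ} (hK : 0 ≤ K) (hN : 1 ≤ N)
    (hKN : 32 * K ≤ N ^ 2) (hn : N ^ 6 = n) {u : ℂ}
    (hu : ‖u‖ * (2 * Real.exp 2 * chaosRate K) ≤ N ^ 2) :
    ∫⁻ W in {W | IsTypical K N (rowMean W) ∧ IsTypical K N (colDev W)},
      ‖G (scaledMatrix u (rowMean W) (colDev W) (dblCentre W)) u‖ₑ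
        ∂gaussPi (Fin n × Fin n) ≤ 2 := by
  have hn0 : n ≠ 0 := by
    rintro rfl
    have : 0 < N ^ 6 := by positivity
    simp_all
  set E : Set (Fin n × Fin n → ℂ) := {W | IsTypical K N (rowMean W) ∧ IsTypical K N (colDev W)}
  have hE : MeasurableSet E :=
    (measurable_rowMean (measurableSet_isTypical K N)).inter
      (measurable_colDev (measurableSet_isTypical K N))
  have hmp := measurePreserving_sub_add_mulVec (dblCentring_mul_self hn0)
    (conjTranspose_dblCentring (n := n))
  have hT : ∀ p : (Fin n × Fin n → ℂ) × (Fin n × Fin n → ℂ),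
      rowMean (p.1 - (dblCentring n).mulVec p.1 + (dblCentring n).mulVec p.2) = rowMean p.1 ∧
      colDev (p.1 - (dblCentring n).mulVec p.1 + (dblCentring n).mulVec p.2) = colDev p.1 ∧
      dblCentre (p.1 - (dblCentring n).mulVec p.1 + (dblCentring n).mulVec p.2) =
        dblCentre p.2 := by
    intro p
    refine means_of_eq_add hn0 fun i j => ?_
    rw [Pi.add_apply, Pi.sub_apply, dblCentring_mulVec, dblCentring_mulVec]
    rw [eq_row_add_col_add_dblCentre p.1 i j]
    ring
  have hmG : Measurable fun W : Fin n × Fin n → ℂ =>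
      ‖G (scaledMatrix u (rowMean W) (colDev W) (dblCentre W)) u‖ₑ :=
    ((measurable_G_scaledMatrix u).comp (measurable_id.prodMk measurable_id)).enorm
  let F : (Fin n × Fin n → ℂ) × (Fin n × Fin n → ℂ) → ℝ≥0∞ := fun p => E.indicator
    (fun _ => ‖G (scaledMatrix u (rowMean p.1) (colDev p.1) (dblCentre p.2)) u‖ₑ) p.1
  have hF : Measurable F := (measurable_G_scaledMatrix u).enorm.indicator (measurable_fst hE)
  rw [← lintegral_indicator hE, ← hmp.lintegral_comp (hmG.indicator hE)]
  calc _ = ∫⁻ p, F p ∂(gaussPi (Fin n × Fin n)).prod (gaussPi (Fin n × Fin n)) := by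
        refine lintegral_congr fun p => ?_
        obtain ⟨h1, h2, h3⟩ := hT p
        have hm : p.1 - (dblCentring n).mulVec p.1 + (dblCentring n).mulVec p.2 ∈ E ↔ p.1 ∈ E := by
          simp only [E, Set.mem_ofPred_eq, h1, h2]
        by_cases hp : p.1 ∈ E
        · simp only [F, Set.indicator_of_mem hp, Set.indicator_of_mem (hm.mpr hp), h1, h2, h3]
        · simp only [F, Set.indicator_of_notMem hp, Set.indicator_of_notMem (mt hm.mp hp)]
    _ ≤ ∫⁻ _ : Fin n × Fin n → ℂ, 2 ∂gaussPi (Fin n × Fin n) := by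
        rw [lintegral_prod _ hF.aemeasurable]
        refine lintegral_mono fun W => ?_
        by_cases hW : W ∈ E
        · simp only [F, Set.indicator_of_mem hW]
          exact lintegral_norm_G_le hW.1 hW.2 hK hN hKN hn hu
        · simp [F, Set.indicator_of_notMem hW]
    _ = 2 := by simp

theorem setLIntegral_norm_X2_le {K N : ℝ} (hK : 0 ≤ K) (hN : 1 ≤ N)
    (hKN : 32 * K ≤ N ^ 2) (hn : N ^ 6 = n) (hn2 : 2 ≤ n) {u : ℂ}
    (hu : ‖u‖ * (2 * Real.exp 2 * chaosRate K) ≤ N ^ 2) (hu' : ‖u‖ ≤ N ^ 2) :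
    ∫⁻ W in typicalSet K N n, ‖X2 (mat W) u‖ₑ ∂gaussPi (Fin n × Fin n) ≤
      ENNReal.ofReal (Real.exp (7 * K)) * 2 := by
  have hmG : Measurable fun W : Fin n × Fin n → ℂ =>
      ‖G (scaledMatrix u (rowMean W) (colDev W) (dblCentre W)) u‖ₑ :=
    ((measurable_G_scaledMatrix u).comp (measurable_id.prodMk measurable_id)).enorm
  calc _ ≤ ∫⁻ W in typicalSet K N n, ENNReal.ofReal (Real.exp (7 * K)) *
        ‖G (scaledMatrix u (rowMean W) (colDev W) (dblCentre W)) u‖ₑ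
          ∂gaussPi (Fin n × Fin n) := by
        refine setLIntegral_mono (hmG.const_mul _) fun W hW => ?_
        rw [← ofReal_norm, ← ofReal_norm, ← ENNReal.ofReal_mul (by positivity)]
        exact ENNReal.ofReal_le_ofReal (norm_X2_le hW.1 hW.2.1 hW.2.2 hK hN hn hn2 hu')
    _ = ENNReal.ofReal (Real.exp (7 * K)) * ∫⁻ W in typicalSet K N n,
        ‖G (scaledMatrix u (rowMean W) (colDev W) (dblCentre W)) u‖ₑ
          ∂gaussPi (Fin n × Fin n) := lintegral_const_mul' _ _ ENNReal.ofReal_ne_top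
    _ ≤ _ := by
        gcongr
        refine le_trans (lintegral_mono_set ?_) (setLIntegral_norm_G_le hK hN hKN hn hu)
        exact fun W hW => ⟨hW.1, hW.2.1⟩

end Resampling

/-! ### Uniform control on a disc. -/

section Supremum

variable {n : ℕ}

theorem continuous_G_mat :
    Continuous fun p : (Fin n × Fin n → ℂ) × ℂ => G (mat p.1) p.2 := by
  unfold G Matrix.permanent
  simp only [J, mat, Matrix.add_apply, Matrix.smul_apply, Matrix.of_apply, smul_eq_mul]
  fun_prop

theorem continuous_X2_mat :
    Continuous fun p : (Fin n × Fin n → ℂ) × ℂ => X2 (mat p.1) p.2 := by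
  have hv : Continuous fun W : Fin n × Fin n → ℂ => vec (mat W) :=
    PiLp.continuous_toLp 2 _
  have h1 : Continuous fun W : Fin n × Fin n → ℂ => D1 (mat W) := by
    unfold D1 mat at *
    fun_prop
  have h2 : Continuous fun W : Fin n × Fin n → ℂ => D2 (mat W) := by
    unfold D2 mat at *
    fun_prop
  have h3 := continuous_G_mat (n := n)
  have h1' := h1.comp (continuous_fst (Y := ℂ))
  have h2' := h2.comp (continuous_fst (Y := ℂ))
  simp only [Function.comp_def] at h1' h2'
  unfold X2
  fun_prop

/-- Cauchy's integral formula: since v lies in the half disc, the kernel is at most 2 / R, and the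
total constant is 1 / π ≤ 1. -/
theorem enorm_le_lintegral_circle {f : ℂ → ℂ} (hf : Differentiable ℂ f) {R : ℝ} (hR : 0 < R)
    {v : ℂ} (hv : ‖v‖ ≤ R / 2) :
    ‖f v‖ₑ ≤ ∫⁻ θ in Set.Ioc 0 (2 * Real.pi), ‖f (circleMap 0 R θ)‖ₑ := by
  have hvb : v ∈ Metric.ball (0 : ℂ) R := by
    rw [mem_ball_zero_iff]
    linarith
  have h :=
    Complex.two_pi_I_inv_smul_circleIntegral_sub_inv_smul_of_differentiable_on_off_countable
      Set.countable_empty hvb hf.continuous.continuousOn fun z _ => hf z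
  rw [← h, circleIntegral, intervalIntegral.integral_of_le (by positivity),
    enorm_smul]
  refine (mul_le_mul_right (enorm_integral_le_lintegral_enorm _) _).trans ?_
  rw [← lintegral_const_mul' _ _ enorm_ne_top]
  refine lintegral_mono fun θ => ?_
  simp only [deriv_circleMap, smul_eq_mul, enorm_mul]
  rw [← mul_assoc, ← mul_assoc]
  refine mul_le_of_le_one_left (by positivity) ?_
  rw [← enorm_mul, ← enorm_mul, ← enorm_mul, ← ofReal_norm, ENNReal.ofReal_le_one]
  have h1 : R / 2 ≤ ‖circleMap 0 R θ - v‖ := by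
    have := norm_sub_norm_le (circleMap 0 R θ) v
    rw [norm_circleMap_zero, abs_of_pos hR] at this
    linarith
  simp only [norm_mul, norm_inv, norm_circleMap_zero, abs_of_pos hR, Complex.norm_I,
    Complex.norm_ofNat, Complex.norm_real, Real.norm_of_nonneg Real.pi_pos.le]
  have h2 : ‖circleMap 0 R θ - v‖⁻¹ ≤ (R / 2)⁻¹ := inv_anti₀ (by positivity) h1
  calc _ ≤ (2 * Real.pi * 1)⁻¹ * (R * 1) * (R / 2)⁻¹ := by gcongr
    _ = 1 / Real.pi := by field_simp
    _ ≤ 1 := by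
      rw [div_le_one Real.pi_pos]
      linarith [Real.pi_gt_three]

/-- The supremum over the half disc is at most a circle integral, whose expectation on the typical
event is bounded by Tonelli and the pointwise first moment. Markov's inequality then applies to that
one random variable. -/
theorem measure_sup_X2_le {K N R L : ℝ} (hK : 1 ≤ K) (hN : 1 ≤ N) (hKN : 32 * K ≤ N ^ 2)
    (hn : N ^ 6 = n) (hn2 : 2 ≤ n) (hR : 0 < R)
    (hRN : R * (2 * Real.exp 2 * chaosRate K) ≤ N ^ 2) (hRN' : R ≤ N ^ 2) (hL : 0 < L) :
    gaussPi (Fin n × Fin n) {W | ∃ u : ℂ, ‖u‖ ≤ R / 2 ∧ L + 1 < ‖X2 (mat W) u - 1‖} ≤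
      ENNReal.ofReal (326 / K + 12288 / N ^ 2 + Real.exp (7 * K) * 2 * (2 * Real.pi) / L) := by
  let S : (Fin n × Fin n → ℂ) → ℝ≥0∞ := fun W =>
    ∫⁻ θ in Set.Ioc 0 (2 * Real.pi), ‖X2 (mat W) (circleMap 0 R θ)‖ₑ
  have hjm : Measurable fun p : (Fin n × Fin n → ℂ) × ℝ => ‖X2 (mat p.1) (circleMap 0 R p.2)‖ₑ := by
    have := (continuous_X2_mat (n := n)).comp
      (continuous_fst.prodMk ((continuous_circleMap 0 R).comp continuous_snd))
    exact this.measurable.enorm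
  have hS : Measurable S := hjm.lintegral_prod_right'
  have hint : ∫⁻ W in typicalSet K N n, S W ∂gaussPi (Fin n × Fin n) ≤
      ENNReal.ofReal (Real.exp (7 * K) * 2 * (2 * Real.pi)) := by
    simp only [S]
    rw [lintegral_lintegral_swap hjm.aemeasurable]
    calc _ ≤ ∫⁻ _ in Set.Ioc 0 (2 * Real.pi), ENNReal.ofReal (Real.exp (7 * K)) * 2 := by
          refine lintegral_mono fun θ => ?_
          have hθ : ‖circleMap 0 R θ‖ = R := by rw [norm_circleMap_zero, abs_of_pos hR]
          exact setLIntegral_norm_X2_le (by linarith) hN hKN hn hn2 (by rwa [hθ]) (by rwa [hθ])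
      _ = _ := by
          rw [setLIntegral_const, Real.volume_Ioc, sub_zero, ENNReal.ofReal_mul (by positivity),
            ENNReal.ofReal_mul (by positivity)]
          simp
          rw [ENNReal.ofReal_mul (by positivity)]
          simp
  have hmark : (gaussPi (Fin n × Fin n)).restrict (typicalSet K N n) {W | ENNReal.ofReal L ≤ S W} ≤
      ENNReal.ofReal (Real.exp (7 * K) * 2 * (2 * Real.pi) / L) := by
    have h := (mul_meas_ge_le_lintegral (μ := (gaussPi (Fin n × Fin n)).restrict
      (typicalSet K N n)) hS (ENNReal.ofReal L)).trans hint
    rwa [mul_comm, ← ENNReal.le_div_iff_mul_le (Or.inl (by simpa using hL))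
      (Or.inl ENNReal.ofReal_ne_top), ← ENNReal.ofReal_div_of_pos hL] at h
  rw [Measure.restrict_apply (measurableSet_le measurable_const hS)] at hmark
  have hsub : {W : Fin n × Fin n → ℂ | ∃ u : ℂ, ‖u‖ ≤ R / 2 ∧ L + 1 < ‖X2 (mat W) u - 1‖} ⊆
      (typicalSet K N n)ᶜ ∪ ({W | ENNReal.ofReal L ≤ S W} ∩ typicalSet K N n) := by
    rintro W ⟨u, hu, hW⟩
    by_cases hT : W ∈ typicalSet K N n
    · refine Or.inr ⟨?_, hT⟩
      have h1 := enorm_le_lintegral_circle (differentiable_X2 (mat W)) hR hu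
      refine le_trans ?_ h1
      rw [← ofReal_norm]
      refine ENNReal.ofReal_le_ofReal ?_
      have := norm_sub_le (X2 (mat W) u) 1
      rw [norm_one] at this
      linarith
    · exact Or.inl hT
  refine (measure_mono hsub).trans ((measure_union_le _ _).trans ((add_le_add
    (measure_compl_typicalSet_le hn hK (by linarith)) hmark).trans_eq ?_))
  rw [← ENNReal.ofReal_add (by positivity) (by positivity)]

/-- The reweighted permanent is bounded, in probability, on a disc of radius of order
`n ^ (1 / 3)`. -/
theorem exists_sup_X2_bound (ε : ℝ) (hε : 0 < ε) : ∃ c K : ℝ, 0 < c ∧ 0 < K ∧ ∀ᶠ n : ℕ in atTop,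
    gaussPi (Fin n × Fin n) {W | ∃ u : ℂ, ‖u‖ ≤ c * (n : ℝ) ^ (1 / 3 : ℝ) ∧
      K < ‖X2 (mat W) u - 1‖} ≤ ENNReal.ofReal ε := by
  -- Each of the three error terms is made at most ε / 3, and 978 = 3 · 326. Below, `c` is taken to
  -- meet both constraints on the radius.
  let K : ℝ := max 1 (978 / ε)
  have hK : 1 ≤ K := le_max_left _ _
  have hK0 : 0 < K := by linarith
  let q : ℝ := 2 * Real.exp 2 * chaosRate K
  have hq : 0 < q := by
    have := chaosRate_pos K
    positivity
  let c : ℝ := min 1 q⁻¹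
  have hc : 0 < c := lt_min one_pos (by positivity)
  let L : ℝ := 3 * (Real.exp (7 * K) * 2 * (2 * Real.pi)) / ε
  have hL : 0 < L := by positivity
  refine ⟨c / 2, L + 1, by positivity, by positivity, ?_⟩
  have htend : Tendsto (fun n : ℕ => (n : ℝ) ^ (1 / 3 : ℝ)) atTop atTop :=
    (tendsto_rpow_atTop (by norm_num)).comp tendsto_natCast_atTop_atTop
  filter_upwards [htend.eventually_ge_atTop (32 * K), htend.eventually_ge_atTop (3 * 12288 / ε),
    eventually_ge_atTop 2] with n h1 h2 hn2
  have hn1 : (1 : ℝ) ≤ n := by exact_mod_cast (by omega : 1 ≤ n)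
  let N : ℝ := (n : ℝ) ^ (1 / 6 : ℝ)
  have hN : 1 ≤ N := Real.one_le_rpow hn1 (by norm_num)
  have hN6 : N ^ 6 = n := by
    rw [← Real.rpow_natCast, ← Real.rpow_mul (by positivity)]
    norm_num
  have hN2 : N ^ 2 = (n : ℝ) ^ (1 / 3 : ℝ) := by
    rw [← Real.rpow_natCast, ← Real.rpow_mul (by positivity)]
    norm_num
  rw [← hN2] at h1 h2 ⊢
  have hR : 0 < c * N ^ 2 := by positivity
  have h := measure_sup_X2_le (R := c * N ^ 2) (L := L) hK hN h1 hN6 hn2 hR ?_ ?_ hL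
  · rw [div_mul_eq_mul_div]
    refine h.trans (ENNReal.ofReal_le_ofReal ?_)
    have e1 : 326 / K ≤ ε / 3 := by
      have : 978 / ε ≤ K := le_max_right _ _
      rw [div_le_iff₀ hε] at this
      rw [div_le_div_iff₀ hK0 (by norm_num)]
      linarith
    have e2 : 12288 / N ^ 2 ≤ ε / 3 := by
      rw [div_le_iff₀ hε] at h2
      rw [div_le_div_iff₀ (by positivity) (by norm_num)]
      linarith
    have e3 : Real.exp (7 * K) * 2 * (2 * Real.pi) / L = ε / 3 := by
      simp only [L]
      field_simp
    linarith
  · have : c * q ≤ 1 := by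
      calc c * q ≤ q⁻¹ * q := by
            gcongr
            exact min_le_right _ _
        _ = 1 := inv_mul_cancel₀ hq.ne'
    calc c * N ^ 2 * q = c * q * N ^ 2 := by ring
      _ ≤ 1 * N ^ 2 := by gcongr
      _ = N ^ 2 := one_mul _
  · exact mul_le_of_le_one_left (by positivity) (min_le_left _ _)

end Supremum

end RandomPermanent

/-! ### Scaling to variance ν and the exact law of the linear term. -/

namespace RandomPermanent

section Scaling

variable {n : ℕ}

theorem complexGaussian_map_mul {ν ν' : ℝ≥0} {c : ℝ} (h : (ν' : ℝ) = c ^ 2 * ν) :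
    (complexGaussian ν).map (fun z : ℂ => (c : ℂ) * z) = complexGaussian ν' := by
  let T : ℂ →L[ℝ] ℂ := c • ContinuousLinearMap.id ℝ ℂ
  have hT : (fun z : ℂ => (c : ℂ) * z) = T := by
    ext z
    simp [T]
  rw [hT]
  have : IsProbabilityMeasure ((complexGaussian ν).map T) :=
    Measure.isProbabilityMeasure_map T.continuous.measurable.aemeasurable
  refine Measure.ext_of_charFunDual ?_
  ext L
  rw [charFunDual_map, charFunDual_complexGaussian, charFunDual_complexGaussian, h]
  congr 3
  simp [T]
  ring

theorem G_smul (W : Matrix (Fin n) (Fin n) ℂ) (c u : ℂ) : G (c • W) u = G W (c * u) := by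
  rw [G, G, smul_smul, mul_comm u c]

theorem vec_smul (W : Matrix (Fin n) (Fin n) ℂ) (c : ℂ) : vec (c • W) = c • vec W := rfl

theorem D1_smul (W : Matrix (Fin n) (Fin n) ℂ) (c : ℂ) : D1 (c • W) = c * D1 W := by
  rw [D1, D1, vec_smul, Finset.mul_sum]
  refine Finset.sum_congr rfl fun e _ => ?_
  simp
  ring

theorem D2_smul (W : Matrix (Fin n) (Fin n) ℂ) (c : ℂ) : D2 (c • W) = c ^ 2 * D2 W := by
  rw [D2, D2, vec_smul, Finset.mul_sum, map_smul]
  refine Finset.sum_congr rfl fun e _ => ?_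
  simp
  ring

theorem X2_smul (W : Matrix (Fin n) (Fin n) ℂ) (c u : ℂ) : X2 (c • W) u = X2 W (c * u) := by
  rw [X2, X2, D1_smul, D2_smul, G_smul]
  congr 2
  ring

variable {Ω : Type*} [MeasurableSpace Ω] {P : Measure Ω} [IsProbabilityMeasure P] {ν : ℝ≥0}
  {W : Ω → Matrix (Fin n) (Fin n) ℂ}

/-- The standardised entries of a Gaussian matrix. -/
noncomputable def stdEntries (ν : ℝ≥0) (W : Matrix (Fin n) (Fin n) ℂ) (e : Fin n × Fin n) : ℂ :=
  (((√ν)⁻¹ : ℝ) : ℂ) * W e.1 e.2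

theorem smul_mat_stdEntries (hν : 0 < ν) (W : Matrix (Fin n) (Fin n) ℂ) :
    ((√ν : ℝ) : ℂ) • mat (stdEntries ν W) = W := by
  have h : ((√ν : ℝ) : ℂ) ≠ 0 := by
    exact_mod_cast (Real.sqrt_pos.mpr (by exact_mod_cast hν)).ne'
  ext i j
  simp [mat, stdEntries, h]

theorem IsGaussianMatrix.hasLaw_stdEntries (h : IsGaussianMatrix P ν W) (hν : 0 < ν) :
    HasLaw (fun ω => stdEntries ν (W ω)) (gaussPi (Fin n × Fin n)) P := by
  have hs : (0 : ℝ) < ν := by exact_mod_cast hν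
  have hm : ∀ e : Fin n × Fin n, AEMeasurable (fun ω => stdEntries ν (W ω) e) P := fun e =>
    (h.law e.1 e.2).aemeasurable.const_mul _
  have hlaw : ∀ e : Fin n × Fin n,
      P.map (fun ω => stdEntries ν (W ω) e) = complexGaussian 1 := by
    intro e
    have h1 := complexGaussian_map_mul (ν := ν) (ν' := 1) (c := (√ν)⁻¹) (by
      rw [inv_pow, Real.sq_sqrt hs.le, inv_mul_cancel₀ hs.ne', NNReal.coe_one])
    rw [← (h.law e.1 e.2).map_eq, AEMeasurable.map_map_of_aemeasurable (by fun_prop)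
      (h.law e.1 e.2).aemeasurable] at h1
    exact h1
  have hind : iIndepFun (fun (e : Fin n × Fin n) ω => stdEntries ν (W ω) e) P :=
    h.indep.comp (fun _ z => (((√ν)⁻¹ : ℝ) : ℂ) * z) fun _ => by fun_prop
  refine ⟨aemeasurable_pi_lambda _ hm, ?_⟩
  have := (iIndepFun_iff_map_fun_eq_pi_map hm).mp hind
  simp only [hlaw] at this
  exact this

/-- The inequality holds for every set, so measurability of bad events defined by a quantifier over
u need not be checked. -/
theorem IsGaussianMatrix.measure_le (h : IsGaussianMatrix P ν W) (hν : 0 < ν)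
    (s : Set (Fin n × Fin n → ℂ)) :
    P {ω | stdEntries ν (W ω) ∈ s} ≤ gaussPi (Fin n × Fin n) s := by
  have h1 := h.hasLaw_stdEntries hν
  rw [← h1.map_eq]
  exact Measure.le_map_apply h1.aemeasurable s

/-- The linear coefficient is exactly Gaussian. -/
theorem IsGaussianMatrix.map_D1 (h : IsGaussianMatrix P ν W) (hν : 0 < ν) (hn : n ≠ 0) :
    P.map (fun ω => D1 (W ω)) = complexGaussian ν := by
  have hs : (0 : ℝ) < ν := by exact_mod_cast hν
  have h0 : (n : ℂ) ≠ 0 := by exact_mod_cast hn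
  -- A single row of n² entries 1/n has norm one, hence is a coisometry onto a one-dimensional
  -- space.
  let A : Matrix Unit (Fin n × Fin n) ℂ := Matrix.of fun _ _ => (n : ℂ)⁻¹
  have hA : A * A.conjTranspose = 1 := by
    ext i j
    simp [A, Matrix.mul_apply]
    field_simp
  have h1 := (measurePreserving_gaussPi_unit.map_eq : _)
  rw [← gaussPi_map_mulVec A hA, ← (h.hasLaw_stdEntries hν).map_eq] at h1
  have hl := (h.hasLaw_stdEntries hν).aemeasurable
  rw [AEMeasurable.map_map_of_aemeasurable (by fun_prop) hl,
    AEMeasurable.map_map_of_aemeasurable (by fun_prop)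
      (Measurable.comp_aemeasurable (by fun_prop) hl)] at h1
  have h2 := complexGaussian_map_mul (ν := 1) (ν' := ν) (c := √ν) (by
    rw [Real.sq_sqrt hs.le, NNReal.coe_one, mul_one])
  rw [← h1, AEMeasurable.map_map_of_aemeasurable (by fun_prop)
    (Measurable.comp_aemeasurable (by fun_prop) (Measurable.comp_aemeasurable (by fun_prop) hl))]
    at h2
  rw [← h2]
  congr 1
  ext ω
  conv_lhs => rw [← smul_mat_stdEntries hν (W ω), D1_smul]
  simp [A, D1, vec, mat, Matrix.mulVec, dotProduct, MeasurableEquiv.funUnique]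

end Scaling

/-! ### The continued logarithm. -/

section Logarithm

variable {n : ℕ}

/-- The remainder in the expansion of the logarithm is the logarithm of the reweighted
permanent. -/
theorem logPer_sub_eq_log_X2 (W : Matrix (Fin n) (Fin n) ℂ) (z : ℂ)
    (h : ∀ u : ℂ, ‖u‖ ≤ ‖z‖ → ‖X2 W u - 1‖ ≤ 1 / 2) :
    logPer W z - ((Real.log n.factorial : ℂ) + z * D1 W + z ^ 2 / 2 * D2 W) =
      Complex.log (X2 W z) := by
  have hu : ∀ t ∈ Set.uIcc (0 : ℝ) 1, ‖X2 W (t * z) - 1‖ ≤ 1 / 2 := by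
    intro t ht
    rw [Set.uIcc_of_le zero_le_one] at ht
    refine h _ ?_
    rw [norm_mul, Complex.norm_real, Real.norm_of_nonneg ht.1]
    exact mul_le_of_le_one_left (norm_nonneg _) ht.2
  have hslit : ∀ t ∈ Set.uIcc (0 : ℝ) 1, X2 W (t * z) ∈ Complex.slitPlane := by
    intro t ht
    have := Complex.mem_slitPlane_of_norm_lt_one ((hu t ht).trans_lt (by norm_num))
    simpa using this
  have hG : ∀ t ∈ Set.uIcc (0 : ℝ) 1, G W (t * z) ≠ 0 := by
    intro t ht h0
    have := Complex.slitPlane_ne_zero (hslit t ht)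
    rw [X2, h0, mul_zero] at this
    exact this rfl
  let E : ℂ → ℂ := fun u => -(u * D1 W) - u ^ 2 / 2 * D2 W
  have hE : ∀ u, HasDerivAt E (-(D1 W) - u * D2 W) u := by
    intro u
    have h1 := ((hasDerivAt_id u).mul_const (D1 W)).neg.sub
      ((((hasDerivAt_id u).pow 2).div_const 2).mul_const (D2 W))
    refine h1.congr_deriv ?_
    simp
  -- As `X2` stays within 1/2 of 1 along the segment, its principal logarithm is smooth there, and Φ
  -- is an antiderivative of the logarithmic derivative of `G`.
  let Φ : ℝ → ℂ := fun t => Complex.log (X2 W (t * z)) - E (t * z)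
  have hΦ : ∀ t ∈ Set.uIcc (0 : ℝ) 1,
      HasDerivAt Φ (z * deriv (G W) ((t : ℂ) * z) / G W ((t : ℂ) * z)) t := by
    intro t ht
    have h2 : HasDerivAt (fun s : ℝ => (s : ℂ) * z) z t := by
      simpa using (Complex.ofRealCLM.hasDerivAt (x := t)).mul_const z
    have hX : HasDerivAt (X2 W) (Complex.exp (E (t * z)) * (-(D1 W) - t * z * D2 W) * G W (t * z) +
        Complex.exp (E (t * z)) * deriv (G W) (t * z)) (t * z) :=
      (hE _).cexp.mul ((differentiable_G W) _).hasDerivAt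
    have hX' := hX.comp t h2
    have h3 := HasDerivAt.clog_real (f := fun s : ℝ => X2 W (s * z)) (x := t) hX' (hslit t ht)
    have h4 := (hE (t * z)).comp t h2
    refine (h3.sub h4).congr_deriv ?_
    have := hG t ht
    have hex := Complex.exp_ne_zero (E (t * z))
    have hXe : X2 W (t * z) = Complex.exp (E (t * z)) * G W (t * z) := rfl
    rw [hXe]
    field_simp
    ring
  have hint : IntervalIntegrable (fun t : ℝ => z * deriv (G W) ((t : ℂ) * z) / G W ((t : ℂ) * z))
      volume 0 1 := by
    refine ContinuousOn.intervalIntegrable (ContinuousOn.div ?_ ?_ hG)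
    · have hcd : Continuous (deriv (G W)) :=
        ((differentiable_G W).contDiff (n := 1)).continuous_deriv le_rfl
      exact (by fun_prop : Continuous fun t : ℝ => z * deriv (G W) ((t : ℂ) * z)).continuousOn
    · have := (differentiable_G W).continuous
      exact (by fun_prop : Continuous fun t : ℝ => G W ((t : ℂ) * z)).continuousOn
  rw [logPer, intervalIntegral.integral_eq_sub_of_hasDerivAt hΦ hint]
  simp [Φ, E, X2_zero]
  ring

theorem norm_logPer_sub_le (W : Matrix (Fin n) (Fin n) ℂ) (z : ℂ)
    (h : ∀ u : ℂ, ‖u‖ ≤ ‖z‖ → ‖X2 W u - 1‖ ≤ 1 / 2) :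
    ‖logPer W z - ((Real.log n.factorial : ℂ) + z * D1 W + z ^ 2 / 2 * D2 W)‖ ≤
      3 / 2 * ‖X2 W z - 1‖ := by
  rw [logPer_sub_eq_log_X2 W z h]
  have := Complex.norm_log_one_add_half_le_self (h z le_rfl)
  simpa using this

theorem permanent_ne_zero_of_X2 {W : Matrix (Fin n) (Fin n) ℂ} {u : ℂ}
    (h : ‖X2 W u - 1‖ ≤ 1 / 2) : (J n + u • W).permanent ≠ 0 := by
  intro h0
  rw [X2, G, h0] at h
  norm_num at h

theorem measurable_integral_logDeriv {X : Type*} [TopologicalSpace X]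
    [SecondCountableTopologyEither X ℂ] [MeasurableSpace X] [OpensMeasurableSpace X]
    {f : X → ℂ → ℂ} (hf : Continuous f.uncurry) (z : ℂ) :
    Measurable fun x => ∫ t in (0 : ℝ)..1, z * deriv (f x) ((t : ℂ) * z) / f x ((t : ℂ) * z) := by
  have hφ : Measurable fun p : X × ℝ => (p.1, (p.2 : ℂ) * z) := by fun_prop
  have hm : Measurable fun p : X × ℝ =>
      z * deriv (f p.1) ((p.2 : ℂ) * z) / f p.1 ((p.2 : ℂ) * z) :=
    (((measurable_deriv_with_param hf).comp hφ).const_mul z).div (hf.measurable.comp hφ)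
  simp only [intervalIntegral.integral_of_le zero_le_one]
  exact (hm.stronglyMeasurable.integral_prod_right').measurable

theorem measurable_logPer_mat (z : ℂ) :
    Measurable fun W : Fin n × Fin n → ℂ => logPer (mat W) z :=
  (measurable_integral_logDeriv (f := fun W : Fin n × Fin n → ℂ => G (mat W))
    continuous_G_mat z).const_add _

end Logarithm

end RandomPermanent

/-! ### Rates in probability. -/

namespace RandomPermanent

section Rates

/-- The event on which the reweighted permanent is not cubically close to `1`. -/
def cubicBadSet (c C : ℝ) (n : ℕ) : Set (Fin n × Fin n → ℂ) :=
  {W | ∃ u : ℂ, ‖u‖ < c * (n : ℝ) ^ (1 / 3 : ℝ) ∧ C * (‖u‖ ^ 3 / n) < ‖X2 (mat W) u - 1‖}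

theorem rpow_third_pow_three (n : ℕ) : ((n : ℝ) ^ (1 / 3 : ℝ)) ^ 3 = n := by
  rw [← Real.rpow_natCast, ← Real.rpow_mul (by positivity)]
  norm_num

/-- The bound K on the disc of radius R = c n^(1/3) becomes K (‖u‖ / R)³ by Schwarz's lemma, and R³
= c³ n. -/
theorem exists_measure_cubicBadSet_le (ε : ℝ) (hε : 0 < ε) : ∃ c C : ℝ, 0 < c ∧ 0 < C ∧
    ∀ᶠ n : ℕ in atTop, gaussPi (Fin n × Fin n) (cubicBadSet c C n) ≤ ENNReal.ofReal ε := by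
  obtain ⟨c, K, hc, hK, h⟩ := exists_sup_X2_bound ε hε
  refine ⟨c, K / c ^ 3, hc, by positivity, ?_⟩
  filter_upwards [h, eventually_ge_atTop 2] with n hn hn2
  refine (measure_mono ?_).trans hn
  rintro W ⟨u, hu, hW⟩
  by_contra hcon
  have hb : ∀ v : ℂ, ‖v‖ ≤ c * (n : ℝ) ^ (1 / 3 : ℝ) → ‖X2 (mat W) v - 1‖ ≤ K := by
    intro v hv
    by_contra hv'
    exact hcon ⟨v, hv, not_le.mp hv'⟩
  have h1 := norm_X2_sub_one_le_of_bound hn2 (mat W) hb hu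
  rw [div_pow, mul_pow, rpow_third_pow_three] at h1
  have h0 : (n : ℝ) ≠ 0 := by exact_mod_cast (by omega : n ≠ 0)
  have e : K / c ^ 3 * (‖u‖ ^ 3 / n) = K * (‖u‖ ^ 3 / (c ^ 3 * n)) := by field_simp
  linarith

/-- D₂ has order n^(-1/2) = N ^ (-3) for variance one; this makes z D₂ / 2 negligible in part (b).
-/
theorem norm_D2_mat_le {n : ℕ} {K N : ℝ} {W : Fin n × Fin n → ℂ} (hW : W ∈ typicalSet K N n)
    (hK : 0 ≤ K) (hN : 1 ≤ N) (hn : N ^ 6 = n) (hn2 : 2 ≤ n) :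
    ‖D2 (mat W)‖ ≤ 8 * K / N ^ 3 := by
  obtain ⟨hx, hy, hS⟩ := hW
  have hn0 : n ≠ 0 := by omega
  have hnR : (2 : ℝ) ≤ n := by exact_mod_cast hn2
  have h1 := norm_sum_dblCentre_sq_le hx hy hS hK hN hn0
  have h2 : ‖(n : ℂ) - 1‖ = (n : ℝ) - 1 := by
    rw [← Complex.ofReal_natCast, ← Complex.ofReal_one, ← Complex.ofReal_sub, Complex.norm_real,
      Real.norm_of_nonneg (by linarith)]
  have h3 : 0 < (n : ℝ) - 1 := by linarith
  have h4 : ‖1 / ((n : ℂ) * ((n : ℂ) - 1)) * ∑ i, ∑ j, dblCentre W i j ^ 2‖ ≤ 6 * K / N ^ 3 := by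
    rw [norm_mul, norm_div, norm_mul, h2, Complex.norm_natCast, norm_one]
    calc _ ≤ 1 / (n * ((n : ℝ) - 1)) * (3 * K * n) := by gcongr
      _ = 3 * K / ((n : ℝ) - 1) := by field_simp
      _ ≤ 3 * K / (n / 2) := by
        gcongr
        linarith
      _ = 6 * K / N ^ 6 := by
        rw [hn]
        field_simp
        ring
      _ ≤ 6 * K / N ^ 3 := by
        gcongr
        norm_num
  have h5 := hx.norm_sum_sq_le
  have h6 := hy.norm_sum_sq_le
  rw [D2_mat hn0]
  refine (norm_add_le _ _).trans ?_
  have h7 := norm_sub_le (-∑ i, rowMean W i ^ 2) (∑ j, colDev W j ^ 2)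
  rw [norm_neg] at h7
  have e : 8 * K / N ^ 3 = K / N ^ 3 + K / N ^ 3 + 6 * K / N ^ 3 := by ring
  linarith

theorem exists_measure_compl_typicalSet_le (ε : ℝ) (hε : 0 < ε) : ∃ K : ℝ, 1 ≤ K ∧
    ∀ᶠ n : ℕ in atTop, gaussPi (Fin n × Fin n) (typicalSet K ((n : ℝ) ^ (1 / 6 : ℝ)) n)ᶜ ≤
      ENNReal.ofReal ε := by
  have hK : 1 ≤ max 1 (652 / ε) := le_max_left _ _
  refine ⟨max 1 (652 / ε), hK, ?_⟩
  have htend : Tendsto (fun n : ℕ => ((n : ℝ) ^ (1 / 6 : ℝ)) ^ 2) atTop atTop :=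
    (tendsto_pow_atTop two_ne_zero).comp
      ((tendsto_rpow_atTop (by norm_num)).comp tendsto_natCast_atTop_atTop)
  filter_upwards [htend.eventually_ge_atTop (2 * 12288 / ε), eventually_ge_atTop 1] with n h1 hn
  have hn1 : (1 : ℝ) ≤ n := by exact_mod_cast hn
  have hN6 : ((n : ℝ) ^ (1 / 6 : ℝ)) ^ 6 = n := by
    rw [← Real.rpow_natCast, ← Real.rpow_mul (by positivity)]
    norm_num
  have hN : 0 < (n : ℝ) ^ (1 / 6 : ℝ) := by positivity
  refine (measure_compl_typicalSet_le hN6 hK hN).trans (ENNReal.ofReal_le_ofReal ?_)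
  have e1 : 326 / max 1 (652 / ε) ≤ ε / 2 := by
    have : 652 / ε ≤ max 1 (652 / ε) := le_max_right _ _
    rw [div_le_iff₀ hε] at this
    rw [div_le_div_iff₀ (by linarith) (by norm_num)]
    linarith
  have e2 : 12288 / ((n : ℝ) ^ (1 / 6 : ℝ)) ^ 2 ≤ ε / 2 := by
    rw [div_le_iff₀ hε] at h1
    rw [div_le_div_iff₀ (by positivity) (by norm_num)]
    linarith
  linarith

theorem tendsto_measure_zero {X : Type*} [MeasurableSpace X] {μ : Measure X} {s : ℕ → Set X}
    (h : ∀ ε : ℝ, 0 < ε → ∀ᶠ n in atTop, μ (s n) ≤ ENNReal.ofReal ε) :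
    Tendsto (fun n => μ (s n)) atTop (𝓝 0) := by
  rw [ENNReal.tendsto_nhds_zero]
  intro ε hε
  obtain ⟨r, hr, hrε⟩ := ENNReal.lt_iff_exists_nnreal_btwn.mp hε
  filter_upwards [h r (by exact_mod_cast hr)] with n hn
  refine hn.trans ?_
  rw [ENNReal.ofReal_coe_nnreal]
  exact hrε.le

theorem mat_entries {n : ℕ} (V : Matrix (Fin n) (Fin n) ℂ) :
    (mat fun e : Fin n × Fin n => V e.1 e.2) = V := rfl

theorem IsGaussianMatrix.aemeasurable_entries {Ω : Type*} [MeasurableSpace Ω] {P : Measure Ω}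
    {ν : ℝ≥0} {n : ℕ} {V : Ω → Matrix (Fin n) (Fin n) ℂ}
    (h : IsGaussianMatrix P ν V) : AEMeasurable (fun ω (e : Fin n × Fin n) => V ω e.1 e.2) P :=
  aemeasurable_pi_lambda _ fun e => (h.law e.1 e.2).aemeasurable

theorem IsGaussianMatrix.aemeasurable_logPer {Ω : Type*} [MeasurableSpace Ω] {P : Measure Ω}
    {ν : ℝ≥0} {n : ℕ} {V : Ω → Matrix (Fin n) (Fin n) ℂ}
    (h : IsGaussianMatrix P ν V) (u : ℂ) : AEMeasurable (fun ω => logPer (V ω) u) P := by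
  simpa only [Function.comp_def, mat_entries] using
    (measurable_logPer_mat u).comp_aemeasurable h.aemeasurable_entries

theorem IsGaussianMatrix.aemeasurable_D1 {Ω : Type*} [MeasurableSpace Ω] {P : Measure Ω}
    {ν : ℝ≥0} {n : ℕ} {V : Ω → Matrix (Fin n) (Fin n) ℂ}
    (h : IsGaussianMatrix P ν V) : AEMeasurable (fun ω => D1 (V ω)) P := by
  have hm : Measurable fun w : Fin n × Fin n → ℂ => D1 (mat w) := by
    simp only [D1_mat, rowMean]
    fun_prop
  simpa only [Function.comp_def, mat_entries] using
    hm.comp_aemeasurable h.aemeasurable_entries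

variable {Ω : Type*} [MeasurableSpace Ω] {P : Measure Ω} [IsProbabilityMeasure P] {ν : ℝ≥0}
  {W : (n : ℕ) → Ω → Matrix (Fin n) (Fin n) ℂ} {z : ℕ → ℂ}

/-- Since `X2` of the matrix at u equals `X2` of its standardisation at √ν u, the standard bound
transfers. The hypothesis `hz` eventually brings √ν ‖z n‖ below c n^(1/3). -/
theorem eventually_measure_cubic_le (hν : 0 < ν) (hW : ∀ n, IsGaussianMatrix P ν (W n))
    (hz : Tendsto (fun n : ℕ => (√ν * ‖z n‖) ^ 3 / n) atTop (𝓝 0)) {c C ε : ℝ} (hc : 0 < c)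
    (hC : 0 < C)
    (h : ∀ᶠ n : ℕ in atTop, gaussPi (Fin n × Fin n) (cubicBadSet c C n) ≤ ENNReal.ofReal ε) :
    ∀ᶠ n : ℕ in atTop, P {ω | ¬ ∀ u : ℂ, ‖u‖ ≤ ‖z n‖ →
      ‖X2 (W n ω) u - 1‖ ≤ C * ((√ν * ‖z n‖) ^ 3 / n)} ≤ ENNReal.ofReal ε := by
  filter_upwards [h, hz.eventually_lt_const (show 0 < c ^ 3 by positivity),
    eventually_ge_atTop 1] with n h1 h2 hn
  have hn0 : (0 : ℝ) < n := by exact_mod_cast hn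
  refine (measure_mono fun ω hω => ?_).trans (((hW n).measure_le hν (cubicBadSet c C n)).trans h1)
  have hω' : ¬ ∀ u : ℂ, ‖u‖ ≤ ‖z n‖ → ‖X2 (W n ω) u - 1‖ ≤ C * ((√ν * ‖z n‖) ^ 3 / n) := hω
  push Not at hω'
  obtain ⟨u, hu, hX⟩ := hω'
  have e : ‖((√ν : ℝ) : ℂ) * u‖ = √ν * ‖u‖ := by
    rw [norm_mul, Complex.norm_real, Real.norm_of_nonneg (Real.sqrt_nonneg _)]
  have hle : √ν * ‖u‖ ≤ √ν * ‖z n‖ := by gcongr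
  refine ⟨((√ν : ℝ) : ℂ) * u, ?_, ?_⟩
  · rw [e]
    refine hle.trans_lt ?_
    rw [div_lt_iff₀ hn0, ← rpow_third_pow_three, ← mul_pow] at h2
    exact lt_of_pow_lt_pow_left₀ 3 (by positivity) h2
  · rw [← X2_smul, smul_mat_stdEntries hν, e]
    refine lt_of_le_of_lt ?_ hX
    gcongr

theorem tendstoInMeasure_X2 (hν : 0 < ν) (hW : ∀ n, IsGaussianMatrix P ν (W n))
    (hz : Tendsto (fun n : ℕ => (√ν * ‖z n‖) ^ 3 / n) atTop (𝓝 0)) :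
    TendstoInMeasure P (fun n ω => X2 (W n ω) (z n)) atTop (fun _ => (1 : ℂ)) := by
  rw [tendstoInMeasure_iff_dist]
  intro η hη
  refine tendsto_measure_zero fun ε hε => ?_
  obtain ⟨c, C, hc, hC, h⟩ := exists_measure_cubicBadSet_le ε hε
  have hCz := hz.const_mul C
  rw [mul_zero] at hCz
  filter_upwards [eventually_measure_cubic_le hν hW hz hc hC h, hCz.eventually_lt_const hη]
    with n h1 h2
  refine (measure_mono fun ω hω hcon => ?_).trans h1
  have h3 := hcon (z n) le_rfl
  rw [Set.mem_ofPred_eq, dist_eq_norm] at hω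
  linarith

theorem tendsto_measure_permanent_eq_zero (hν : 0 < ν) (hW : ∀ n, IsGaussianMatrix P ν (W n))
    (hz : Tendsto (fun n : ℕ => (√ν * ‖z n‖) ^ 3 / n) atTop (𝓝 0)) :
    Tendsto (fun n => P {ω | ∃ u : ℂ, ‖u‖ ≤ ‖z n‖ ∧ (J n + u • W n ω).permanent = 0})
      atTop (𝓝 0) := by
  refine tendsto_measure_zero fun ε hε => ?_
  obtain ⟨c, C, hc, hC, h⟩ := exists_measure_cubicBadSet_le ε hε
  have hCz := hz.const_mul C
  rw [mul_zero] at hCz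
  filter_upwards [eventually_measure_cubic_le hν hW hz hc hC h,
    hCz.eventually_le_const one_half_pos] with n h1 h2
  refine (measure_mono ?_).trans h1
  rintro ω ⟨u, hu, h0⟩ hcon
  exact permanent_ne_zero_of_X2 ((hcon u hu).trans h2) h0

theorem eventually_measure_remainder_le (hν : 0 < ν) (hW : ∀ n, IsGaussianMatrix P ν (W n))
    (hz : Tendsto (fun n : ℕ => (√ν * ‖z n‖) ^ 3 / n) atTop (𝓝 0)) {c C ε : ℝ} (hc : 0 < c)
    (hC : 0 < C)
    (h : ∀ᶠ n : ℕ in atTop, gaussPi (Fin n × Fin n) (cubicBadSet c C n) ≤ ENNReal.ofReal ε) :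
    ∀ᶠ n : ℕ in atTop, P {ω | 3 / 2 * C * ((√ν * ‖z n‖) ^ 3 / n) <
      ‖logPer (W n ω) (z n) - ((Real.log n.factorial : ℂ) + z n * D1 (W n ω)
        + z n ^ 2 / 2 * D2 (W n ω))‖} ≤ ENNReal.ofReal ε := by
  have hCz := hz.const_mul C
  rw [mul_zero] at hCz
  filter_upwards [eventually_measure_cubic_le hν hW hz hc hC h,
    hCz.eventually_le_const one_half_pos] with n h1 h2
  refine (measure_mono fun ω hω hcon => ?_).trans h1
  have h3 := norm_logPer_sub_le (W n ω) (z n) fun u hu => (hcon u hu).trans h2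
  have h4 := hcon (z n) le_rfl
  rw [Set.mem_ofPred_eq] at hω
  linarith

theorem tendstoInDistribution_D1 (hν : 0 < ν) (hW : ∀ n, IsGaussianMatrix P ν (W n)) :
    TendstoInDistribution (fun n ω => D1 (W n ω)) atTop (id : ℂ → ℂ) (fun _ => P)
      (complexGaussian ν) where
  forall_aemeasurable n := (hW n).aemeasurable_D1
  aemeasurable_limit := aemeasurable_id
  tendsto := by
    refine tendsto_const_nhds.congr' ?_
    filter_upwards [eventually_ne_atTop 0] with n hn
    refine Subtype.ext ?_
    simp only [Measure.map_id]
    exact ((hW n).map_D1 hν hn).symm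

/-- The difference is z D₂ / 2 plus the remainder over z, of orders ‖z‖ n^(-1/2) and ‖z‖² / n; both
vanish for ‖z‖ = o(n^(1/3)). -/
theorem tendstoInMeasure_logPer_sub_D1 (hν : 0 < ν) (hW : ∀ n, IsGaussianMatrix P ν (W n))
    (hq : Tendsto (fun n : ℕ => ‖z n‖ / (n : ℝ) ^ (1 / 3 : ℝ)) atTop (𝓝 0))
    (hz0 : ∀ᶠ n in atTop, z n ≠ 0) :
    TendstoInMeasure P ((fun n ω => (logPer (W n ω) (z n) - (Real.log n.factorial : ℂ)) / z n) -
      fun n ω => D1 (W n ω)) atTop 0 := by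
  have hz : Tendsto (fun n : ℕ => (√ν * ‖z n‖) ^ 3 / n) atTop (𝓝 0) := by
    have h1 := ((hq.const_mul √ν).pow 3)
    rw [mul_zero, zero_pow three_ne_zero] at h1
    refine h1.congr fun n => ?_
    rw [← mul_div_assoc, div_pow, rpow_third_pow_three]
  rw [tendstoInMeasure_iff_dist]
  intro η hη
  refine tendsto_measure_zero fun ε hε => ?_
  obtain ⟨c, C, hc, hC, h⟩ := exists_measure_cubicBadSet_le (ε / 2) (half_pos hε)
  obtain ⟨K, hK, hT⟩ := exists_measure_compl_typicalSet_le (ε / 2) (half_pos hε)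
  have hlim : Tendsto (fun n : ℕ => 4 * K * ν * (‖z n‖ / (n : ℝ) ^ (1 / 3 : ℝ)) +
      3 / 2 * C * √ν ^ 3 * (‖z n‖ / (n : ℝ) ^ (1 / 3 : ℝ)) ^ 2) atTop (𝓝 0) := by
    have := (hq.const_mul (4 * K * ν)).add ((hq.pow 2).const_mul (3 / 2 * C * √ν ^ 3))
    simpa using this
  filter_upwards [eventually_measure_remainder_le hν hW hz hc hC h, hT, hz0,
    hlim.eventually_lt_const hη, eventually_ge_atTop 2] with n h1 h2 h3 h4 hn2
  have hn1 : (1 : ℝ) ≤ n := by exact_mod_cast (by omega : 1 ≤ n)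
  have hN : 1 ≤ (n : ℝ) ^ (1 / 6 : ℝ) := Real.one_le_rpow hn1 (by norm_num)
  have hN6 : ((n : ℝ) ^ (1 / 6 : ℝ)) ^ 6 = n := by
    rw [← Real.rpow_natCast, ← Real.rpow_mul (by positivity)]
    norm_num
  have hN2 : (n : ℝ) ^ (1 / 3 : ℝ) = ((n : ℝ) ^ (1 / 6 : ℝ)) ^ 2 := by
    rw [← Real.rpow_natCast, ← Real.rpow_mul (by positivity)]
    norm_num
  rw [hN2] at h4
  set N := (n : ℝ) ^ (1 / 6 : ℝ) with hNdef
  have hN0 : 0 < N := by linarith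
  have hzn : 0 < ‖z n‖ := norm_pos_iff.mpr h3
  have h2' := ((hW n).measure_le hν (typicalSet K N n)ᶜ).trans h2
  refine (measure_mono (t := _ ∪ _) fun ω hω => ?_).trans
    ((measure_union_le _ _).trans ((add_le_add h1 h2').trans_eq ?_))
  · by_contra hcon
    rw [Set.mem_union, not_or] at hcon
    obtain ⟨hr, ht⟩ := hcon
    simp only [Set.mem_ofPred_eq, not_lt, Set.mem_compl_iff, not_not] at hr ht
    have hD2 := norm_D2_mat_le ht (by linarith) hN hN6 hn2
    have hD2' : ‖D2 (W n ω)‖ ≤ ν * (8 * K / N ^ 3) := by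
      conv_lhs => rw [← smul_mat_stdEntries hν (W n ω), D2_smul]
      rw [norm_mul, norm_pow, Complex.norm_real, Real.norm_of_nonneg (Real.sqrt_nonneg _),
        Real.sq_sqrt NNReal.zero_le_coe]
      gcongr
    set rem := logPer (W n ω) (z n) - ((Real.log n.factorial : ℂ) + z n * D1 (W n ω)
        + z n ^ 2 / 2 * D2 (W n ω)) with hrem
    have e : (logPer (W n ω) (z n) - (Real.log n.factorial : ℂ)) / z n - D1 (W n ω) =
        z n / 2 * D2 (W n ω) + rem / z n := by
      rw [hrem]
      field_simp
      ring
    have hω' : η ≤ ‖z n / 2 * D2 (W n ω) + rem / z n‖ := by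
      have : η ≤ dist ((logPer (W n ω) (z n) - (Real.log n.factorial : ℂ)) / z n - D1 (W n ω)) 0 :=
        hω
      rwa [dist_zero_right, e] at this
    have b1 : ‖z n / 2 * D2 (W n ω)‖ ≤ 4 * K * ν * (‖z n‖ / N ^ 2) := by
      rw [norm_mul, norm_div, Complex.norm_ofNat]
      calc _ ≤ ‖z n‖ / 2 * (ν * (8 * K / N ^ 3)) := by gcongr
        _ = 4 * K * ν * (‖z n‖ / N ^ 3) := by ring
        -- The power of N is weakened so that the bound is expressed through ‖z n‖ / n^(1/3), which
        -- is what tends to 0.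
        _ ≤ 4 * K * ν * (‖z n‖ / N ^ 2) := by
          gcongr
          norm_num
    have b2 : ‖rem / z n‖ ≤ 3 / 2 * C * √ν ^ 3 * (‖z n‖ / N ^ 2) ^ 2 := by
      rw [norm_div, div_le_iff₀ hzn]
      refine hr.trans ?_
      rw [← hN6]
      calc _ = 3 / 2 * C * √ν ^ 3 * (‖z n‖ ^ 3 / N ^ 6) := by ring
        _ ≤ 3 / 2 * C * √ν ^ 3 * (‖z n‖ ^ 3 / N ^ 4) := by
          gcongr
          norm_num
        _ = _ := by ring
    linarith [norm_add_le (z n / 2 * D2 (W n ω)) (rem / z n)]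
  · rw [← ENNReal.ofReal_add (by positivity) (by positivity)]
    congr 1
    ring

end Rates

end RandomPermanent

/-! ### Assembly of the theorem. -/

theorem mainTheorem10 :
    ∃ K : ℝ → ℝ, ∀ (ν : ℝ≥0), 0 < ν →
      ∀ {Ω : Type*} [MeasurableSpace Ω] (P : Measure Ω) [IsProbabilityMeasure P]
        (W : (n : ℕ) → Ω → Matrix (Fin n) (Fin n) ℂ),
        (∀ n, IsGaussianMatrix P ν (W n)) →
      ∀ z : ℕ → ℂ,
        (Tendsto (fun n : ℕ => (ν : ℝ) ^ 3 * ‖z n‖ ^ 6 / (n : ℝ) ^ 2) atTop (𝓝 0) →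
          TendstoInMeasure P (fun n ω => X2 (W n ω) (z n)) atTop (fun _ => (1 : ℂ)) ∧
          Tendsto (fun n => P {ω | ∃ u : ℂ, ‖u‖ ≤ ‖z n‖ ∧ (J n + u • W n ω).permanent = 0})
            atTop (𝓝 0) ∧
          ∀ ε : ℝ, 0 < ε → ∀ᶠ n : ℕ in atTop,
            P {ω | K ε * ((ν : ℝ) ^ (3 / 2 : ℝ) * ‖z n‖ ^ 3 / n) <
              ‖logPer (W n ω) (z n) -
                ((Real.log n.factorial : ℂ) + z n * D1 (W n ω)
                  + z n ^ 2 / 2 * D2 (W n ω))‖} ≤ ENNReal.ofReal ε) ∧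
        (z =o[atTop] (fun n : ℕ => (n : ℝ) ^ (1 / 3 : ℝ)) → (∀ᶠ n in atTop, z n ≠ 0) →
          TendstoInDistribution
            (fun n ω => (logPer (W n ω) (z n) - (Real.log n.factorial : ℂ)) / z n) atTop
            (id : ℂ → ℂ) (fun _ => P) (complexGaussian ν)) := by
  -- The constants come from the standard Gaussian law and depend on ε alone, which makes the
  -- implicit constant independent of ν and of the sequence.
  choose! c C hc hC hcC using exists_measure_cubicBadSet_le
  refine ⟨fun ε => 3 / 2 * C ε, fun ν hν Ω _ P _ W hW z => ⟨fun hz => ?_, fun hz hz0 => ?_⟩⟩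
  -- The hypothesis of (a) is the square of this quantity.
  · have hδ : Tendsto (fun n : ℕ => (√ν * ‖z n‖) ^ 3 / n) atTop (𝓝 0) := by
      have h1 := (Real.continuous_sqrt.tendsto 0).comp hz
      rw [Real.sqrt_zero] at h1
      refine h1.congr fun n => ?_
      have e : (ν : ℝ) ^ 3 * ‖z n‖ ^ 6 / (n : ℝ) ^ 2 = ((√ν * ‖z n‖) ^ 3 / n) ^ 2 := by
        rw [div_pow, ← pow_mul, mul_pow]
        congr 2
        rw [show 3 * 2 = 2 * 3 by rfl, pow_mul, Real.sq_sqrt NNReal.zero_le_coe]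
      rw [Function.comp_apply, e, Real.sqrt_sq (by positivity)]
    refine ⟨tendstoInMeasure_X2 hν hW hδ, tendsto_measure_permanent_eq_zero hν hW hδ,
      fun ε hε => ?_⟩
    have e : (ν : ℝ) ^ (3 / 2 : ℝ) = √ν ^ 3 := by
      rw [Real.sqrt_eq_rpow, ← Real.rpow_natCast, ← Real.rpow_mul NNReal.zero_le_coe]
      norm_num
    have h := eventually_measure_remainder_le hν hW hδ (hc ε hε) (hC ε hε) (hcC ε hε)
    simpa only [e, ← mul_pow] using h
  · have hq : Tendsto (fun n : ℕ => ‖z n‖ / (n : ℝ) ^ (1 / 3 : ℝ)) atTop (𝓝 0) :=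
      hz.norm_left.tendsto_div_nhds_zero
    exact tendstoInDistribution_of_tendstoInMeasure_sub _ _ (tendstoInDistribution_D1 hν hW)
      (tendstoInMeasure_logPer_sub_D1 hν hW hq hz0)
      fun n => ((hW n).aemeasurable_logPer (z n)).sub_const _ |>.div_const _
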